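/- **Theorem 2.1.** Let $\theta\ge 1$ be an integer and let $\Sigma\subseteq\mathbb R$ be a closed set with nonempty interior and at most countable boundary (for instance a nondegenerate closed interval, or a closed set that is an at most countable union of nondegenerate intervals); if $\theta$ is even, assume $\Sigma\subseteq[0,\infty)$. Let $p(n)\ge 1$ be integers with $p(n)/n\to\kappa\in(0,\infty)$, and let $w_n:\Sigma\to[0,\infty)$ be continuous. Write $\mathcal N(f)$ for the set of zeros of $f$ in $\Sigma$. Assume: (a1) there is a continuous $w:\Sigma\to[0,\infty)$ such that $\mathcal N(w)$ is finite and $\mathcal N(w_n)\subseteq\mathcal N(w)$ for all large $n$; $w_n\to w$ uniformly on compact subsets of $\Sigma$, and $\log w_n\to\log w$ uniformly on compact subsets of $\Sigma\setminus\mathcal N(w)$; and $\log w$ is Lipschitz on every compact subset of $\Sigma\setminus\mathcal N(w)$; (a2) if $\Sigma$ is unbounded, there are $n_0\in\mathbb N$ and $\epsilon>0$ with $|x|^{(\theta+1)(\kappa+\epsilon)}\sup_{n\ge n_0}w_n(x)\to0$ as $|x|\to\infty$, $x\in\Sigma$. Put $$Z_n=\int_{\Sigma^{p(n)}}\prod_{i=1}^{p(n)}w_n(x_i)^n\prod_{i<j}|x_i-x_j|\,|x_i^\theta-x_j^\theta|\,dx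 .$$ Then $0<Z_n<\infty$ for all large $n$. For such $n$ let $Q_n$ be the probability measure on $\Sigma^{p(n)}$ with Lebesgue density $$q_n(x)=\frac1{Z_n}\prod_{i=1}^{p(n)}w_n(x_i)^n\prod_{i<j}|x_i-x_j|\,|x_i^\theta-x_j^\theta| ,$$ and let $L_n(x)=\frac1{p(n)}\sum_{j=1}^{p(n)}\delta_{x_j}$. For $x,y\in\Sigma$ let $$F(x,y)=\frac{\kappa^2}{2}\left(\log|x^\theta-y^\theta|^{-1}+\log|x-y|^{-1}\right)-\frac\kappa2\left(\log w(x)+\log w(y)\right),$$ with $F(x,y)=+\infty$ if $x=y$ or $w(x)w(y)=0$, and for $\mu$ in the space $\mathcal M_1(\Sigma)$ of Borel probability measures on $\Sigma$ let $H(\mu)=\iint F\,d\mu\,d\mu\in(-\infty,+\infty]$. That is, $$H(\mu)=\frac{\kappa^2}{2}\iint\left(\log|x^\theta-y^\theta|^{-1}+\log|x-y|^{-1}\right)d\mu(x)\,d\mu(y)-\kappa\int\log w\,d\mu ,$$ where the logarithmic terms are collected under one double integral. Then the limit $c:=\lim_{n\to\infty}n^{-2}\log Z_n$ exists, is finite,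 and equals $-\inf_{\mu\in\mathcal M_1(\Sigma)}H(\mu)$. Moreover $(Q_n\circ L_n^{-1})_n$ satisfies a large deviations principle on $\mathcal M_1(\Sigma)$ with the weak topology, with speed $n^2$ and good rate function $I(\mu)=H(\mu)+c$. This means that $I$ takes values in $[0,\infty]$, is lower semicontinuous and has compact level sets $\{I\le L\}$ for all $L\in[0,\infty)$, that for every open $G\subseteq\mathcal M_1(\Sigma)$ $$\liminf_{n\to\infty}\frac1{n^2}\log Q_n(L_n\in G)\ge-\inf_{\mu\in G}I(\mu),$$ and that for every closed $A\subseteq\mathcal M_1(\Sigma)$ $$\limsup_{n\to\infty}\frac1{n^2}\log Q_n(L_n\in A)\le-\inf_{\mu\in A}I(\mu).$$ -/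

import Mathlib

open MeasureTheory Filter Topology Set
open scoped ENNReal

noncomputable section

namespace BiorthogonalLDP

/-! ### Large deviations principles -/

/-- A good rate function `I : X → [0, ∞]`: nonnegative, lower semicontinuous, and with compact
level sets `{I ≤ L}` for every finite `L ≥ 0`. -/
structure IsGoodRateFunction {X : Type*} [TopologicalSpace X] (I : X → EReal) : Prop where
  nonneg : ∀ x, 0 ≤ I x
  lowerSemicontinuous : LowerSemicontinuous I
  isCompact_level : ∀ L : ℝ, 0 ≤ L → IsCompact {x | I x ≤ (L : EReal)}

/-- The sequence of laws `Q n ∘ (L n)⁻¹` on `X` satisfies the large deviations principle with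
speed `a n` and good rate function `I`. The logarithm takes the value `⊥` at `0`. -/
structure SatisfiesLDP {X : Type*} [TopologicalSpace X] {Ω : ℕ → Type*}
    [∀ n, MeasurableSpace (Ω n)] (Q : ∀ n, Measure (Ω n)) (L : ∀ n, Ω n → X)
    (a : ℕ → ℝ) (I : X → EReal) : Prop where
  good : IsGoodRateFunction I
  lower : ∀ G : Set X, IsOpen G →
    -(⨅ x ∈ G, I x) ≤ liminf (fun n => ENNReal.log (Q n (L n ⁻¹' G)) / (a n : EReal)) atTop
  upper : ∀ A : Set X, IsClosed A →
    limsup (fun n => ENNReal.log (Q n (L n ⁻¹' A)) / (a n : EReal)) atTop ≤ -(⨅ x ∈ A, I x)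

/-! ### The ensemble -/

/-- The unnormalised density
`∏ i, w(xᵢ)ⁿ * ∏_{i<j} |xᵢ - xⱼ| |xᵢ^θ - xⱼ^θ| * 1_{S^m}(x)` on `ℝ^m`
(used with the weight `w = w_n` and with `m = p(n)`). -/
def density (S : Set ℝ) (θ n m : ℕ) (w : ℝ → ℝ) (x : Fin m → ℝ) : ℝ :=
  {y : Fin m → ℝ | ∀ i, y i ∈ S}.indicator
    (fun x => (∏ i, w (x i) ^ n) *
      ∏ i, ∏ j ∈ Finset.Ioi i, (|x i - x j| * |x i ^ θ - x j ^ θ|)) x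

/-- The partition function, i.e. the Lebesgue integral of the unnormalised density. -/
def partitionFn (S : Set ℝ) (θ n m : ℕ) (w : ℝ → ℝ) : ℝ≥0∞ :=
  ∫⁻ x : Fin m → ℝ, ENNReal.ofReal (density S θ n m w x)

/-- The normalised ensemble as a measure on `ℝ^m`. -/
def ensemble (S : Set ℝ) (θ n m : ℕ) (w : ℝ → ℝ) : Measure (Fin m → ℝ) :=
  (partitionFn S θ n m w)⁻¹ •
    (volume : Measure (Fin m → ℝ)).withDensity fun x => ENNReal.ofReal (density S θ n m w x)

/-- The inclusion `S^m → ℝ^m`. -/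
def incl (S : Set ℝ) (m : ℕ) (x : Fin m → S) : Fin m → ℝ := fun i => (x i : ℝ)

/-- The normalised ensemble as a measure on `S^m`, on which it is concentrated. -/
def ensembleOn (S : Set ℝ) (θ n m : ℕ) (w : ℝ → ℝ) : Measure (Fin m → S) :=
  (ensemble S θ n m w).comap (incl S m)

/-- The empirical measure `(1/m) ∑ j, δ_{x_j}` of `m ≥ 1` points of `S`. -/
def empirical {S : Set ℝ} {m : ℕ} (hm : 0 < m) (x : Fin m → S) : ProbabilityMeasure S :=
  ⟨(m : ℝ≥0∞)⁻¹ • ∑ j, Measure.dirac (x j), ⟨by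
    have h0 : (m : ℝ≥0∞) ≠ 0 := by exact_mod_cast hm.ne'
    simp [ENNReal.inv_mul_cancel h0 (ENNReal.natCast_ne_top m)]⟩⟩

/-! ### Assumptions on the weights -/

/-- The zeros of `f` in `S`. -/
def zerosIn (S : Set ℝ) (f : ℝ → ℝ) : Set ℝ := {x ∈ S | f x = 0}

/-- Convergence of the weights `wn` to the limit weight `w` on `S`. -/
structure WeightsConverge (S : Set ℝ) (wn : ℕ → ℝ → ℝ) (w : ℝ → ℝ) : Prop where
  continuousOn : ContinuousOn w S
  nonneg : ∀ x ∈ S, 0 ≤ w x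
  finite_zeros : (zerosIn S w).Finite
  zeros_subset : ∀ᶠ n in atTop, zerosIn S (wn n) ⊆ zerosIn S w
  tendsto : ∀ K ⊆ S, IsCompact K → TendstoUniformlyOn wn w atTop K
  tendsto_log : ∀ K ⊆ S \ zerosIn S w, IsCompact K →
    TendstoUniformlyOn (fun n x => Real.log (wn n x)) (fun x => Real.log (w x)) atTop K
  lipschitz_log : ∀ K ⊆ S \ zerosIn S w, IsCompact K →
    ∃ C, LipschitzOnWith C (fun x => Real.log (w x)) K

/-- Decay of the weights at infinity along `S`, uniformly in `n ≥ n₀`. -/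
def TailDecay (S : Set ℝ) (θ : ℕ) (κ : ℝ) (wn : ℕ → ℝ → ℝ) : Prop :=
  ¬ Bornology.IsBounded S → ∃ n₀ : ℕ, ∃ ε : ℝ, 0 < ε ∧
    Tendsto (fun x : ℝ => ENNReal.ofReal (|x| ^ (((θ : ℝ) + 1) * (κ + ε))) *
        ⨆ n ≥ n₀, ENNReal.ofReal (wn n x))
      (Bornology.cobounded ℝ ⊓ 𝓟 S) (𝓝 0)

/-! ### The energy -/

/-- The integral of an extended-real function that is bounded below (or whose negative part is
integrable): integral of the positive part minus integral of the negative part. -/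
def eintegral {α : Type*} [MeasurableSpace α] (μ : Measure α) (f : α → EReal) : EReal :=
  ((∫⁻ x, (f x).toENNReal ∂μ : ℝ≥0∞) : EReal) - ((∫⁻ x, (-f x).toENNReal ∂μ : ℝ≥0∞) : EReal)

open Classical in
/-- `F(x,y) = (κ²/2) (log |x^θ - y^θ|⁻¹ + log |x - y|⁻¹) - (κ/2) (log w(x) + log w(y))`,
with the value `∞` if `x^θ = y^θ` or if `w` vanishes at `x` or `y`. -/
def kernelF (θ : ℕ) (κ : ℝ) (w : ℝ → ℝ) (x y : ℝ) : EReal :=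
  if x ^ θ = y ^ θ ∨ w x = 0 ∨ w y = 0 then ⊤
  else ((κ ^ 2 / 2 * (Real.log |x ^ θ - y ^ θ|⁻¹ + Real.log |x - y|⁻¹)
    - κ / 2 * (Real.log (w x) + Real.log (w y)) : ℝ) : EReal)

/-- The weighted energy `μ ↦ ∬ F dμ dμ`, i.e.
`(κ²/2) ∬ (log |x^θ - y^θ|⁻¹ + log |x - y|⁻¹) dμ dμ - κ ∫ log w dμ` with the three logarithmic
terms collected under one double integral, so that no `∞ - ∞` can occur. -/
def energy (S : Set ℝ) (θ : ℕ) (κ : ℝ) (w : ℝ → ℝ) (μ : ProbabilityMeasure S) : EReal :=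
  eintegral ((μ : Measure S).prod (μ : Measure S)) fun z => kernelF θ κ w z.1 z.2

end BiorthogonalLDP

end

noncomputable section

namespace BiorthogonalLDP

/-! ### Products over pairs of indices -/

/-! Put E(x,y) = |x-y| |x^θ-y^θ| (w(x) w(y))^(1/κ), so that F = -(κ²/2) log E. The square of the
unnormalised density is a product over ordered pairs: each particle has p(n)-1 partners, and
spreading w_n^n over them turns the weight into w_n^(n/(p(n)-1)), whose limit is w^(1/κ). The
logarithm of the density is therefore close to -n² times the energy of the empirical measure, up to
the diagonal and the singularities of log E. The tail assumption makes E bounded, E + 1 ≤ B, so the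
cost (κ²/2)(log B - log E) is nonnegative, and by `energy_eq` H is its double integral minus (κ²/2)
log B.

Upper bound (`eventually_lintegral_le`). Replacing E by E + η makes the cost bounded and continuous,
at the price of O(n) in the exponent for the diagonal. On a compact set of measures one η serves for
all measures at once. Compactness comes from a moment g(x) = δ log(1+|x|), and measures with a large
moment are handled directly by the polynomial decay of the pair interaction. A factor (1+x²)⁻¹ per
particle is set aside to make the density integrable; its total mass is only exponential in n.

Lower bound (`eventually_le_lintegral`). If ν ≤ M · Lebesgue lives on a compact set away from the
zeros of w, sample the particles independently from ν. Chebyshev's inequality puts the empirical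
measure near ν with probability tending to 1, while Markov's inequality bounds the pair cost by
slightly more than its mean with probability bounded below. Comparison with Lebesgue measure costs
M^p(n), negligible at speed n². A general μ of finite energy has no atoms, hence does not see the
boundary of S, the zeros of w or the origin; it is conditioned on a compact set and convolved with a
small uniform law (`exists_bounded_density_approx`).

Both bounds concern unnormalised masses. Applied to the whole space they give the asymptotics of
Z_n, and division gives the large deviations principle (`satisfiesLDP_of_exponential_bounds`). -/

lemma sq_prod_prod_Ioi {M : Type*} [CommMonoid M] {m : ℕ} (f : Fin m → Fin m → M)
    (hf : ∀ i j, f i j = f j i) :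
    (∏ i, ∏ j ∈ Finset.Ioi i, f i j) ^ 2 = ∏ i, ∏ j ∈ {i}ᶜ, f i j := by
  calc (∏ i, ∏ j ∈ Finset.Ioi i, f i j) ^ 2
      = ∏ i, ∏ j ∈ Finset.Ioi i, f j i * f i j := by
        simp_rw [Finset.prod_mul_distrib, sq]
        congr 1
        exact Finset.prod_congr rfl fun i _ => Finset.prod_congr rfl fun j _ => hf i j
    _ = ∏ i, ∏ j ∈ {i}ᶜ, f j i := Finset.prod_prod_Ioi_mul_eq_prod_prod_off_diag f
    _ = _ := Finset.prod_congr rfl fun i _ => Finset.prod_congr rfl fun j _ => hf j i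

/-- Each index occurs in 2(m-1) ordered pairs, m-1 times in either position. This is the count by
which one-particle weights are spread over pairs. -/
lemma prod_offDiag_mul {M : Type*} [CommMonoid M] {m : ℕ} (a : Fin m → M) :
    ∏ i, ∏ j ∈ ({i}ᶜ : Finset (Fin m)), (a i * a j) = ∏ i, a i ^ (2 * (m - 1)) := by
  have hcard : ∀ i : Fin m, ({i}ᶜ : Finset (Fin m)).card = m - 1 := fun i => by
    rw [Finset.card_compl]; simp
  have h1 : ∏ i, ∏ j ∈ ({i}ᶜ : Finset (Fin m)), a i = ∏ i, a i ^ (m - 1) :=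
    Finset.prod_congr rfl fun i _ => by rw [Finset.prod_const, hcard]
  have h2 : ∏ i, ∏ j ∈ ({i}ᶜ : Finset (Fin m)), a j = ∏ i, a i ^ (m - 1) := by
    rw [← h1]
    refine Finset.prod_comm' fun i j => ?_
    simp [ne_comm]
  simp_rw [Finset.prod_mul_distrib]
  rw [h1, h2, ← Finset.prod_mul_distrib]
  refine Finset.prod_congr rfl fun i _ => ?_
  rw [two_mul, pow_add]

lemma prod_offDiag_const {m : ℕ} (c : ℝ) :
    ∏ i : Fin m, ∏ _j ∈ ({i}ᶜ : Finset (Fin m)), c = c ^ (m * (m - 1)) := by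
  have hcard : ∀ i : Fin m, ({i}ᶜ : Finset (Fin m)).card = m - 1 := fun i => by
    rw [Finset.card_compl]; simp
  simp [hcard, ← pow_mul, mul_comm]

/-! ### Product measures -/

section Pi

variable {X : Type*} [MeasurableSpace X]

/-- It suffices to compare on boxes, because the product measure comes from the largest outer
measure dominated by the box products. This is the passage from independent samples of ν to Lebesgue
measure. -/
lemma pi_le_smul_pi {μ ν : Measure X} [SigmaFinite μ] [SigmaFinite ν] {M : ℝ≥0∞}
    (hM0 : M ≠ 0) (hM : M ≠ ∞) (h : μ ≤ M • ν) (m : ℕ) :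
    Measure.pi (fun _ : Fin m => μ) ≤ M ^ m • Measure.pi (fun _ : Fin m => ν) := by
  have key : ((M ^ m)⁻¹ • Measure.pi (fun _ : Fin m => μ)).toOuterMeasure ≤
      OuterMeasure.pi fun _ : Fin m => ν.toOuterMeasure := by
    rw [OuterMeasure.le_pi]
    intro s _
    have : ((M ^ m)⁻¹ • Measure.pi (fun _ : Fin m => μ)) (pi univ s) ≤ ∏ i, ν (s i) := by
      rw [Measure.smul_apply, Measure.pi_pi, smul_eq_mul,
        ENNReal.inv_mul_le_iff (pow_ne_zero _ hM0) (ENNReal.pow_ne_top hM)]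
      calc ∏ i, μ (s i) ≤ ∏ i, (M * ν (s i)) :=
            Finset.prod_le_prod' fun i _ => by simpa using h (s i)
        _ = M ^ m * ∏ i, ν (s i) := by simp [Finset.prod_mul_distrib]
    exact this
  have key2 : ((M ^ m)⁻¹ • Measure.pi (fun _ : Fin m => μ)) ≤ Measure.pi fun _ : Fin m => ν := by
    refine Measure.le_iff.2 fun s hs => ?_
    conv_rhs => rw [Measure.pi, toMeasure_apply _ _ hs]
    exact key s
  intro s
  have := key2 s
  rw [Measure.smul_apply, smul_eq_mul,
    ENNReal.inv_mul_le_iff (pow_ne_zero _ hM0) (ENNReal.pow_ne_top hM)] at this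
  simpa using this

lemma lintegral_prod_pi_eq_pow {ν : Measure X} [SigmaFinite ν] {h : X → ℝ} (h0 : ∀ x, 0 ≤ h x)
    (hint : Integrable h ν) (m : ℕ) :
    ∫⁻ x : Fin m → X, ENNReal.ofReal (∏ i, h (x i)) ∂(Measure.pi fun _ => ν) =
      ENNReal.ofReal ((∫ x, h x ∂ν) ^ m) := by
  rw [← ofReal_integral_eq_lintegral_ofReal]
  · congr 1
    rw [integral_fintype_prod_eq_prod (fun _ : Fin m => h)]
    simp
  · exact Integrable.fintype_prod (f := fun _ : Fin m => h) fun _ => hint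
  · exact Eventually.of_forall fun x => Finset.prod_nonneg fun i _ => h0 _

lemma pi_map_pair {ν : Measure X} [IsProbabilityMeasure ν] {m : ℕ} {i j : Fin m} (hij : i ≠ j) :
    (Measure.pi fun _ : Fin m => ν).map (fun x => (x i, x j)) = ν.prod ν := by
  have hind : ProbabilityTheory.iIndepFun (fun (i : Fin m) (x : Fin m → X) => x i)
      (Measure.pi fun _ : Fin m => ν) :=
    ProbabilityTheory.iIndepFun_pi (X := fun _ => id) fun _ => aemeasurable_id
  have h2 := (ProbabilityTheory.indepFun_iff_map_prod_eq_prod_map_map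
    (measurable_pi_apply i).aemeasurable (measurable_pi_apply j).aemeasurable).1
      (hind.indepFun hij)
  rw [h2, (measurePreserving_eval (fun _ : Fin m => ν) i).map_eq,
    (measurePreserving_eval (fun _ : Fin m => ν) j).map_eq]

/-- Only the mean of the pair sum is needed later, for Markov's inequality; distinct coordinates
have joint law ν ⊗ ν. -/
lemma lintegral_sum_offDiag {ν : Measure X} [IsProbabilityMeasure ν] {Y : X × X → ℝ≥0∞}
    (hY : Measurable Y) (m : ℕ) :
    ∫⁻ x : Fin m → X, ∑ i, ∑ j ∈ {i}ᶜ, Y (x i, x j) ∂(Measure.pi fun _ => ν) =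
      (m * (m - 1) : ℕ) * ∫⁻ z, Y z ∂(ν.prod ν) := by
  have hpair : ∀ i j : Fin m, Measurable fun x : Fin m → X => (x i, x j) := fun i j =>
    (measurable_pi_apply i).prodMk (measurable_pi_apply j)
  have hm : ∀ i j : Fin m, Measurable fun x : Fin m → X => Y (x i, x j) := fun i j =>
    hY.comp (hpair i j)
  rw [lintegral_finsetSum _ fun i _ => Finset.measurable_fun_sum _ fun j _ => hm i j]
  have : ∀ i : Fin m, ∫⁻ x : Fin m → X, ∑ j ∈ {i}ᶜ, Y (x i, x j) ∂(Measure.pi fun _ => ν) =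
      (m - 1 : ℕ) * ∫⁻ z, Y z ∂(ν.prod ν) := by
    intro i
    rw [lintegral_finsetSum _ fun j _ => hm i j]
    rw [Finset.sum_congr rfl (g := fun _ => ∫⁻ z, Y z ∂(ν.prod ν))]
    · rw [Finset.sum_const, Finset.card_compl]; simp
    · intro j hj
      have hij : i ≠ j := by simpa [eq_comm] using hj
      rw [← pi_map_pair hij, lintegral_map hY (hpair i j)]
  simp_rw [this]
  simp [mul_assoc]

end Pi

/-! ### Weak law of large numbers for empirical measures -/

section Empirical

variable {S : Set ℝ}

lemma integral_empirical {m : ℕ} (hm : 0 < m) (x : Fin m → S) (f : S → ℝ) :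
    ∫ y, f y ∂(empirical hm x : Measure S) = (m : ℝ)⁻¹ * ∑ j, f (x j) := by
  change ∫ y, f y ∂((m : ℝ≥0∞)⁻¹ • ∑ j, Measure.dirac (x j)) = _
  rw [integral_smul_measure, integral_finsetSum_measure]
  · simp
  · intro i _
    exact (integrable_dirac (by simp))

lemma lintegral_empirical {m : ℕ} (hm : 0 < m) (x : Fin m → S) (f : S → ℝ≥0∞) :
    ∫⁻ y, f y ∂(empirical hm x : Measure S) = (m : ℝ≥0∞)⁻¹ * ∑ j, f (x j) := by
  change ∫⁻ y, f y ∂((m : ℝ≥0∞)⁻¹ • ∑ j, Measure.dirac (x j)) = _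
  rw [lintegral_smul_measure, lintegral_finsetSum_measure]
  simp

/-- The sets whose complements have vanishing probability form a filter, and the claim is that it
converges to ν. Weak convergence can then be tested on one bounded continuous function at a time,
where Chebyshev's inequality applies. -/
lemma tendsto_pi_empirical_compl (ν : ProbabilityMeasure S) (p : ℕ → ℕ) (hp : ∀ n, 0 < p n)
    (hpt : Tendsto p atTop atTop) {G : Set (ProbabilityMeasure S)} (hG : G ∈ 𝓝 ν) :
    Tendsto (fun n => (Measure.pi fun _ : Fin (p n) => (ν : Measure S))
      (empirical (hp n) ⁻¹' Gᶜ)) atTop (𝓝 0) := by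
  let P : ∀ n, Measure (Fin (p n) → S) := fun n => Measure.pi fun _ => (ν : Measure S)
  let F : Filter (ProbabilityMeasure S) :=
    { sets := {A | Tendsto (fun n => P n (empirical (hp n) ⁻¹' Aᶜ)) atTop (𝓝 0)}
      univ_sets := by simp
      sets_of_superset := by
        intro A B hA hAB
        exact tendsto_of_tendsto_of_tendsto_of_le_of_le tendsto_const_nhds hA
          (fun _ => zero_le) fun n => measure_mono (preimage_mono (compl_subset_compl.2 hAB))
      inter_sets := by
        intro A B hA hB
        have := Tendsto.add hA hB
        rw [add_zero] at this
        refine tendsto_of_tendsto_of_tendsto_of_le_of_le tendsto_const_nhds this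
          (fun _ => zero_le) fun n => ?_
        simp only [compl_inter, preimage_union]
        exact measure_union_le _ _ }
  suffices h : Tendsto id F (𝓝 ν) from h hG
  rw [ProbabilityMeasure.tendsto_iff_forall_integral_tendsto]
  intro f
  rw [Metric.tendsto_nhds]
  intro ε hε
  change Tendsto (fun n => P n (empirical (hp n) ⁻¹' _)) atTop (𝓝 0)
  have hmem : MemLp (fun y => f y) 2 (ν : Measure S) :=
    MemLp.of_bound f.continuous.aestronglyMeasurable ‖f‖
      (Eventually.of_forall fun y => f.norm_coe_le_norm y)
  set V := ProbabilityTheory.variance (fun y => f y) (ν : Measure S)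
  have hbound : ∀ n, P n (empirical (hp n) ⁻¹'
      {μ | dist (∫ y, f y ∂(id μ : Measure S)) (∫ y, f y ∂(ν : Measure S)) < ε}ᶜ) ≤
      ENNReal.ofReal (V / ε ^ 2 / p n) := by
    intro n
    have hpn : (0 : ℝ) < p n := by exact_mod_cast hp n
    let X : (Fin (p n) → S) → ℝ := ∑ j, fun x => f (x j)
    have hX : MemLp X 2 (P n) := memLp_finsetSum' _ fun j _ =>
      hmem.comp_measurePreserving (measurePreserving_eval (fun _ : Fin (p n) => (ν : Measure S)) j)
    have hvar : ProbabilityTheory.variance X (P n) = p n * V := by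
      have := ProbabilityTheory.variance_sum_pi (μ := fun _ : Fin (p n) => (ν : Measure S))
        (X := fun _ y => f y) fun _ => hmem
      simpa [X, P, V] using this
    have hmean : ∫ x, X x ∂(P n) = p n * ∫ y, f y ∂(ν : Measure S) := by
      simp only [X, Finset.sum_apply]
      rw [integral_finsetSum]
      · have : ∀ j : Fin (p n), ∫ x, f (x j) ∂(P n) = ∫ y, f y ∂(ν : Measure S) := by
          intro j
          have hmp := measurePreserving_eval (fun _ : Fin (p n) => (ν : Measure S)) j
          rw [← hmp.map_eq, integral_map hmp.measurable.aemeasurable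
            f.continuous.aestronglyMeasurable]
        simp [this]
      · intro j _
        exact (hmem.comp_measurePreserving (measurePreserving_eval
          (fun _ : Fin (p n) => (ν : Measure S)) j)).integrable (by norm_num)
    have hch := ProbabilityTheory.meas_ge_le_variance_div_sq hX (c := p n * ε) (by positivity)
    rw [hvar, hmean] at hch
    refine (measure_mono ?_).trans (hch.trans (le_of_eq ?_))
    · intro x hx
      simp only [mem_preimage, mem_compl_iff, mem_ofPred_eq, not_lt, id] at hx ⊢
      rw [integral_empirical, Real.dist_eq] at hx
      have : X x - p n * ∫ y, f y ∂(ν : Measure S) =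
          p n * ((p n : ℝ)⁻¹ * ∑ j, f (x j) - ∫ y, f y ∂(ν : Measure S)) := by
        simp only [X, Finset.sum_apply]; field_simp
      rw [this, abs_mul, abs_of_pos hpn]
      gcongr
    · congr 1; field_simp
  refine tendsto_of_tendsto_of_tendsto_of_le_of_le tendsto_const_nhds ?_
    (fun _ => zero_le) hbound
  have : Tendsto (fun n => V / ε ^ 2 / (p n : ℝ)) atTop (𝓝 0) :=
    (tendsto_const_nhds.div_atTop (tendsto_natCast_atTop_atTop.comp hpt))
  simpa using ENNReal.tendsto_ofReal this

end Empirical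

/-! ### Growth of the number of particles -/

section Growth

variable {p : ℕ → ℕ} {κ : ℝ}

lemma tendsto_atTop_of_ratio (hκ : 0 < κ)
    (hpκ : Tendsto (fun n : ℕ => (p n : ℝ) / (n : ℝ)) atTop (𝓝 κ)) : Tendsto p atTop atTop := by
  rw [← tendsto_natCast_atTop_iff (R := ℝ)]
  have h := Tendsto.pos_mul_atTop hκ hpκ (tendsto_natCast_atTop_atTop (R := ℝ))
  refine h.congr' ?_
  filter_upwards [eventually_gt_atTop 0] with n hn
  have : (n : ℝ) ≠ 0 := by exact_mod_cast hn.ne'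
  field_simp

lemma tendsto_ratio_div (hpκ : Tendsto (fun n : ℕ => (p n : ℝ) / (n : ℝ)) atTop (𝓝 κ)) :
    Tendsto (fun n : ℕ => (p n : ℝ) / (n : ℝ) ^ 2) atTop (𝓝 0) := by
  have := hpκ.mul (tendsto_inv_atTop_nhds_zero_nat (𝕜 := ℝ))
  rw [mul_zero] at this
  refine this.congr fun n => ?_
  rw [sq, div_mul_eq_div_div, div_eq_mul_inv (_ / _)]

lemma tendsto_ratio_sq (hpκ : Tendsto (fun n : ℕ => (p n : ℝ) / (n : ℝ)) atTop (𝓝 κ)) :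
    Tendsto (fun n : ℕ => (p n : ℝ) ^ 2 / (n : ℝ) ^ 2) atTop (𝓝 (κ ^ 2)) := by
  simpa [div_pow] using hpκ.pow 2

lemma tendsto_const_div_sq (c : ℝ) :
    Tendsto (fun n : ℕ => c / (n : ℝ) ^ 2) atTop (𝓝 0) :=
  tendsto_const_nhds.div_atTop
    ((tendsto_pow_atTop two_ne_zero).comp (tendsto_natCast_atTop_atTop (R := ℝ)))

/-- Every exponent below is a quadratic polynomial in p(n). Only its leading coefficient survives at
speed n², so diagonal terms and masses to the power p(n) are harmless. -/
lemma tendsto_quadratic_div (hpκ : Tendsto (fun n : ℕ => (p n : ℝ) / (n : ℝ)) atTop (𝓝 κ))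
    (a b c : ℝ) :
    Tendsto (fun n : ℕ => (a * (p n : ℝ) ^ 2 + b * p n + c) / (n : ℝ) ^ 2) atTop
      (𝓝 (a * κ ^ 2)) := by
  have := (((tendsto_ratio_sq hpκ).const_mul a).add ((tendsto_ratio_div hpκ).const_mul b)).add
    (tendsto_const_div_sq c)
  simp only [mul_zero, add_zero] at this
  refine this.congr fun n => ?_
  ring

lemma eventually_quadratic_le (hpκ : Tendsto (fun n : ℕ => (p n : ℝ) / (n : ℝ)) atTop (𝓝 κ))
    {a : ℝ} (b c : ℝ) {d : ℝ} (h : a * κ ^ 2 < d) :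
    ∀ᶠ n : ℕ in atTop, a * (p n : ℝ) ^ 2 + b * p n + c ≤ d * (n : ℝ) ^ 2 := by
  filter_upwards [(tendsto_quadratic_div hpκ a b c).eventually_lt_const h,
    eventually_gt_atTop 0] with n hn hn0
  have : (0 : ℝ) < (n : ℝ) ^ 2 := by positivity
  exact ((div_lt_iff₀ this).1 hn).le

lemma eventually_le_quadratic (hpκ : Tendsto (fun n : ℕ => (p n : ℝ) / (n : ℝ)) atTop (𝓝 κ))
    {a : ℝ} (b c : ℝ) {d : ℝ} (h : d < a * κ ^ 2) :
    ∀ᶠ n : ℕ in atTop, d * (n : ℝ) ^ 2 ≤ a * (p n : ℝ) ^ 2 + b * p n + c := by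
  filter_upwards [(tendsto_quadratic_div hpκ a b c).eventually_const_lt h,
    eventually_gt_atTop 0] with n hn hn0
  have : (0 : ℝ) < (n : ℝ) ^ 2 := by positivity
  exact ((lt_div_iff₀ this).1 hn).le

end Growth

/-! ### The energy functional of a multiplicative pair interaction -/

section Functional

variable {S : Set ℝ}

open Classical in
/-- `(κ²/2) (log B - log E)`, infinite where `E` vanishes. -/
def cost (κ B : ℝ) (E : S × S → ℝ) (z : S × S) : ℝ≥0∞ :=
  if E z = 0 then ∞ else ENNReal.ofReal (κ ^ 2 / 2 * (Real.log B - Real.log (E z)))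

/-- The regularisation `(κ²/2) (log B - log (E + η))` of `cost`. -/
def regCost (κ B η : ℝ) (E : S × S → ℝ) (z : S × S) : ℝ :=
  κ ^ 2 / 2 * (Real.log B - Real.log (E z + η))

/-- The double integral of `cost`. -/
def costEnergy (κ B : ℝ) (E : S × S → ℝ) (μ : ProbabilityMeasure S) : ℝ≥0∞ :=
  ∫⁻ z, cost κ B E z ∂((μ : Measure S).prod (μ : Measure S))

variable {κ B η : ℝ} {E : S × S → ℝ}

lemma regCost_nonneg (hE0 : ∀ z, 0 ≤ E z) (hEB : ∀ z, E z + 1 ≤ B) (hη : 0 < η) (hη1 : η ≤ 1)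
    (z : S × S) : 0 ≤ regCost κ B η E z := by
  have := hE0 z
  have h2 := hEB z
  have : Real.log (E z + η) ≤ Real.log B := Real.log_le_log (by linarith) (by linarith)
  unfold regCost
  have : 0 ≤ Real.log B - Real.log (E z + η) := by linarith
  positivity

lemma continuous_regCost (hE : Continuous E) (hE0 : ∀ z, 0 ≤ E z) (hη : 0 < η) :
    Continuous (regCost κ B η E) := by
  unfold regCost
  have : Continuous fun z => Real.log (E z + η) :=
    (hE.add continuous_const).log fun z => by have := hE0 z; exact (by linarith : 0 < E z + η).ne'
  fun_prop

lemma regCost_le (hE0 : ∀ z, 0 ≤ E z) (hη : 0 < η) (z : S × S) :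
    regCost κ B η E z ≤ κ ^ 2 / 2 * (Real.log B - Real.log η) := by
  unfold regCost
  have : Real.log η ≤ Real.log (E z + η) := Real.log_le_log hη (by linarith [hE0 z])
  gcongr

lemma measurable_cost (hE : Measurable E) : Measurable (cost κ B E) := by
  unfold cost
  exact Measurable.ite (hE (measurableSet_singleton 0)) measurable_const (by fun_prop)

lemma monotone_regCost (hE0 : ∀ z, 0 ≤ E z) (z : S × S) :
    Monotone fun k : ℕ => ENNReal.ofReal (regCost κ B (1 / ((k : ℝ) + 1)) E z) := by
  intro k l hkl
  refine ENNReal.ofReal_le_ofReal ?_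
  unfold regCost
  have h1 : Real.log (E z + 1 / ((l : ℝ) + 1)) ≤ Real.log (E z + 1 / ((k : ℝ) + 1)) := by
    refine Real.log_le_log (by have := hE0 z; positivity) ?_
    have : (k : ℝ) ≤ l := by exact_mod_cast hkl
    gcongr
  gcongr

lemma iSup_regCost (hκ : 0 < κ) (hE0 : ∀ z, 0 ≤ E z) (z : S × S) :
    ⨆ k : ℕ, ENNReal.ofReal (regCost κ B (1 / ((k : ℝ) + 1)) E z) = cost κ B E z := by
  refine iSup_eq_of_tendsto (monotone_regCost hE0 z) ?_
  have h0 : Tendsto (fun k : ℕ => E z + 1 / ((k : ℝ) + 1)) atTop (𝓝 (E z)) := by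
    simpa using (tendsto_const_nhds (x := E z)).add (tendsto_one_div_add_atTop_nhds_zero_nat (𝕜 := ℝ))
  unfold cost regCost
  split_ifs with h
  · refine ENNReal.tendsto_ofReal_atTop.comp ?_
    have h1 : Tendsto (fun k : ℕ => E z + 1 / ((k : ℝ) + 1)) atTop (𝓝[>] 0) := by
      refine tendsto_nhdsWithin_iff.2 ⟨h ▸ h0, Eventually.of_forall fun k => ?_⟩
      rw [h, mem_Ioi]; positivity
    have h2 := tendsto_neg_atBot_atTop.comp (Real.tendsto_log_nhdsGT_zero.comp h1)
    have h3 := tendsto_atTop_add_const_left atTop (Real.log B) h2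
    exact Tendsto.const_mul_atTop (by positivity) h3
  · refine ENNReal.tendsto_ofReal (Tendsto.const_mul _ (tendsto_const_nhds.sub ?_))
    exact h0.log h

lemma costEnergy_eq_iSup (hκ : 0 < κ) (hE : Continuous E) (hE0 : ∀ z, 0 ≤ E z)
    (μ : ProbabilityMeasure S) :
    costEnergy κ B E μ = ⨆ k : ℕ, ∫⁻ z, ENNReal.ofReal (regCost κ B (1 / ((k : ℝ) + 1)) E z)
      ∂((μ : Measure S).prod (μ : Measure S)) := by
  unfold costEnergy
  rw [← lintegral_iSup]
  · simp_rw [iSup_regCost hκ hE0]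
  · intro k
    exact (continuous_regCost hE hE0 (by positivity)).measurable.ennreal_ofReal
  · intro k l hkl z
    exact monotone_regCost hE0 z hkl

/-- The shift by η keeps the logarithm away from its singularity, so the integrand is bounded and
continuous, and μ ↦ μ ⊗ μ is weakly continuous. -/
lemma continuous_lintegral_regCost (hE : Continuous E) (hE0 : ∀ z, 0 ≤ E z) (hη : 0 < η) :
    Continuous fun μ : ProbabilityMeasure S =>
      ∫⁻ z, ENNReal.ofReal (regCost κ B η E z) ∂((μ : Measure S).prod (μ : Measure S)) := by
  set C := max (κ ^ 2 / 2 * (Real.log B - Real.log η)) 0 with hC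
  let f : BoundedContinuousFunction (S × S) NNReal :=
    BoundedContinuousFunction.mkOfBound
      ⟨fun z => (regCost κ B η E z).toNNReal,
        continuous_real_toNNReal.comp (continuous_regCost hE hE0 hη)⟩ C (by
        intro z z'
        have h1 : ∀ z, max (regCost κ B η E z) 0 ≤ C :=
          fun z => max_le_max_right _ (regCost_le hE0 hη z)
        simp only [ContinuousMap.coe_mk, NNReal.dist_eq, Real.coe_toNNReal']
        rw [abs_le]
        constructor <;> linarith [h1 z, h1 z', le_max_right (regCost κ B η E z) 0,
          le_max_right (regCost κ B η E z') 0])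
  have h1 : Continuous fun ρ : ProbabilityMeasure (S × S) =>
      ∫⁻ z, ENNReal.ofReal (regCost κ B η E z) ∂(ρ : Measure (S × S)) := by
    refine continuous_iff_continuousAt.2 fun ρ => ?_
    exact (ProbabilityMeasure.tendsto_iff_forall_lintegral_tendsto.1 tendsto_id) f
  have h2 : Continuous fun μ : ProbabilityMeasure S => (μ.prod μ : ProbabilityMeasure (S × S)) :=
    ProbabilityMeasure.continuous_prod.comp (continuous_id.prodMk continuous_id)
  exact h1.comp h2

lemma lowerSemicontinuous_costEnergy (hκ : 0 < κ) (hE : Continuous E) (hE0 : ∀ z, 0 ≤ E z) :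
    LowerSemicontinuous (costEnergy κ B E) := by
  have : costEnergy κ B E = fun μ : ProbabilityMeasure S => ⨆ k : ℕ, ∫⁻ z,
      ENNReal.ofReal (regCost κ B (1 / ((k : ℝ) + 1)) E z)
        ∂((μ : Measure S).prod (μ : Measure S)) :=
    funext fun μ => costEnergy_eq_iSup hκ hE hE0 μ
  rw [this]
  exact lowerSemicontinuous_iSup fun k =>
    (continuous_lintegral_regCost hE hE0 (by positivity)).lowerSemicontinuous

/-- Probability measures with a bounded moment of a function with compact sublevel sets form a
relatively compact set. -/
lemma isCompact_closure_moment_le {g : S → ℝ} (hg : Measurable g)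
    (hgc : ∀ r, IsCompact {x | g x ≤ r}) (R : ℝ) :
    IsCompact (closure {μ : ProbabilityMeasure S |
      ∫⁻ x, ENNReal.ofReal (g x) ∂(μ : Measure S) ≤ ENNReal.ofReal R}) := by
  apply isCompact_closure_of_isTightMeasureSet
  rw [isTightMeasureSet_iff_exists_isCompact_measure_compl_le]
  intro ε hε
  rcases eq_or_ne ε ∞ with rfl | hε'
  · exact ⟨∅, isCompact_empty, by simp⟩
  set e := ε.toReal
  have he : 0 < e := ENNReal.toReal_pos hε.ne' hε'
  set r := (|R| + 1) / e
  have hr : 0 < r := by positivity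
  refine ⟨_, hgc r, ?_⟩
  rintro _ ⟨μ, hμ, rfl⟩
  have h1 := mul_meas_ge_le_lintegral (μ := (μ : Measure S)) hg.ennreal_ofReal (ENNReal.ofReal r)
  have h2 : (μ : Measure S) {x | g x ≤ r}ᶜ ≤
      (μ : Measure S) {x | ENNReal.ofReal r ≤ ENNReal.ofReal (g x)} := by
    refine measure_mono fun x hx => ?_
    simp only [mem_compl_iff, mem_ofPred_eq, not_le] at hx ⊢
    exact ENNReal.ofReal_le_ofReal hx.le
  have h3 : ENNReal.ofReal r * (μ : Measure S) {x | g x ≤ r}ᶜ ≤ ENNReal.ofReal (|R| + 1) :=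
    calc _ ≤ _ := by gcongr
      _ ≤ _ := h1
      _ ≤ _ := hμ
      _ ≤ _ := ENNReal.ofReal_le_ofReal (by linarith [le_abs_self R])
  have h4 : ENNReal.ofReal (|R| + 1) = ENNReal.ofReal r * ε := by
    rw [← ENNReal.ofReal_toReal hε', ← ENNReal.ofReal_mul hr.le]
    congr 1
    change _ = (|R| + 1) / e * e
    rw [div_mul_cancel₀ _ he.ne']
  rw [h4] at h3
  exact (ENNReal.mul_le_mul_iff_right (ENNReal.ofReal_pos.2 hr).ne' ENNReal.ofReal_ne_top).1 h3

/-- The decay of E gives cost(x,y) ≥ (κ²/2)(g(x) + g(y)); one of the two terms is dropped. This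
coercivity is what makes the level sets of the energy compact. -/
lemma moment_le_costEnergy (hκ : 0 < κ) (hB : 0 < B) {g : S → ℝ} (hg : Measurable g)
    (hg0 : ∀ x, 0 ≤ g x) (hE0 : ∀ z, 0 ≤ E z)
    (hEg : ∀ x y, E (x, y) ≤ B * Real.exp (-g x - g y)) (μ : ProbabilityMeasure S) :
    ENNReal.ofReal (κ ^ 2 / 2) * ∫⁻ x, ENNReal.ofReal (g x) ∂(μ : Measure S) ≤
      costEnergy κ B E μ := by
  have h1 : ∫⁻ z : S × S, ENNReal.ofReal (κ ^ 2 / 2) * ENNReal.ofReal (g z.1)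
      ∂((μ : Measure S).prod (μ : Measure S)) =
      ENNReal.ofReal (κ ^ 2 / 2) * ∫⁻ x, ENNReal.ofReal (g x) ∂(μ : Measure S) := by
    rw [lintegral_prod _ (by fun_prop)]
    simp only [lintegral_const, measure_univ, mul_one]
    rw [lintegral_const_mul _ (by fun_prop)]
  rw [← h1]
  refine lintegral_mono fun z => ?_
  unfold cost
  split_ifs with h
  · exact le_top
  · rw [← ENNReal.ofReal_mul (by positivity)]
    refine ENNReal.ofReal_le_ofReal ?_
    have hpos : 0 < E z := lt_of_le_of_ne (hE0 z) (Ne.symm h)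
    have h2 : Real.log (E z) ≤ Real.log B + (-g z.1 - g z.2) := by
      rw [← Real.log_exp (-g z.1 - g z.2), ← Real.log_mul hB.ne' (Real.exp_pos _).ne']
      exact Real.log_le_log hpos (hEg z.1 z.2)
    have := hg0 z.2
    gcongr
    linarith

lemma isCompact_costEnergy_le (hκ : 0 < κ) (hB : 0 < B) (hE : Continuous E) {g : S → ℝ}
    (hg : Measurable g) (hg0 : ∀ x, 0 ≤ g x) (hgc : ∀ r, IsCompact {x | g x ≤ r})
    (hE0 : ∀ z, 0 ≤ E z) (hEg : ∀ x y, E (x, y) ≤ B * Real.exp (-g x - g y)) (a : ℝ) :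
    IsCompact {μ : ProbabilityMeasure S | costEnergy κ B E μ ≤ ENNReal.ofReal a} := by
  refine (isCompact_closure_moment_le hg hgc (a / (κ ^ 2 / 2))).of_isClosed_subset
    ((lowerSemicontinuous_costEnergy hκ hE hE0).isClosed_preimage _) ?_
  refine Subset.trans (fun μ hμ => ?_) subset_closure
  have h1 := (moment_le_costEnergy hκ hB hg hg0 hE0 hEg μ).trans hμ
  have hk : 0 < κ ^ 2 / 2 := by positivity
  have h2 : ENNReal.ofReal a = ENNReal.ofReal (κ ^ 2 / 2) * ENNReal.ofReal (a / (κ ^ 2 / 2)) := by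
    rw [← ENNReal.ofReal_mul hk.le]; congr 1; field_simp
  rw [h2] at h1
  exact (ENNReal.mul_le_mul_iff_right (ENNReal.ofReal_pos.2 hk).ne' ENNReal.ofReal_ne_top).1 h1

/-- Strict lower bounds for the energy on a compact set hold for a common regularisation. -/
lemma exists_regCost_gt (hκ : 0 < κ) (hE : Continuous E) (hE0 : ∀ z, 0 ≤ E z)
    {A : Set (ProbabilityMeasure S)} (hA : IsCompact A) {a : ℝ≥0∞}
    (ha : ∀ μ ∈ A, a < costEnergy κ B E μ) :
    ∃ η : ℝ, 0 < η ∧ η ≤ 1 ∧ ∀ μ ∈ A, a < ∫⁻ z, ENNReal.ofReal (regCost κ B η E z)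
      ∂((μ : Measure S).prod (μ : Measure S)) := by
  let U : ℕ → Set (ProbabilityMeasure S) := fun k => {μ | a < ∫⁻ z,
    ENNReal.ofReal (regCost κ B (1 / ((k : ℝ) + 1)) E z) ∂((μ : Measure S).prod (μ : Measure S))}
  have hU : ∀ k, IsOpen (U k) := fun k =>
    isOpen_lt continuous_const (continuous_lintegral_regCost hE hE0 (by positivity))
  have hcover : A ⊆ ⋃ k, U k := by
    intro μ hμ
    have := ha μ hμ
    rw [costEnergy_eq_iSup hκ hE hE0, lt_iSup_iff] at this
    exact mem_iUnion.2 this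
  have hmono : Monotone U := fun k l hkl μ hμ =>
    lt_of_lt_of_le hμ (lintegral_mono fun z => monotone_regCost hE0 z hkl)
  obtain ⟨k, hk⟩ := hA.elim_directed_cover U hU hcover hmono.directed_le
  refine ⟨1 / ((k : ℝ) + 1), by positivity, ?_, fun μ hμ => hk hμ⟩
  rw [div_le_one (by positivity)]
  have : (0 : ℝ) ≤ k := by positivity
  linarith

end Functional

/-! ### Exponential bounds for unnormalised masses -/

section Bounds

variable {S : Set ℝ} {κ B : ℝ} {E : S × S → ℝ}

lemma sum_offDiag_const {m : ℕ} (c : ℝ) :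
    ∑ i : Fin m, ∑ _j ∈ ({i}ᶜ : Finset (Fin m)), c = (m : ℝ) * (m - 1 : ℕ) * c := by
  have hcard : ∀ i : Fin m, ({i}ᶜ : Finset (Fin m)).card = m - 1 := fun i => by
    rw [Finset.card_compl]; simp
  simp [hcard, mul_assoc]

lemma lintegral_empirical_prod {m : ℕ} (hm : 0 < m) (x : Fin m → S) {t : S × S → ℝ}
    (ht : Measurable t) (ht0 : ∀ z, 0 ≤ t z) :
    ∫⁻ z, ENNReal.ofReal (t z)
      ∂((empirical hm x : Measure S).prod (empirical hm x : Measure S)) =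
      ENNReal.ofReal (((m : ℝ) ^ 2)⁻¹ * ∑ i, ∑ j, t (x i, x j)) := by
  have hm' : (0 : ℝ) < m := by exact_mod_cast hm
  have hinv : (m : ℝ≥0∞)⁻¹ = ENNReal.ofReal ((m : ℝ)⁻¹) := by
    rw [ENNReal.ofReal_inv_of_pos hm', ENNReal.ofReal_natCast]
  rw [lintegral_prod _ (by fun_prop), lintegral_empirical]
  simp_rw [lintegral_empirical]
  rw [← Finset.mul_sum, hinv]
  simp_rw [← ENNReal.ofReal_sum_of_nonneg fun j (_ : j ∈ Finset.univ) => ht0 _]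
  rw [← ENNReal.ofReal_sum_of_nonneg fun i _ => Finset.sum_nonneg fun j _ => ht0 _,
    ← ENNReal.ofReal_mul (by positivity), ← ENNReal.ofReal_mul (by positivity)]
  congr 1
  field_simp

/-- The double integral against the empirical measure contains the diagonal, absent from the
product. Its m terms are each at most (κ²/2)(log B - log η), which is the correction linear in m in
the exponent. -/
lemma prod_add_le_of_lt_lintegral (hκ : 0 < κ) (hE : Continuous E) (hE0 : ∀ z, 0 ≤ E z)
    (hEB : ∀ z, E z + 1 ≤ B) {η : ℝ} (hη : 0 < η) (hη1 : η ≤ 1) {a : ℝ} {m : ℕ} (hm : 0 < m)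
    (x : Fin m → S)
    (ha : ENNReal.ofReal a < ∫⁻ z, ENNReal.ofReal (regCost κ B η E z)
      ∂((empirical hm x : Measure S).prod (empirical hm x : Measure S))) :
    ∏ i, ∏ j ∈ {i}ᶜ, (E (x i, x j) + η) ≤
      Real.exp ((m : ℝ) * (m - 1 : ℕ) * Real.log B -
        2 / κ ^ 2 * (a * (m : ℝ) ^ 2 - m * (κ ^ 2 / 2 * (Real.log B - Real.log η)))) := by
  have hm' : (0 : ℝ) < m := by exact_mod_cast hm
  set t := regCost κ B η E with ht
  have ht0 : ∀ z, 0 ≤ t z := regCost_nonneg hE0 hEB hη hη1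
  rw [lintegral_empirical_prod hm x (continuous_regCost hE hE0 hη).measurable ht0,
    ENNReal.ofReal_lt_ofReal_iff'] at ha
  have hT : a * (m : ℝ) ^ 2 ≤ ∑ i, ∑ j, t (x i, x j) := by
    have := ha.1.le
    rwa [inv_mul_eq_div, le_div_iff₀ (by positivity)] at this
  have hdiag : ∑ i, t (x i, x i) ≤ m * (κ ^ 2 / 2 * (Real.log B - Real.log η)) := by
    calc ∑ i, t (x i, x i) ≤ ∑ _i : Fin m, (κ ^ 2 / 2 * (Real.log B - Real.log η)) :=
          Finset.sum_le_sum fun i _ => regCost_le hE0 hη _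
      _ = _ := by simp
  have hsplit : ∑ i, ∑ j, t (x i, x j) =
      ∑ i, t (x i, x i) + ∑ i, ∑ j ∈ {i}ᶜ, t (x i, x j) := by
    rw [← Finset.sum_add_distrib]
    exact Finset.sum_congr rfl fun i _ => Fintype.sum_eq_add_sum_compl i _
  have hlog : ∀ z, E z + η = Real.exp (Real.log B - 2 / κ ^ 2 * t z) := by
    intro z
    have : Real.log B - 2 / κ ^ 2 * t z = Real.log (E z + η) := by
      simp only [ht, regCost]; field_simp; ring
    rw [this, Real.exp_log (by linarith [hE0 z])]
  have hprod : ∏ i, ∏ j ∈ {i}ᶜ, (E (x i, x j) + η) =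
      Real.exp (∑ i, ∑ j ∈ {i}ᶜ, (Real.log B - 2 / κ ^ 2 * t (x i, x j))) := by
    rw [Real.exp_sum]
    refine Finset.prod_congr rfl fun i _ => ?_
    rw [Real.exp_sum]
    exact Finset.prod_congr rfl fun j _ => hlog _
  rw [hprod, Real.exp_le_exp]
  simp_rw [Finset.sum_sub_distrib]
  rw [sum_offDiag_const]
  simp_rw [← Finset.mul_sum]
  gcongr
  linarith

/-- Each particle sits in 2(m-1) ordered pairs, so the exponential factors multiply to exp(-2(m-1) ∑
g(x_i)), and the sum is at least m R. -/
lemma prod_exp_le_of_lt_moment (hB : 0 < B) {g : S → ℝ} (hg0 : ∀ x, 0 ≤ g x) {m : ℕ}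
    (hm : 0 < m) (x : Fin m → S) {R : ℝ}
    (hR : ENNReal.ofReal R < ∫⁻ y, ENNReal.ofReal (g y) ∂(empirical hm x : Measure S)) :
    ∏ i, ∏ j ∈ {i}ᶜ, (B * Real.exp (-g (x i) - g (x j))) ≤
      Real.exp ((m : ℝ) * (m - 1 : ℕ) * Real.log B - 2 * (m - 1 : ℕ) * (m * R)) := by
  have hm' : (0 : ℝ) < m := by exact_mod_cast hm
  have hinv : (m : ℝ≥0∞)⁻¹ = ENNReal.ofReal ((m : ℝ)⁻¹) := by
    rw [ENNReal.ofReal_inv_of_pos hm', ENNReal.ofReal_natCast]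
  rw [lintegral_empirical, hinv, ← ENNReal.ofReal_sum_of_nonneg fun i _ => hg0 _,
    ← ENNReal.ofReal_mul (by positivity), ENNReal.ofReal_lt_ofReal_iff'] at hR
  have hsum : m * R ≤ ∑ i, g (x i) := by
    have := hR.1.le
    rwa [inv_mul_eq_div, le_div_iff₀ hm', mul_comm] at this
  have h1 : ∏ i, ∏ j ∈ {i}ᶜ, (B * Real.exp (-g (x i) - g (x j))) =
      B ^ (m * (m - 1)) * ∏ i, Real.exp (-g (x i)) ^ (2 * (m - 1)) := by
    rw [← prod_offDiag_mul fun i => Real.exp (-g (x i)), ← prod_offDiag_const,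
      ← Finset.prod_mul_distrib]
    refine Finset.prod_congr rfl fun i _ => ?_
    rw [← Finset.prod_mul_distrib]
    refine Finset.prod_congr rfl fun j _ => ?_
    rw [← Real.exp_add, sub_eq_add_neg]
  have h2 : ∏ i, Real.exp (-g (x i)) ^ (2 * (m - 1)) =
      Real.exp (-(2 * (m - 1 : ℕ) * ∑ i, g (x i))) := by
    rw [Finset.prod_pow, ← Real.exp_sum, ← Real.exp_nat_mul]
    congr 1
    push_cast
    rw [Finset.sum_neg_distrib]; ring
  have h3 : B ^ (m * (m - 1)) = Real.exp ((m : ℝ) * (m - 1 : ℕ) * Real.log B) := by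
    rw [← Nat.cast_mul, Real.exp_nat_mul, Real.exp_log hB]
  rw [h1, h2, h3, ← Real.exp_add, Real.exp_le_exp]
  have : 2 * ((m - 1 : ℕ) : ℝ) * (m * R) ≤ 2 * (m - 1 : ℕ) * ∑ i, g (x i) := by gcongr
  linarith

variable {p : ℕ → ℕ}

/-- Upper bound for the unnormalised mass of a closed set of empirical measures. -/
lemma eventually_lintegral_le (hp : ∀ n, 0 < p n) (hκ : 0 < κ)
    (hpκ : Tendsto (fun n : ℕ => (p n : ℝ) / (n : ℝ)) atTop (𝓝 κ))
    (hE : Continuous E) (hE0 : ∀ z, 0 ≤ E z) (hEB : ∀ z, E z + 1 ≤ B) (hB : 0 < B)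
    {g : S → ℝ} (hg : Measurable g) (hg0 : ∀ x, 0 ≤ g x) (hgc : ∀ r, IsCompact {x | g x ≤ r})
    {lam : Measure S} [SigmaFinite lam] {h : S → ℝ} (h0 : ∀ x, 0 ≤ h x) (hhm : Measurable h)
    (hint : Integrable h lam)
    {D : ∀ n, (Fin (p n) → S) → ℝ}
    (hreg : ∀ η : ℝ, 0 < η → η ≤ 1 → ∀ᶠ n in atTop, ∀ x, D n x ^ 2 ≤
      (∏ i, h (x i)) ^ 2 * ∏ i, ∏ j ∈ {i}ᶜ, (E (x i, x j) + η))
    (htail : ∀ᶠ n in atTop, ∀ x, D n x ^ 2 ≤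
      (∏ i, h (x i)) ^ 2 * ∏ i, ∏ j ∈ {i}ᶜ, (B * Real.exp (-g (x i) - g (x j))))
    {A : Set (ProbabilityMeasure S)} (hA : IsClosed A) {a : ℝ}
    (ha : ∀ μ ∈ A, ENNReal.ofReal a < costEnergy κ B E μ) {c : ℝ}
    (hc : κ ^ 2 / 2 * Real.log B - a < c) :
    ∀ᶠ n : ℕ in atTop, ∫⁻ x in empirical (hp n) ⁻¹' A, ENNReal.ofReal (D n x)
      ∂(Measure.pi fun _ => lam) ≤ ENNReal.ofReal (Real.exp (c * (n : ℝ) ^ 2)) := by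
  obtain ⟨d, hd1, hd2⟩ := exists_between hc
  -- The moment level a / κ² is chosen so that outside `K` the decay alone yields the leading
  -- exponent (p²/2) log B - a p²/κ², the same as the energy bound yields inside.
  set K := closure {μ : ProbabilityMeasure S |
      ∫⁻ x, ENNReal.ofReal (g x) ∂(μ : Measure S) ≤ ENNReal.ofReal (a / κ ^ 2)}
  have hK : IsCompact K := isCompact_closure_moment_le hg hgc _
  obtain ⟨η, hη, hη1, hη2⟩ := exists_regCost_gt hκ hE hE0 (hK.inter_left hA)
    fun μ hμ => ha μ hμ.1
  have hκ2 : κ ^ 2 ≠ 0 := by positivity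
  -- the density is small on the set in question
  have hdens : ∀ᶠ n : ℕ in atTop, ∀ x ∈ empirical (hp n) ⁻¹' A,
      D n x ≤ Real.exp (d * (n : ℝ) ^ 2) * ∏ i, h (x i) := by
    have hcast : ∀ n, ((p n - 1 : ℕ) : ℝ) = p n - 1 := fun n => by
      rw [Nat.cast_sub (hp n)]; simp
    -- The polynomials in `e1` and `e2` are half the exponents of the two bounds on the squared
    -- density; they differ only in the linear term.
    have e1 := eventually_quadratic_le hpκ (a := 1 / 2 * Real.log B - a / κ ^ 2)
      (-(1 / 2 * Real.log B) + 1 / 2 * (Real.log B - Real.log η)) 0 (d := d)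
      (by rw [sub_mul, div_mul_cancel₀ _ hκ2]; linarith)
    have e2 := eventually_quadratic_le hpκ (a := 1 / 2 * Real.log B - a / κ ^ 2)
      (-(1 / 2 * Real.log B) + a / κ ^ 2) 0 (d := d)
      (by rw [sub_mul, div_mul_cancel₀ _ hκ2]; linarith)
    filter_upwards [hreg η hη hη1, htail, e1, e2] with n h1 h2 e1 e2 x hx
    have hpr : 0 ≤ ∏ i, h (x i) := Finset.prod_nonneg fun i _ => h0 _
    refine le_of_sq_le_sq ?_ (by positivity)
    rw [mul_pow, ← Real.exp_nat_mul, mul_comm (Real.exp _)]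
    by_cases hmem : empirical (hp n) x ∈ K
    · refine (h1 x).trans ?_
      refine mul_le_mul_of_nonneg_left ?_ (sq_nonneg _)
      refine (prod_add_le_of_lt_lintegral hκ hE hE0 hEB hη hη1 (hp n) x
        (hη2 _ ⟨hx, hmem⟩)).trans ?_
      rw [Real.exp_le_exp, hcast]
      push_cast
      have : 2 / κ ^ 2 * (a * (p n : ℝ) ^ 2 - p n * (κ ^ 2 / 2 * (Real.log B - Real.log η))) =
          2 * (a / κ ^ 2) * (p n : ℝ) ^ 2 - p n * (Real.log B - Real.log η) := by
        field_simp
      rw [this]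
      nlinarith [e1]
    · refine (h2 x).trans ?_
      refine mul_le_mul_of_nonneg_left ?_ (sq_nonneg _)
      have hlt : ENNReal.ofReal (a / κ ^ 2) <
          ∫⁻ y, ENNReal.ofReal (g y) ∂(empirical (hp n) x : Measure S) := by
        by_contra! hle
        exact hmem (subset_closure hle)
      refine (prod_exp_le_of_lt_moment hB hg0 (hp n) x hlt).trans ?_
      rw [Real.exp_le_exp, hcast]
      push_cast
      nlinarith [e2]
  set I := ∫ x, h x ∂lam
  have hI : 0 ≤ I := integral_nonneg h0
  -- The reference mass I^p has an exponent linear in p and fits into the gap c - d. The logarithm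
  -- is taken at I + 1 because I may vanish.
  have e3 := eventually_quadratic_le hpκ (a := 0) (Real.log (I + 1)) 0 (d := c - d)
    (by linarith)
  filter_upwards [hdens, e3] with n hn e3
  calc ∫⁻ x in empirical (hp n) ⁻¹' A, ENNReal.ofReal (D n x) ∂(Measure.pi fun _ => lam)
      ≤ ∫⁻ x : Fin (p n) → S, ENNReal.ofReal (Real.exp (d * (n : ℝ) ^ 2) * ∏ i, h (x i))
          ∂(Measure.pi fun _ => lam) := by
        refine (setLIntegral_mono (by fun_prop) fun x hx =>
          ENNReal.ofReal_le_ofReal (hn x hx)).trans (setLIntegral_le_lintegral _ _)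
    _ = ENNReal.ofReal (Real.exp (d * (n : ℝ) ^ 2)) * ENNReal.ofReal (I ^ p n) := by
        simp_rw [ENNReal.ofReal_mul (Real.exp_pos (d * (n : ℝ) ^ 2)).le]
        rw [lintegral_const_mul' _ _ ENNReal.ofReal_ne_top, lintegral_prod_pi_eq_pow h0 hint]
    _ ≤ ENNReal.ofReal (Real.exp (d * (n : ℝ) ^ 2)) *
          ENNReal.ofReal (Real.exp ((c - d) * (n : ℝ) ^ 2)) := by
        gcongr
        calc I ^ p n ≤ (I + 1) ^ p n := by gcongr; linarith
          _ = Real.exp (p n * Real.log (I + 1)) := by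
            rw [Real.exp_nat_mul, Real.exp_log (by linarith)]
          _ ≤ _ := by rw [Real.exp_le_exp]; linarith
    _ = _ := by
        rw [← ENNReal.ofReal_mul (Real.exp_pos _).le, ← Real.exp_add]
        congr 2; ring

/-- Lower bound for the unnormalised mass of a neighbourhood of a measure which has a bounded
density and is carried by a set on which the weights are controlled. -/
lemma eventually_le_lintegral (hp : ∀ n, 0 < p n) (hκ : 0 < κ)
    (hpκ : Tendsto (fun n : ℕ => (p n : ℝ) / (n : ℝ)) atTop (𝓝 κ))
    (hE : Continuous E) (hE0 : ∀ z, 0 ≤ E z) (hEB : ∀ z, E z ≤ B)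
    {lam : Measure S} [SigmaFinite lam] {D : ∀ n, (Fin (p n) → S) → ℝ}
    (hD0 : ∀ n x, 0 ≤ D n x) (hDm : ∀ n, Measurable (D n)) {K : Set S}
    (hlow : ∀ ε : ℝ, 0 < ε → ∀ᶠ n in atTop, ∀ x : Fin (p n) → S, (∀ i, x i ∈ K) →
      ∏ i, ∏ j ∈ {i}ᶜ, (Real.exp (-ε) * E (x i, x j)) ≤ D n x ^ 2)
    {ν : ProbabilityMeasure S} (hνK : (ν : Measure S) Kᶜ = 0) {M : ℝ} (hM : 0 < M)
    (hνM : (ν : Measure S) ≤ ENNReal.ofReal M • lam) (hfin : costEnergy κ B E ν ≠ ∞)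
    {G : Set (ProbabilityMeasure S)} (hG : G ∈ 𝓝 ν) {c : ℝ}
    (hc : c < κ ^ 2 / 2 * Real.log B - (costEnergy κ B E ν).toReal) :
    ∀ᶠ n : ℕ in atTop, ENNReal.ofReal (Real.exp (c * (n : ℝ) ^ 2)) ≤
      ∫⁻ x in empirical (hp n) ⁻¹' G, ENNReal.ofReal (D n x) ∂(Measure.pi fun _ => lam) := by
  set H := (costEnergy κ B E ν).toReal with hH
  have hH0 : 0 ≤ H := ENNReal.toReal_nonneg
  have hHe : costEnergy κ B E ν = ENNReal.ofReal H := (ENNReal.ofReal_toReal hfin).symm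
  have hκ2 : κ ^ 2 ≠ 0 := by positivity
  set ε := (κ ^ 2 / 2 * Real.log B - H - c) / (2 * (1 + κ ^ 2 / 2)) with hε_def
  have hε : 0 < ε := div_pos (by linarith) (by positivity)
  -- The losses, ε in the energy and ε per pair in the density, add up to exactly half of the
  -- available gap.
  have hεc : c < κ ^ 2 / 2 * (Real.log B - ε) - (H + ε) := by
    have : ε * (2 * (1 + κ ^ 2 / 2)) = κ ^ 2 / 2 * Real.log B - H - c := by
      rw [hε_def]; field_simp
    nlinarith
  -- The pair cost has mean N H with N = p(p-1), so by Markov it reaches N (H + ε) with probability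
  -- at most q < 1. A success probability bounded below is enough; no law of large numbers for the
  -- pair sum is needed.
  set q := H / (H + ε) with hq
  have hq0 : 0 ≤ q := by positivity
  have hq1 : q < 1 := by rw [hq, div_lt_one (by positivity)]; linarith
  set P : ∀ n, Measure (Fin (p n) → S) := fun n => Measure.pi fun _ => (ν : Measure S) with hP
  set Φ : ∀ n, (Fin (p n) → S) → ℝ≥0∞ := fun n x =>
    ∑ i, ∑ j ∈ {i}ᶜ, cost κ B E (x i, x j) with hΦ
  have hcm : Measurable (cost κ B E) := measurable_cost hE.measurable
  set τ : ℕ → ℝ := fun n => ((p n * (p n - 1) : ℕ) : ℝ) * (H + ε) with hτ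
  have hcast : ∀ n, ((p n * (p n - 1) : ℕ) : ℝ) = (p n : ℝ) * (p n - 1) := fun n => by
    rw [Nat.cast_mul, Nat.cast_sub (hp n)]; simp
  have hptop := tendsto_atTop_of_ratio hκ hpκ
  -- Markov's inequality
  have hmarkov : ∀ᶠ n in atTop, P n {x | ENNReal.ofReal (τ n) ≤ Φ n x} ≤ ENNReal.ofReal q := by
    filter_upwards [hptop.eventually_ge_atTop 2] with n hn
    have hN : 0 < p n * (p n - 1) := Nat.mul_pos (hp n) (by omega)
    have hN' : (0 : ℝ) < (p n * (p n - 1) : ℕ) := by exact_mod_cast hN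
    have hτ0 : 0 < τ n := by positivity
    have h1 : ∫⁻ x, Φ n x ∂(P n) = ENNReal.ofReal (τ n) * ENNReal.ofReal q := by
      rw [hΦ, hP, lintegral_sum_offDiag hcm]
      change _ * costEnergy κ B E ν = _
      rw [hHe, ← ENNReal.ofReal_natCast, ← ENNReal.ofReal_mul hN'.le,
        ← ENNReal.ofReal_mul hτ0.le]
      congr 1
      simp only [hτ, hq]
      field_simp
    have hΦm : Measurable (Φ n) := Finset.measurable_fun_sum _ fun i _ =>
      Finset.measurable_fun_sum _ fun j _ =>
        hcm.comp ((measurable_pi_apply i).prodMk (measurable_pi_apply j))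
    have h2 := mul_meas_ge_le_lintegral (μ := P n) hΦm (ENNReal.ofReal (τ n))
    rw [h1] at h2
    exact (ENNReal.mul_le_mul_iff_right (ENNReal.ofReal_pos.2 hτ0).ne'
      ENNReal.ofReal_ne_top).1 h2
  have hK0 : ∀ n, P n {x | ∀ i, x i ∈ K}ᶜ = 0 := by
    intro n
    have : {x : Fin (p n) → S | ∀ i, x i ∈ K}ᶜ = ⋃ i, (fun x => x i) ⁻¹' Kᶜ := by
      ext x; simp
    rw [this, measure_iUnion_null_iff]
    intro i
    exact Measure.pi_eval_preimage_null _ hνK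
  set r := (1 - q) / 2 with hr
  have hr0 : 0 < r := by rw [hr]; linarith
  have hlln : ∀ᶠ n in atTop, P n (empirical (hp n) ⁻¹' Gᶜ) < ENNReal.ofReal r :=
    (tendsto_pi_empirical_compl ν p hp hptop hG).eventually_lt_const (ENNReal.ofReal_pos.2 hr0)
  set d : ℕ → ℝ := fun n => 1 / 2 * (((p n * (p n - 1) : ℕ) : ℝ) * (Real.log B - ε) -
    2 / κ ^ 2 * τ n) with hd
  have hset : ∀ᶠ n in atTop, ENNReal.ofReal r ≤
      P n ({x | ENNReal.ofReal (Real.exp (d n)) ≤ ENNReal.ofReal (D n x)} ∩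
        empirical (hp n) ⁻¹' G) := by
    filter_upwards [hmarkov, hlln, hlow ε hε] with n h1 h2 h3
    set T := {x | ENNReal.ofReal (Real.exp (d n)) ≤ ENNReal.ofReal (D n x)} ∩
        empirical (hp n) ⁻¹' G
    -- Outside three bad events of total mass at most q + 0 + r the configuration lies in `T`, and 1
    -- - q = 2r leaves mass r for it. Only subadditivity is used, so the preimage of `G` need not be
    -- known to be measurable.
    have hcover : (univ : Set (Fin (p n) → S)) ⊆
        (({x | ENNReal.ofReal (τ n) ≤ Φ n x} ∪ {x | ∀ i, x i ∈ K}ᶜ) ∪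
          empirical (hp n) ⁻¹' Gᶜ) ∪ T := by
      intro x _
      by_cases hx1 : ENNReal.ofReal (τ n) ≤ Φ n x
      · exact Or.inl (Or.inl (Or.inl hx1))
      by_cases hx2 : ∀ i, x i ∈ K
      swap
      · exact Or.inl (Or.inl (Or.inr hx2))
      by_cases hx3 : empirical (hp n) x ∈ G
      swap
      · exact Or.inl (Or.inr hx3)
      refine Or.inr ⟨ENNReal.ofReal_le_ofReal ?_, hx3⟩
      refine le_of_sq_le_sq (le_trans ?_ (h3 x hx2)) (hD0 n x)
      rw [not_le] at hx1
      have hΦtop : Φ n x ≠ ∞ := (hx1.trans ENNReal.ofReal_lt_top).ne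
      have hctop : ∀ i, ∀ j ∈ ({i}ᶜ : Finset (Fin (p n))), cost κ B E (x i, x j) ≠ ∞ := by
        intro i j hj
        have := (ENNReal.sum_ne_top.1 hΦtop) i (Finset.mem_univ _)
        exact (ENNReal.sum_ne_top.1 this) j hj
      have hexp : ∀ i, ∀ j ∈ ({i}ᶜ : Finset (Fin (p n))),
          Real.exp (-ε) * E (x i, x j) =
            Real.exp ((Real.log B - ε) - 2 / κ ^ 2 * (cost κ B E (x i, x j)).toReal) := by
        intro i j hj
        have h4 := hctop i j hj
        have hne : E (x i, x j) ≠ 0 := fun h => h4 (by simp [cost, h])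
        have hpos : 0 < E (x i, x j) := lt_of_le_of_ne (hE0 _) hne.symm
        have h5 : (cost κ B E (x i, x j)).toReal =
            κ ^ 2 / 2 * (Real.log B - Real.log (E (x i, x j))) := by
          rw [cost, if_neg hne, ENNReal.toReal_ofReal]
          have := Real.log_le_log hpos (hEB (x i, x j))
          have : 0 ≤ Real.log B - Real.log (E (x i, x j)) := by linarith
          positivity
        rw [h5]
        have : (Real.log B - ε) - 2 / κ ^ 2 * (κ ^ 2 / 2 * (Real.log B -
            Real.log (E (x i, x j)))) = -ε + Real.log (E (x i, x j)) := by
          field_simp; ring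
        rw [this, Real.exp_add, Real.exp_log hpos]
      have hprod : ∏ i, ∏ j ∈ {i}ᶜ, (Real.exp (-ε) * E (x i, x j)) =
          Real.exp (∑ i, ∑ j ∈ {i}ᶜ,
            ((Real.log B - ε) - 2 / κ ^ 2 * (cost κ B E (x i, x j)).toReal)) := by
        rw [Real.exp_sum]
        refine Finset.prod_congr rfl fun i _ => ?_
        rw [Real.exp_sum]
        exact Finset.prod_congr rfl fun j hj => hexp i j hj
      have hsum : ∑ i, ∑ j ∈ {i}ᶜ, (cost κ B E (x i, x j)).toReal = (Φ n x).toReal := by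
        rw [hΦ, ENNReal.toReal_sum fun i hi => (ENNReal.sum_ne_top.1 hΦtop) i hi]
        exact Finset.sum_congr rfl fun i _ => (ENNReal.toReal_sum fun j hj => hctop i j hj).symm
      have hΦτ : (Φ n x).toReal ≤ τ n := ENNReal.toReal_le_of_le_ofReal (by positivity) hx1.le
      rw [hprod, ← Real.exp_nat_mul, Real.exp_le_exp]
      simp_rw [Finset.sum_sub_distrib]
      rw [sum_offDiag_const, sum_offDiag_const, ← Nat.cast_mul]
      simp_rw [← Finset.mul_sum]
      rw [hsum]
      have : 2 / κ ^ 2 * (Φ n x).toReal ≤ 2 / κ ^ 2 * τ n := by gcongr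
      simp only [hd]
      push_cast at this ⊢
      linarith
    have h5 : (1 : ℝ≥0∞) ≤ ENNReal.ofReal q + 0 + ENNReal.ofReal r + P n T := by
      calc (1 : ℝ≥0∞) = P n univ := by rw [measure_univ]
        _ ≤ _ := measure_mono hcover
        _ ≤ _ := (measure_union_le _ _).trans (add_le_add_left ((measure_union_le _ _).trans
          (add_le_add ((measure_union_le _ _).trans (add_le_add h1 (hK0 n).le)) h2.le)) _)
    have h6 : (1 : ℝ≥0∞) = ENNReal.ofReal q + 0 + ENNReal.ofReal r + ENNReal.ofReal r := by
      rw [add_zero, ← ENNReal.ofReal_add hq0 hr0.le, ← ENNReal.ofReal_add (by positivity) hr0.le,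
        ← ENNReal.ofReal_one]
      congr 1; rw [hr]; ring
    rw [h6] at h5
    exact (ENNReal.add_le_add_iff_left (by simp)).1 h5
  -- The density bound M enters through the linear coefficient and the success probability r through
  -- the constant one; neither affects the limit.
  have hgrow := eventually_le_quadratic hpκ
    (a := 1 / 2 * (Real.log B - ε) - 1 / κ ^ 2 * (H + ε))
    (-(1 / 2 * (Real.log B - ε) - 1 / κ ^ 2 * (H + ε)) - Real.log M) (Real.log r) (d := c) (by
      have : 1 / κ ^ 2 * (H + ε) * κ ^ 2 = H + ε := by field_simp
      rw [sub_mul, this]; linarith)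
  filter_upwards [hset, hgrow] with n h1 h2
  have hM0 : ENNReal.ofReal M ≠ 0 := (ENNReal.ofReal_pos.2 hM).ne'
  have hle := pi_le_smul_pi hM0 ENNReal.ofReal_ne_top hνM (p n)
  have hint : ENNReal.ofReal (Real.exp (d n)) * ENNReal.ofReal r ≤
      ENNReal.ofReal M ^ p n * ∫⁻ x in empirical (hp n) ⁻¹' G, ENNReal.ofReal (D n x)
        ∂(Measure.pi fun _ => lam) := by
    calc ENNReal.ofReal (Real.exp (d n)) * ENNReal.ofReal r
        ≤ ENNReal.ofReal (Real.exp (d n)) * ((P n).restrict (empirical (hp n) ⁻¹' G))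
          {x | ENNReal.ofReal (Real.exp (d n)) ≤ ENNReal.ofReal (D n x)} := by
          rw [Measure.restrict_apply
            (measurableSet_le measurable_const (hDm n).ennreal_ofReal)]
          gcongr
      _ ≤ ∫⁻ x in empirical (hp n) ⁻¹' G, ENNReal.ofReal (D n x) ∂(P n) :=
          mul_meas_ge_le_lintegral (hDm n).ennreal_ofReal _
      _ ≤ ∫⁻ x in empirical (hp n) ⁻¹' G, ENNReal.ofReal (D n x)
          ∂(ENNReal.ofReal M ^ p n • Measure.pi fun _ => lam) :=
          lintegral_mono' (Measure.restrict_mono le_rfl hle) le_rfl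
      _ = _ := by rw [Measure.restrict_smul, lintegral_smul_measure, smul_eq_mul]
  have hMn : ENNReal.ofReal M ^ p n ≠ 0 := pow_ne_zero _ hM0
  have hMn' : ENNReal.ofReal M ^ p n ≠ ∞ := ENNReal.pow_ne_top ENNReal.ofReal_ne_top
  refine (ENNReal.mul_le_mul_iff_right hMn hMn').1 (le_trans ?_ hint)
  rw [← ENNReal.ofReal_pow hM.le, ← ENNReal.ofReal_mul (by positivity),
    ← ENNReal.ofReal_mul (by positivity)]
  refine ENNReal.ofReal_le_ofReal ?_
  have hMe : M ^ p n = Real.exp (p n * Real.log M) := by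
    rw [Real.exp_nat_mul, Real.exp_log hM]
  rw [hMe, ← Real.exp_add]
  refine le_of_le_of_eq (b := Real.exp (d n + Real.log r)) ?_
    (by rw [Real.exp_add, Real.exp_log hr0])
  rw [Real.exp_le_exp]
  simp only [hd, hτ, hcast]
  have : 2 / κ ^ 2 * ((p n : ℝ) * (p n - 1) * (H + ε)) =
      2 * (1 / κ ^ 2 * (H + ε)) * ((p n : ℝ) * (p n - 1)) := by ring
  rw [this]
  nlinarith [h2]

end Bounds

/-! ### From exponential bounds to a large deviations principle -/

lemma log_div_sq_le_iff {n : ℕ} (hn : 0 < n) {a : ℝ≥0∞} {c : ℝ} :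
    ENNReal.log a / (((n : ℝ) ^ 2 : ℝ) : EReal) ≤ (c : EReal) ↔
      a ≤ ENNReal.ofReal (Real.exp (c * (n : ℝ) ^ 2)) := by
  have h : (0 : EReal) < (((n : ℝ) ^ 2 : ℝ) : EReal) := by
    exact_mod_cast (by positivity : (0 : ℝ) < (n : ℝ) ^ 2)
  rw [EReal.div_le_iff_le_mul h (EReal.coe_ne_top _), ← ENNReal.log_le_log_iff,
    ENNReal.log_ofReal_of_pos (Real.exp_pos _), Real.log_exp, ← EReal.coe_mul, mul_comm]

lemma le_log_div_sq_iff {n : ℕ} (hn : 0 < n) {a : ℝ≥0∞} {c : ℝ} :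
    (c : EReal) ≤ ENNReal.log a / (((n : ℝ) ^ 2 : ℝ) : EReal) ↔
      ENNReal.ofReal (Real.exp (c * (n : ℝ) ^ 2)) ≤ a := by
  have h : (0 : EReal) < (((n : ℝ) ^ 2 : ℝ) : EReal) := by
    exact_mod_cast (by positivity : (0 : ℝ) < (n : ℝ) ^ 2)
  rw [EReal.le_div_iff_mul_le h (EReal.coe_ne_top _), ← ENNReal.log_le_log_iff,
    ENNReal.log_ofReal_of_pos (Real.exp_pos _), Real.log_exp, ← EReal.coe_mul]

/-- `J n A` stands for the unnormalised mass of `A`. The two bounds for the whole space pin its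
exponent down to -inf e, and dividing by it shifts every rate by that constant. Nothing about `J`
beyond these bounds and `hQ` is used, in particular no measurability of the sets. -/
theorem satisfiesLDP_of_exponential_bounds {X : Type*} [TopologicalSpace X] {Ω : ℕ → Type*}
    [∀ n, MeasurableSpace (Ω n)] (Q : ∀ n, Measure (Ω n)) (L : ∀ n, Ω n → X)
    (J : ℕ → Set X → ℝ≥0∞) (hQ : ∀ n A, Q n (L n ⁻¹' A) = (J n univ)⁻¹ * J n A)
    (e : X → EReal) (hlsc : LowerSemicontinuous e)
    (hcpt : ∀ a : ℝ, IsCompact {x | e x ≤ a}) (b : ℝ) (hb : ∀ x, (b : EReal) ≤ e x)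
    (x₀ : X) (hx₀ : e x₀ ≠ ⊤)
    (hupper : ∀ A, IsClosed A → ∀ a c : ℝ, (∀ x ∈ A, (a : EReal) < e x) → -a < c →
      ∀ᶠ n : ℕ in atTop, J n A ≤ ENNReal.ofReal (Real.exp (c * (n : ℝ) ^ 2)))
    (hlower : ∀ G, IsOpen G → ∀ x ∈ G, ∀ a : ℝ, e x < a →
      ∀ᶠ n : ℕ in atTop, ENNReal.ofReal (Real.exp (-a * (n : ℝ) ^ 2)) ≤ J n G) :
    (∀ᶠ n in atTop, J n univ ≠ 0 ∧ J n univ ≠ ∞) ∧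
    ∃ c : ℝ, Tendsto (fun n : ℕ => ENNReal.log (J n univ) / (((n : ℝ) ^ 2 : ℝ) : EReal)) atTop
        (𝓝 (c : EReal)) ∧ (c : EReal) = -(⨅ x, e x) ∧
      SatisfiesLDP Q L (fun n => (n : ℝ) ^ 2) fun x => e x + (c : EReal) := by
  obtain ⟨m, hm⟩ : ∃ m : ℝ, ⨅ x, e x = (m : EReal) := by
    have h1 : ⨅ x, e x ≠ ⊤ := fun h => hx₀ (top_le_iff.1 (h ▸ iInf_le e x₀))
    have h2 : ⨅ x, e x ≠ ⊥ := by
      intro h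
      have : (b : EReal) ≤ ⊥ := h ▸ le_iInf hb
      exact EReal.coe_ne_bot b (le_bot_iff.1 this)
    exact ⟨_, (EReal.coe_toReal h1 h2).symm⟩
  have hme : ∀ x, (m : EReal) ≤ e x := fun x => hm ▸ iInf_le e x
  have hZup : ∀ ε : ℝ, 0 < ε → ∀ᶠ n : ℕ in atTop,
      J n univ ≤ ENNReal.ofReal (Real.exp ((-m + ε) * (n : ℝ) ^ 2)) := fun ε hε =>
    hupper univ isClosed_univ (m - ε / 2) (-m + ε)
      (fun x _ => lt_of_lt_of_le (by exact_mod_cast (by linarith)) (hme x)) (by linarith)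
  have hZlow : ∀ ε : ℝ, 0 < ε → ∀ᶠ n : ℕ in atTop,
      ENNReal.ofReal (Real.exp ((-m - ε) * (n : ℝ) ^ 2)) ≤ J n univ := fun ε hε => by
    have : ⨅ x, e x < ((m + ε : ℝ) : EReal) := by
      rw [hm]; exact_mod_cast (by linarith)
    obtain ⟨x, hx⟩ := iInf_lt_iff.1 this
    have := hlower univ isOpen_univ x (mem_univ _) (m + ε) hx
    simpa [neg_add, sub_eq_add_neg, add_comm] using this
  have hZ : ∀ᶠ n in atTop, J n univ ≠ 0 ∧ J n univ ≠ ∞ := by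
    filter_upwards [hZup 1 one_pos, hZlow 1 one_pos] with n h1 h2
    exact ⟨(lt_of_lt_of_le (ENNReal.ofReal_pos.2 (Real.exp_pos _)) h2).ne',
      (lt_of_le_of_lt h1 ENNReal.ofReal_lt_top).ne⟩
  refine ⟨hZ, -m, ?_, by rw [hm, EReal.coe_neg], ?_, ?_, ?_⟩
  · rw [tendsto_order]
    constructor
    · intro y hy
      obtain ⟨t, ht1, ht2⟩ := EReal.lt_iff_exists_real_btwn.1 hy
      have ht2' : t < -m := by exact_mod_cast ht2
      filter_upwards [hZlow (-m - t) (by linarith), eventually_gt_atTop 0] with n h1 hn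
      refine lt_of_lt_of_le ht1 ((le_log_div_sq_iff hn).2 ?_)
      convert h1 using 4; ring
    · intro y hy
      obtain ⟨t, ht1, ht2⟩ := EReal.lt_iff_exists_real_btwn.1 hy
      have ht1' : -m < t := by exact_mod_cast ht1
      filter_upwards [hZup (t + m) (by linarith), eventually_gt_atTop 0] with n h1 hn
      refine lt_of_le_of_lt ((log_div_sq_le_iff hn).2 ?_) ht2
      convert h1 using 4; ring
  · have hshift : ∀ x (t : ℝ), e x + ((-m : ℝ) : EReal) ≤ t ↔ e x ≤ ((t + m : ℝ) : EReal) := by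
      intro x t
      rw [EReal.coe_neg, ← sub_eq_add_neg, EReal.sub_le_iff_le_add (by simp) (by simp),
        EReal.coe_add]
    refine ⟨fun x => ?_, ?_, fun t _ => ?_⟩
    · rw [EReal.coe_neg, ← sub_eq_add_neg, EReal.sub_nonneg (by simp) (by simp)]
      exact hme x
    · rw [lowerSemicontinuous_iff_isClosed_preimage]
      intro y
      induction y with
      | bot =>
        convert isClosed_empty
        ext x
        have h1 : (0 : EReal) ≤ e x + ((-m : ℝ) : EReal) := by
          rw [EReal.coe_neg, ← sub_eq_add_neg, EReal.sub_nonneg (by simp) (by simp)]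
          exact hme x
        simp only [mem_preimage, mem_Iic, mem_empty_iff_false, iff_false, not_le]
        exact lt_of_lt_of_le (EReal.bot_lt_zero) h1
      | top => simp
      | coe t =>
        have : (fun x => e x + ((-m : ℝ) : EReal)) ⁻¹' Iic (t : EReal) =
            e ⁻¹' Iic ((t + m : ℝ) : EReal) := by
          ext x; exact hshift x t
        rw [this]
        exact hlsc.isClosed_preimage _
    · have : {x | e x + ((-m : ℝ) : EReal) ≤ t} = {x | e x ≤ ((t + m : ℝ) : EReal)} := by
        ext x; exact hshift x t
      rw [this]
      exact hcpt _
  · intro G hG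
    refine EReal.ge_of_forall_gt_iff_ge.1 fun y hy => ?_
    simp only [EReal.lt_neg_comm, iInf_lt_iff] at hy
    obtain ⟨x, hxG, hx⟩ := hy
    obtain ⟨t, ht1, ht2⟩ := EReal.lt_iff_exists_real_btwn.1 hx
    have ht2' : t < -y := by exact_mod_cast ht2
    have hex : e x < ((t + m : ℝ) : EReal) := by
      rw [EReal.coe_neg, ← sub_eq_add_neg, EReal.sub_lt_iff (by simp) (by simp)] at ht1
      rwa [EReal.coe_add]
    refine le_liminf_of_le (by isBoundedDefault) ?_
    -- The gap -y - t > 0 is spent entirely on the normalisation: y + (-m + (-y - t)) = -(t + m).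
    filter_upwards [hlower G hG x hxG _ hex, hZup (-y - t) (by linarith), hZ,
      eventually_gt_atTop 0] with n h1 h2 h3 hn
    rw [le_log_div_sq_iff hn, hQ, ← ENNReal.div_eq_inv_mul,
      ENNReal.le_div_iff_mul_le (Or.inl h3.1) (Or.inl h3.2)]
    refine le_trans ?_ h1
    calc _ ≤ ENNReal.ofReal (Real.exp (y * (n : ℝ) ^ 2)) *
          ENNReal.ofReal (Real.exp ((-m + (-y - t)) * (n : ℝ) ^ 2)) := by gcongr
      _ = _ := by
        rw [← ENNReal.ofReal_mul (Real.exp_pos _).le, ← Real.exp_add]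
        congr 2; ring
  · intro A hA
    refine EReal.le_of_forall_lt_iff_le.1 fun y hy => ?_
    rw [EReal.neg_lt_comm] at hy
    obtain ⟨t, ht1, ht2⟩ := EReal.lt_iff_exists_real_btwn.1 hy
    have ht1' : -y < t := by exact_mod_cast ht1
    have hex : ∀ x ∈ A, ((t + m : ℝ) : EReal) < e x := by
      intro x hx
      have h1 : (t : EReal) < e x + ((-m : ℝ) : EReal) := lt_of_lt_of_le ht2 (iInf₂_le x hx)
      rw [EReal.coe_neg, ← sub_eq_add_neg, EReal.lt_sub_iff_add_lt (by simp) (by simp)] at h1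
      rwa [EReal.coe_add]
    refine limsup_le_of_le (by isBoundedDefault) ?_
    -- The gap t + y > 0 is split in halves between the mass of `A` and the normalisation.
    filter_upwards [hupper A hA _ (-(t + m) + (t + y) / 2) hex (by linarith),
      hZlow ((t + y) / 2) (by linarith), hZ, eventually_gt_atTop 0] with n h1 h2 h3 hn
    rw [log_div_sq_le_iff hn, hQ, ← ENNReal.div_eq_inv_mul,
      ENNReal.div_le_iff h3.1 h3.2]
    refine h1.trans ?_
    calc ENNReal.ofReal (Real.exp ((-(t + m) + (t + y) / 2) * (n : ℝ) ^ 2))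
        = ENNReal.ofReal (Real.exp (y * (n : ℝ) ^ 2)) *
          ENNReal.ofReal (Real.exp ((-m - (t + y) / 2) * (n : ℝ) ^ 2)) := by
          rw [← ENNReal.ofReal_mul (Real.exp_pos _).le, ← Real.exp_add]
          congr 2; ring
      _ ≤ _ := by gcongr

/-! ### The energy in terms of the multiplicative interaction -/

/-- Positive and negative parts satisfy (t - b)⁺ + b = t + (t - b)⁻ in [0, ∞], an identity that can
be integrated without subtraction. The negative part is at most b, hence has finite integral, and
can then be moved across. -/
lemma eintegral_coe_sub_const {α : Type*} [MeasurableSpace α] {μ : Measure α}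
    [IsProbabilityMeasure μ] {c : α → ℝ≥0∞} (hc : Measurable c) {b : ℝ} (hb : 0 ≤ b) :
    eintegral μ (fun x => (c x : EReal) - (b : EReal)) =
      ((∫⁻ x, c x ∂μ : ℝ≥0∞) : EReal) - (b : EReal) := by
  have hpt : ∀ t : ℝ≥0∞, ((t : EReal) - (b : EReal)).toENNReal + ENNReal.ofReal b =
      t + (-((t : EReal) - (b : EReal))).toENNReal := by
    intro t
    induction t with
    | top => simp
    | coe t =>
      have h1 : (((t : ℝ≥0∞) : EReal) - (b : EReal)) = (((t : ℝ) - b : ℝ) : EReal) := by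
        rw [EReal.coe_sub]; rfl
      rw [h1, ← EReal.coe_neg, EReal.toENNReal_of_ne_top (EReal.coe_ne_top _),
        EReal.toENNReal_of_ne_top (EReal.coe_ne_top _), EReal.toReal_coe, EReal.toReal_coe]
      rcases le_total b t with h | h
      · rw [← ENNReal.ofReal_add (by linarith) hb,
          ENNReal.ofReal_of_nonpos (p := -((t : ℝ) - b)) (by linarith)]
        simp
      · rw [ENNReal.ofReal_of_nonpos (p := (t : ℝ) - b) (by linarith), zero_add,
          ← ENNReal.ofReal_coe_nnreal, ← ENNReal.ofReal_add (p := (t : ℝ)) t.2 (by linarith)]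
        congr 1; ring
  have hle : ∀ t : ℝ≥0∞, (-((t : EReal) - (b : EReal))).toENNReal ≤ ENNReal.ofReal b := by
    intro t
    rw [show ENNReal.ofReal b = ((b : ℝ) : EReal).toENNReal by
      rw [EReal.toENNReal_of_ne_top (EReal.coe_ne_top _), EReal.toReal_coe]]
    refine EReal.toENNReal_le_toENNReal ?_
    rw [EReal.neg_sub (by simp) (by simp), add_comm, ← sub_eq_add_neg]
    refine (EReal.sub_le_sub le_rfl (EReal.coe_ennreal_nonneg t)).trans ?_
    simp
  unfold eintegral
  set P := ∫⁻ x, ((c x : EReal) - (b : EReal)).toENNReal ∂μ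
  set N := ∫⁻ x, (-((c x : EReal) - (b : EReal))).toENNReal ∂μ
  have hN : N ≤ ENNReal.ofReal b := by
    calc N ≤ ∫⁻ _, ENNReal.ofReal b ∂μ := lintegral_mono fun x => hle _
      _ = _ := by simp
  have hNtop : N ≠ ∞ := (lt_of_le_of_lt hN ENNReal.ofReal_lt_top).ne
  have hsum : P + ENNReal.ofReal b = (∫⁻ x, c x ∂μ) + N := by
    have h1 : P + ENNReal.ofReal b =
        ∫⁻ x, (((c x : EReal) - (b : EReal)).toENNReal + ENNReal.ofReal b) ∂μ := by
      rw [lintegral_add_right _ measurable_const]; simp [P]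
    rw [h1, ← lintegral_add_left hc]
    exact lintegral_congr fun x => hpt _
  clear_value P N
  generalize (∫⁻ x, c x ∂μ) = I at *
  lift N to NNReal using hNtop
  rcases eq_or_ne I ∞ with rfl | hI
  · have hP : P = ∞ := by
      by_contra h
      have : P + ENNReal.ofReal b ≠ ∞ := by simp [h]
      rw [hsum] at this; simp at this
    rw [hP]; simp
  · have hP : P ≠ ∞ := by
      intro h
      rw [h] at hsum
      have : I + (N : ℝ≥0∞) ≠ ∞ := by simp [hI]
      exact this (by rw [← hsum]; simp)
    lift P to NNReal using hP
    lift I to NNReal using hI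
    have h2 : (P : ℝ) + b = I + N := by
      have := congrArg ENNReal.toReal hsum
      rw [ENNReal.toReal_add (by simp) (by simp), ENNReal.toReal_add (by simp) (by simp),
        ENNReal.toReal_ofReal hb] at this
      simpa using this
    change (((P : ℝ) : EReal)) - (((N : ℝ)) : EReal) = (((I : ℝ)) : EReal) - (b : EReal)
    rw [← EReal.coe_sub, ← EReal.coe_sub]
    congr 1; linarith

section Interaction

variable {S : Set ℝ} {θ : ℕ} {κ : ℝ} {w : ℝ → ℝ}

/-- The interaction `|x - y| |x^θ - y^θ| v(x) v(y)` for a weight `v`. -/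
def pairWeight (θ : ℕ) (v : ℝ → ℝ) (x y : ℝ) : ℝ := |x - y| * |x ^ θ - y ^ θ| * (v x * v y)

/-- The limiting interaction `exp (-(2/κ²) F)`. -/
def limitPair (S : Set ℝ) (θ : ℕ) (κ : ℝ) (w : ℝ → ℝ) (z : S × S) : ℝ :=
  pairWeight θ (fun x => w x ^ (1 / κ)) z.1 z.2

lemma pairWeight_nonneg {v : ℝ → ℝ} {x y : ℝ} (hx : 0 ≤ v x) (hy : 0 ≤ v y) :
    0 ≤ pairWeight θ v x y := by
  unfold pairWeight; positivity

lemma limitPair_nonneg (hw : ∀ x ∈ S, 0 ≤ w x) (z : S × S) : 0 ≤ limitPair S θ κ w z :=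
  pairWeight_nonneg (Real.rpow_nonneg (hw _ z.1.2) _) (Real.rpow_nonneg (hw _ z.2.2) _)

lemma continuous_limitPair (hκ : 0 < κ) (hw : ContinuousOn w S) :
    Continuous (limitPair S θ κ w) := by
  unfold limitPair pairWeight
  have h0 : Continuous fun x : S => w x := continuousOn_iff_continuous_domRestrict.1 hw
  have h1 : Continuous fun x : S => w x ^ (1 / κ) :=
    h0.rpow_const fun x => Or.inr (by positivity)
  have h2 : Continuous fun z : S × S => w z.1 ^ (1 / κ) := h1.comp continuous_fst
  have h3 : Continuous fun z : S × S => w z.2 ^ (1 / κ) := h1.comp continuous_snd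
  fun_prop

lemma limitPair_eq_zero_iff (hκ : 0 < κ) (hw : ∀ x ∈ S, 0 ≤ w x) (z : S × S) :
    limitPair S θ κ w z = 0 ↔
      ((z.1 : ℝ) ^ θ = (z.2 : ℝ) ^ θ ∨ w z.1 = 0 ∨ w z.2 = 0) := by
  have hk : 1 / κ ≠ 0 := by positivity
  unfold limitPair pairWeight
  simp only [mul_eq_zero, abs_eq_zero, sub_eq_zero,
    Real.rpow_eq_zero (hw _ z.1.2) hk, Real.rpow_eq_zero (hw _ z.2.2) hk]
  constructor
  · rintro ((h | h) | h)
    · exact Or.inl (by rw [h])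
    · exact Or.inl h
    · exact Or.inr h
  · rintro (h | h)
    · exact Or.inl (Or.inr h)
    · exact Or.inr h

lemma kernelF_eq (hκ : 0 < κ) (hw : ∀ x ∈ S, 0 ≤ w x) {B : ℝ}
    (hEB : ∀ z, limitPair S θ κ w z ≤ B) (z : S × S) :
    kernelF θ κ w z.1 z.2 = ((cost κ B (limitPair S θ κ w) z : ℝ≥0∞) : EReal) -
      ((κ ^ 2 / 2 * Real.log B : ℝ) : EReal) := by
  unfold kernelF cost
  by_cases h : limitPair S θ κ w z = 0
  · rw [if_pos ((limitPair_eq_zero_iff hκ hw z).1 h), if_pos h]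
    simp
    rfl
  · have h' := h
    rw [limitPair_eq_zero_iff hκ hw] at h'
    rw [if_neg h', if_neg h]
    have hpos : 0 < limitPair S θ κ w z := lt_of_le_of_ne (limitPair_nonneg hw z) (Ne.symm h)
    have hlog : Real.log (limitPair S θ κ w z) ≤ Real.log B := Real.log_le_log hpos (hEB z)
    rw [EReal.coe_ennreal_ofReal, max_eq_left (by
      have : 0 ≤ Real.log B - Real.log (limitPair S θ κ w z) := by linarith
      positivity), ← EReal.coe_sub]
    congr 1
    simp only [not_or] at h'
    have hw1 : 0 < w z.1 := lt_of_le_of_ne (hw _ z.1.2) (Ne.symm h'.2.1)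
    have hw2 : 0 < w z.2 := lt_of_le_of_ne (hw _ z.2.2) (Ne.symm h'.2.2)
    have hx : (z.1 : ℝ) ≠ z.2 := fun h => h'.1 (by rw [h])
    have h1 : |(z.1 : ℝ) - z.2| ≠ 0 := by simpa [sub_eq_zero] using hx
    have h2 : |(z.1 : ℝ) ^ θ - (z.2 : ℝ) ^ θ| ≠ 0 := by simpa [sub_eq_zero] using h'.1
    have h3 : Real.log (limitPair S θ κ w z) = Real.log |(z.1 : ℝ) - z.2| +
        Real.log |(z.1 : ℝ) ^ θ - (z.2 : ℝ) ^ θ| +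
          (1 / κ * Real.log (w z.1) + 1 / κ * Real.log (w z.2)) := by
      unfold limitPair pairWeight
      rw [Real.log_mul (mul_ne_zero h1 h2) (by positivity), Real.log_mul h1 h2,
        Real.log_mul (by positivity) (by positivity), Real.log_rpow hw1, Real.log_rpow hw2]
    rw [h3, Real.log_inv, Real.log_inv]
    field_simp
    ring

lemma energy_eq (hκ : 0 < κ) (hwc : ContinuousOn w S) (hw : ∀ x ∈ S, 0 ≤ w x) {B : ℝ}
    (hB : 1 ≤ B) (hEB : ∀ z, limitPair S θ κ w z ≤ B) (μ : ProbabilityMeasure S) :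
    energy S θ κ w μ = ((costEnergy κ B (limitPair S θ κ w) μ : ℝ≥0∞) : EReal) -
      ((κ ^ 2 / 2 * Real.log B : ℝ) : EReal) := by
  unfold energy costEnergy
  have := Real.log_nonneg hB
  rw [← eintegral_coe_sub_const (measurable_cost (continuous_limitPair hκ hwc).measurable)
    (by positivity)]
  congr 1
  funext z
  exact kernelF_eq hκ hw hEB z

/-- This covers strict lower bounds at negative levels, which are truncated to 0 in [0, ∞]. -/
lemma costEnergy_pos {E : S × S → ℝ} {B : ℝ} (hκ : 0 < κ) (hE : Measurable E)
    (hE0 : ∀ z, 0 ≤ E z) (hEB : ∀ z, E z < B) (μ : ProbabilityMeasure S) :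
    0 < costEnergy κ B E μ := by
  unfold costEnergy
  rw [lintegral_pos_iff_support (measurable_cost hE)]
  have : Function.support (cost κ B E) = univ := by
    refine eq_univ_of_forall fun z => ?_
    rw [Function.mem_support]
    unfold cost
    split_ifs with h
    · simp
    · have hpos : 0 < E z := lt_of_le_of_ne (hE0 z) (Ne.symm h)
      have : 0 < Real.log B - Real.log (E z) := sub_pos.2 (Real.log_lt_log hpos (hEB z))
      exact (ENNReal.ofReal_pos.2 (by positivity)).ne'
  rw [this]
  simp

end Interaction

/-! ### Consequences of the assumptions on the weights -/

section Weights

variable {S : Set ℝ} {θ : ℕ} {κ : ℝ} {p : ℕ → ℕ} {wn : ℕ → ℝ → ℝ} {w : ℝ → ℝ}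

lemma tendsto_inv_pred (hκ : 0 < κ)
    (hpκ : Tendsto (fun n : ℕ => (p n : ℝ) / (n : ℝ)) atTop (𝓝 κ)) :
    Tendsto (fun n : ℕ => 1 / ((p n : ℝ) - 1)) atTop (𝓝 0) := by
  have h := (tendsto_natCast_atTop_iff (R := ℝ)).2 (tendsto_atTop_of_ratio hκ hpκ)
  exact tendsto_const_nhds.div_atTop (tendsto_atTop_add_const_right _ (-1) h)

lemma tendsto_div_pred (hκ : 0 < κ)
    (hpκ : Tendsto (fun n : ℕ => (p n : ℝ) / (n : ℝ)) atTop (𝓝 κ)) :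
    Tendsto (fun n : ℕ => (n : ℝ) / ((p n : ℝ) - 1)) atTop (𝓝 (1 / κ)) := by
  have h := ((hpκ.sub (tendsto_inv_atTop_nhds_zero_nat (𝕜 := ℝ))).inv₀ (by simpa using hκ.ne'))
  rw [sub_zero, ← one_div] at h
  refine h.congr' ?_
  filter_upwards [eventually_gt_atTop 0] with n hn
  have : (n : ℝ) ≠ 0 := by exact_mod_cast hn.ne'
  rw [← one_div (n : ℝ), ← sub_div, inv_div]

/-- Uniform polynomial decay of the weights. -/
lemma exists_weight_le (hκ : 0 < κ) (hS : IsClosed S) (ha1 : WeightsConverge S wn w)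
    (ha2 : TailDecay S θ κ wn) :
    ∃ C α : ℝ, 1 ≤ C ∧ ((θ : ℝ) + 1) * κ < α ∧
      (∀ᶠ n in atTop, ∀ x ∈ S, wn n x ≤ C * (1 + |x|) ^ (-α)) := by
  obtain ⟨N, α, R, hα, hR, htail⟩ : ∃ (N : ℕ) (α R : ℝ), ((θ : ℝ) + 1) * κ < α ∧ 1 ≤ R ∧
      ∀ n ≥ N, ∀ x ∈ S, R ≤ |x| → wn n x ≤ |x| ^ (-α) := by
    by_cases hb : Bornology.IsBounded S
    · obtain ⟨R, hR⟩ := hb.exists_norm_le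
      -- For bounded S no point lies beyond R, so the decay is vacuous and any exponent above (θ+1)κ
      -- will do.
      refine ⟨0, ((θ : ℝ) + 1) * κ + 1, max R 0 + 1, by linarith, by
        linarith [le_max_right R 0], fun n _ x hx hRx => ?_⟩
      have := hR x hx
      rw [Real.norm_eq_abs] at this
      linarith [le_max_left R 0]
    · obtain ⟨N, ε, hε, h⟩ := ha2 hb
      have h1 := h.eventually_lt_const (zero_lt_one)
      rw [eventually_inf_principal, ← comap_norm_atTop, eventually_comap,
        eventually_atTop] at h1
      obtain ⟨R, hR⟩ := h1
      refine ⟨N, ((θ : ℝ) + 1) * (κ + ε), max R 1, ?_, le_max_right _ _, ?_⟩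
      · have : 0 < ((θ : ℝ) + 1) * ε := by positivity
        linarith
      intro n hn x hx hRx
      have hx1 : 1 ≤ |x| := (le_max_right _ _).trans hRx
      have hx0 : 0 < |x| := by linarith
      have h2 := hR |x| ((le_max_left _ _).trans hRx) x (Real.norm_eq_abs x) hx
      have h3 : ENNReal.ofReal (|x| ^ (((θ : ℝ) + 1) * (κ + ε)) * wn n x) < 1 := by
        rw [ENNReal.ofReal_mul (by positivity)]
        refine lt_of_le_of_lt ?_ h2
        gcongr
        exact le_iSup₂_of_le n hn le_rfl
      rw [ENNReal.ofReal_lt_one] at h3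
      rw [Real.rpow_neg hx0.le, ← one_div, le_div_iff₀ (by positivity)]
      linarith [mul_comm (|x| ^ (((θ : ℝ) + 1) * (κ + ε))) (wn n x)]
  have hα0 : 0 < α := lt_of_le_of_lt (by positivity) hα
  set K := S ∩ Icc (-R) R
  have hK : IsCompact K := isCompact_Icc.inter_left hS
  obtain ⟨C₀, hC₀⟩ := hK.exists_bound_of_continuousOn (ha1.continuousOn.mono inter_subset_left)
  have hunif := Metric.tendstoUniformlyOn_iff.1 (ha1.tendsto K inter_subset_left hK) 1 one_pos
  -- The first entry covers |x| ≤ R through uniform convergence on a compact set; the second covers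
  -- |x| ≥ R ≥ 1, where 1 + |x| ≤ 2|x|.
  set C := max ((max C₀ 0 + 1) * (1 + R) ^ α) (2 ^ α)
  have hC1 : (1 : ℝ) ≤ C := (Real.one_le_rpow one_le_two hα0.le).trans (le_max_right _ _)
  refine ⟨C, α, hC1, hα, ?_⟩
  filter_upwards [hunif, eventually_ge_atTop N] with n hn hnN x hx
  have hx0 := abs_nonneg x
  rw [Real.rpow_neg (by positivity), ← div_eq_mul_inv, le_div_iff₀ (by positivity)]
  rcases le_total R |x| with hRx | hRx
  · have hx1 : 1 ≤ |x| := hR.trans hRx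
    have h1 := htail n hnN x hx hRx
    calc wn n x * (1 + |x|) ^ α ≤ |x| ^ (-α) * (2 * |x|) ^ α := by
          gcongr
          linarith
      _ = 2 ^ α := by
          rw [Real.mul_rpow (by norm_num) hx0, mul_comm, mul_assoc,
            ← Real.rpow_add (by linarith), add_neg_cancel, Real.rpow_zero, mul_one]
      _ ≤ C := le_max_right _ _
  · have hxK : x ∈ K := ⟨hx, abs_le.1 hRx⟩
    have h1 := hn x hxK
    have h2 := hC₀ x hxK
    rw [Real.dist_eq, abs_lt] at h1
    rw [Real.norm_eq_abs] at h2
    have h3 : wn n x ≤ max C₀ 0 + 1 := by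
      linarith [le_abs_self (w x), le_max_left C₀ 0]
    calc wn n x * (1 + |x|) ^ α ≤ (max C₀ 0 + 1) * (1 + R) ^ α := by
          gcongr
      _ ≤ C := le_max_left _ _

/-- The weight at stage `n` distributed over the `p n - 1` pairs of a particle, including the
factor `1 + x²` which makes room for an integrable reference density. -/
def pairedWeight (p : ℕ → ℕ) (wn : ℕ → ℝ → ℝ) (n : ℕ) (x : ℝ) : ℝ :=
  wn n x ^ ((n : ℝ) / ((p n : ℝ) - 1)) * (1 + x ^ 2) ^ (1 / ((p n : ℝ) - 1))

lemma tendsto_weight (ha1 : WeightsConverge S wn w) {x : ℝ} (hx : x ∈ S) :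
    Tendsto (fun n => wn n x) atTop (𝓝 (w x)) :=
  (ha1.tendsto {x} (singleton_subset_iff.2 hx) isCompact_singleton).tendsto_at (mem_singleton x)

lemma tendsto_pairedWeight (hκ : 0 < κ)
    (hpκ : Tendsto (fun n : ℕ => (p n : ℝ) / (n : ℝ)) atTop (𝓝 κ))
    (ha1 : WeightsConverge S wn w) {x : ℝ} (hx : x ∈ S) :
    Tendsto (fun n => pairedWeight p wn n x) atTop (𝓝 (w x ^ (1 / κ))) := by
  have h1 := (tendsto_weight ha1 hx).rpow (tendsto_div_pred hκ hpκ) (Or.inr (by positivity))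
  have h2 := (tendsto_const_nhds (x := 1 + x ^ 2)).rpow (tendsto_inv_pred hκ hpκ)
    (Or.inl (by positivity))
  simpa [pairedWeight] using h1.mul h2

/-- The total power of 1 + |x| is at most -α n/(p-1) + 2/(p-1) + θ + 1, which tends to θ + 1 - α/κ =
-2δ < 0. Half of this decay is kept for all large n, and the bound passes to the limit weight. -/
lemma exists_pairedWeight_le (hκ : 0 < κ)
    (hpκ : Tendsto (fun n : ℕ => (p n : ℝ) / (n : ℝ)) atTop (𝓝 κ)) (hS : IsClosed S)
    (hwn_nonneg : ∀ n, ∀ x ∈ S, 0 ≤ wn n x)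
    (ha1 : WeightsConverge S wn w) (ha2 : TailDecay S θ κ wn) :
    ∃ C δ : ℝ, 1 ≤ C ∧ 0 < δ ∧
      (∀ᶠ n in atTop, ∀ x ∈ S, pairedWeight p wn n x * (1 + |x|) ^ (θ + 1) ≤
        C * (1 + |x|) ^ (-δ)) ∧
      (∀ x ∈ S, w x ^ (1 / κ) * (1 + |x|) ^ (θ + 1) ≤ C * (1 + |x|) ^ (-δ)) := by
  obtain ⟨C, α, hC, hα, hle⟩ := exists_weight_le hκ hS ha1 ha2
  set δ := (α / κ - (θ + 1)) / 2 with hδ_def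
  have hδ : 0 < δ := by
    have : (θ : ℝ) + 1 < α / κ := (lt_div_iff₀ hκ).2 hα
    rw [hδ_def]; linarith
  have hmain : ∀ᶠ n in atTop, ∀ x ∈ S, pairedWeight p wn n x * (1 + |x|) ^ (θ + 1) ≤
        C ^ (1 / κ + 1) * (1 + |x|) ^ (-δ) := by
    have ha := tendsto_div_pred hκ hpκ
    have hb := tendsto_inv_pred hκ hpκ
    have hexp : Tendsto (fun n : ℕ => -α * ((n : ℝ) / ((p n : ℝ) - 1)) +
        2 * (1 / ((p n : ℝ) - 1)) + ((θ : ℝ) + 1)) atTop (𝓝 (-(2 * δ))) := by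
      have := ((ha.const_mul (-α)).add (hb.const_mul 2)).add_const ((θ : ℝ) + 1)
      convert this using 2
      rw [hδ_def]; ring
    filter_upwards [hle, hexp.eventually_le_const (by linarith : -(2 * δ) < -δ),
      ha.eventually_le_const (by linarith : 1 / κ < 1 / κ + 1),
      ha.eventually_const_lt (by positivity : (0 : ℝ) < 1 / κ),
      (tendsto_atTop_of_ratio hκ hpκ).eventually_ge_atTop 2] with n h1 h2 h3 h4 h5 x hx
    have h5' : (2 : ℝ) ≤ p n := by exact_mod_cast h5
    have hb0 : 0 ≤ 1 / ((p n : ℝ) - 1) := div_nonneg zero_le_one (by linarith)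
    set a := (n : ℝ) / ((p n : ℝ) - 1)
    set b := 1 / ((p n : ℝ) - 1)
    set t := 1 + |x| with ht
    have ht1 : 1 ≤ t := by rw [ht]; linarith [abs_nonneg x]
    have ht0 : 0 < t := by linarith
    have hsq : 1 + x ^ 2 ≤ t ^ (2 : ℝ) := by
      rw [Real.rpow_two, ht, ← sq_abs]; nlinarith [abs_nonneg x]
    calc pairedWeight p wn n x * t ^ (θ + 1)
        ≤ ((C * t ^ (-α)) ^ a * (t ^ (2 : ℝ)) ^ b) * t ^ ((θ : ℝ) + 1) := by
          rw [← Nat.cast_add_one, Real.rpow_natCast]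
          unfold pairedWeight
          gcongr
          · exact hwn_nonneg n x hx
          · exact h1 x hx
      _ = C ^ a * t ^ (-α * a + 2 * b + ((θ : ℝ) + 1)) := by
          rw [Real.mul_rpow (by linarith) (by positivity), ← Real.rpow_mul ht0.le,
            ← Real.rpow_mul ht0.le, Real.rpow_add ht0 _ ((θ : ℝ) + 1), Real.rpow_add ht0 _ (2 * b)]
          ring
      _ ≤ C ^ (1 / κ + 1) * t ^ (-δ) := by
          gcongr
  refine ⟨C ^ (1 / κ + 1), δ, Real.one_le_rpow hC (by positivity), hδ, hmain, fun x hx => ?_⟩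
  exact le_of_tendsto ((tendsto_pairedWeight hκ hpκ ha1 hx).mul_const _)
    (hmain.mono fun n hn => hn x hx)

/-- The weight exponent eventually stays above 1/(2κ), so (a, s) ↦ a^s is uniformly continuous on
the relevant compact box even at a = 0. The zeros of w therefore cause no trouble, and logarithms
are not needed. -/
lemma tendstoUniformlyOn_pairedWeight (hκ : 0 < κ)
    (hpκ : Tendsto (fun n : ℕ => (p n : ℝ) / (n : ℝ)) atTop (𝓝 κ))
    (hwn_nonneg : ∀ n, ∀ x ∈ S, 0 ≤ wn n x) (ha1 : WeightsConverge S wn w) {K : Set ℝ}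
    (hKS : K ⊆ S) (hK : IsCompact K) :
    TendstoUniformlyOn (fun n => pairedWeight p wn n) (fun x => w x ^ (1 / κ)) atTop K := by
  obtain ⟨C, hC⟩ := hK.exists_bound_of_continuousOn (ha1.continuousOn.mono hKS)
  obtain ⟨D, hD⟩ := hK.exists_bound_of_continuousOn
    (f := fun x : ℝ => 1 + x ^ 2) (by fun_prop)
  have ha := tendsto_div_pred hκ hpκ
  have hb := tendsto_inv_pred hκ hpκ
  have hk : 0 < 1 / κ := by positivity
  let s : Set ((ℝ × ℝ) × ℝ × ℝ) :=
    (Icc 0 (C + 1) ×ˢ Icc (1 / κ / 2) (1 / κ + 1)) ×ˢ (Icc 1 D ×ˢ Icc (-1) 1)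
  let G : (ℝ × ℝ) × ℝ × ℝ → ℝ := fun q => q.1.1 ^ q.1.2 * q.2.1 ^ q.2.2
  have hs : IsCompact s := (isCompact_Icc.prod isCompact_Icc).prod (isCompact_Icc.prod isCompact_Icc)
  have hG : UniformContinuousOn G s := by
    refine hs.uniformContinuousOn_of_continuous ?_
    intro q hq
    refine ContinuousAt.continuousWithinAt (ContinuousAt.mul ?_ ?_)
    · exact ContinuousAt.rpow (by fun_prop) (by fun_prop) (Or.inr (by
        have := hq.1.2.1; linarith))
    · exact ContinuousAt.rpow (by fun_prop) (by fun_prop) (Or.inl (by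
        have := hq.2.1.1; exact (by linarith : 0 < q.2.1).ne'))
  have hconst : ∀ {u : ℕ → ℝ} {l : ℝ}, Tendsto u atTop (𝓝 l) →
      TendstoUniformlyOn (fun n (_ : ℝ) => u n) (fun _ => l) atTop K := by
    intro u l hu
    rw [Metric.tendstoUniformlyOn_iff]
    intro ε hε
    filter_upwards [Metric.tendsto_nhds.1 hu ε hε] with n hn x _
    rwa [dist_comm]
  have hF : TendstoUniformlyOn
      (fun n x => ((wn n x, (n : ℝ) / ((p n : ℝ) - 1)), (1 + x ^ 2, 1 / ((p n : ℝ) - 1))))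
      (fun x => ((w x, 1 / κ), (1 + x ^ 2, 0))) atTop K := by
    rw [Metric.tendstoUniformlyOn_iff]
    intro ε hε
    filter_upwards [Metric.tendstoUniformlyOn_iff.1 (ha1.tendsto K hKS hK) ε hε,
      Metric.tendstoUniformlyOn_iff.1 (hconst ha) ε hε,
      Metric.tendstoUniformlyOn_iff.1 (hconst hb) ε hε] with n h1 h2 h3 x hx
    simp only [Prod.dist_eq, max_lt_iff, dist_self]
    exact ⟨⟨h1 x hx, h2 x hx⟩, hε, h3 x hx⟩
  have := hG.comp_tendstoUniformlyOn_eventually (p := atTop) (t := K) ?_ ?_ hF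
  · refine this.congr_right ?_
    intro x _
    simp [G]
  · filter_upwards [Metric.tendstoUniformlyOn_iff.1 (ha1.tendsto K hKS hK) 1 one_pos,
      ha.eventually_const_le (by linarith : 1 / κ / 2 < 1 / κ),
      ha.eventually_le_const (by linarith : 1 / κ < 1 / κ + 1),
      hb.eventually_const_le (by norm_num : (-1 : ℝ) < 0),
      hb.eventually_le_const (by norm_num : (0 : ℝ) < 1)] with n h1 h2 h3 h4 h5 x hx
    have e1 := h1 x hx
    have e2 := hC x hx
    rw [Real.dist_eq, abs_lt] at e1
    rw [Real.norm_eq_abs] at e2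
    refine ⟨⟨⟨hwn_nonneg n x (hKS hx), ?_⟩, h2, h3⟩, ⟨?_, ?_⟩, h4, h5⟩
    · dsimp only; linarith [le_abs_self (w x)]
    · dsimp only; nlinarith [sq_nonneg x]
    · exact (le_abs_self _).trans (hD x hx)
  · intro x hx
    have e2 := hC x hx
    rw [Real.norm_eq_abs] at e2
    refine ⟨⟨⟨ha1.nonneg x (hKS hx), ?_⟩, ?_, ?_⟩, ⟨?_, ?_⟩, by norm_num, by norm_num⟩
    · dsimp only; linarith [le_abs_self (w x)]
    · dsimp only; linarith
    · dsimp only; linarith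
    · dsimp only; nlinarith [sq_nonneg x]
    · exact (le_abs_self _).trans (hD x hx)

/-- Beyond a radius R the common decay is already below η; within it, uniform convergence is used
with a tolerance that compensates for the factor (1 + |R|)^(θ+1). -/
lemma eventually_pairedWeight_le_add (hκ : 0 < κ)
    (hpκ : Tendsto (fun n : ℕ => (p n : ℝ) / (n : ℝ)) atTop (𝓝 κ)) (hS : IsClosed S)
    (hwn_nonneg : ∀ n, ∀ x ∈ S, 0 ≤ wn n x) (ha1 : WeightsConverge S wn w)
    {C δ : ℝ} (hδ : 0 < δ)
    (hle : ∀ᶠ n in atTop, ∀ x ∈ S, pairedWeight p wn n x * (1 + |x|) ^ (θ + 1) ≤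
        C * (1 + |x|) ^ (-δ)) {η : ℝ} (hη : 0 < η) :
    ∀ᶠ n in atTop, ∀ x ∈ S, pairedWeight p wn n x * (1 + |x|) ^ (θ + 1) ≤
      w x ^ (1 / κ) * (1 + |x|) ^ (θ + 1) + η := by
  have hlim : Tendsto (fun t : ℝ => C * (1 + t) ^ (-δ)) atTop (𝓝 0) := by
    have h1 : Tendsto (fun t : ℝ => 1 + t) atTop atTop :=
      tendsto_atTop_add_const_left _ 1 tendsto_id
    simpa using ((tendsto_rpow_neg_atTop hδ).comp h1).const_mul C
  obtain ⟨R, hR⟩ := eventually_atTop.1 (hlim.eventually_le_const hη)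
  set K := S ∩ Icc (-(|R|)) (|R|)
  have hK : IsCompact K := isCompact_Icc.inter_left hS
  have hpos : 0 < η / (1 + |R|) ^ (θ + 1) := by positivity
  filter_upwards [hle, Metric.tendstoUniformlyOn_iff.1 (tendstoUniformlyOn_pairedWeight hκ hpκ
    hwn_nonneg ha1 (inter_subset_left : K ⊆ S) hK) _ hpos] with n h1 h2 x hx
  have hw0 : 0 ≤ w x ^ (1 / κ) := Real.rpow_nonneg (ha1.nonneg x hx) _
  rcases le_total |R| |x| with hRx | hRx
  · refine (h1 x hx).trans ((hR _ ((le_abs_self R).trans hRx)).trans ?_)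
    have : 0 ≤ w x ^ (1 / κ) * (1 + |x|) ^ (θ + 1) := by positivity
    linarith
  · have h3 := h2 x ⟨hx, abs_le.1 hRx⟩
    rw [Real.dist_eq, abs_lt] at h3
    calc pairedWeight p wn n x * (1 + |x|) ^ (θ + 1)
        ≤ (w x ^ (1 / κ) + η / (1 + |R|) ^ (θ + 1)) * (1 + |x|) ^ (θ + 1) := by
          gcongr; linarith
      _ = w x ^ (1 / κ) * (1 + |x|) ^ (θ + 1) +
          η / (1 + |R|) ^ (θ + 1) * (1 + |x|) ^ (θ + 1) := by ring
      _ ≤ w x ^ (1 / κ) * (1 + |x|) ^ (θ + 1) +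
          η / (1 + |R|) ^ (θ + 1) * (1 + |R|) ^ (θ + 1) := by gcongr
      _ = _ := by rw [div_mul_cancel₀ _ (by positivity)]

/-- On compact sets away from the zeros, the weights are bounded below by the limit weight. -/
lemma eventually_le_weight_rpow (hκ : 0 < κ)
    (hpκ : Tendsto (fun n : ℕ => (p n : ℝ) / (n : ℝ)) atTop (𝓝 κ))
    (hwn_nonneg : ∀ n, ∀ x ∈ S, 0 ≤ wn n x) (ha1 : WeightsConverge S wn w) {K : Set ℝ}
    (hKS : K ⊆ S \ zerosIn S w) (hK : IsCompact K) {ε : ℝ} (hε : 0 < ε) :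
    ∀ᶠ n : ℕ in atTop, ∀ x ∈ K,
      Real.exp (-ε) * w x ^ (1 / κ) ≤ wn n x ^ ((n : ℝ) / ((p n : ℝ) - 1)) := by
  have hwpos : ∀ x ∈ K, 0 < w x := fun x hx =>
    lt_of_le_of_ne (ha1.nonneg x (hKS hx).1) fun h => (hKS hx).2 ⟨(hKS hx).1, h.symm⟩
  have hlogc : ContinuousOn (fun x => Real.log (w x)) K :=
    ContinuousOn.log (ha1.continuousOn.mono fun x hx => (hKS hx).1) fun x hx => (hwpos x hx).ne'
  obtain ⟨C, hC⟩ := hK.exists_bound_of_continuousOn hlogc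
  have ha := tendsto_div_pred hκ hpκ
  set C' := |C| + 1
  have hC' : 0 < C' := by positivity
  set A := 1 / κ + 1
  have hA : 0 < A := by positivity
  filter_upwards [Metric.tendstoUniformlyOn_iff.1 (ha1.tendsto_log K hKS hK) (ε / (2 * A))
    (by positivity), Metric.tendsto_nhds.1 ha (ε / (2 * C')) (by positivity),
    ha.eventually_le_const (by linarith : 1 / κ < A),
    ha.eventually_const_le (by positivity : 0 < 1 / κ), ha1.zeros_subset] with n h1 h2 h3 h4 h5 x hx
  have hwn : 0 < wn n x := lt_of_le_of_ne (hwn_nonneg n x (hKS hx).1) fun h =>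
    (hKS hx).2 (h5 ⟨(hKS hx).1, h.symm⟩)
  have e1 := h1 x hx
  have e2 := hC x hx
  rw [Real.dist_eq] at e1 h2
  rw [Real.norm_eq_abs] at e2
  rw [Real.rpow_def_of_pos (hwpos x hx), Real.rpow_def_of_pos hwn, ← Real.exp_add,
    Real.exp_le_exp]
  set a := (n : ℝ) / ((p n : ℝ) - 1)
  set l := Real.log (w x)
  set ln := Real.log (wn n x)
  -- With a = n/(p-1), the logarithms differ by a·ln - l/κ = -a (l - ln) + (a - 1/κ) l; each term
  -- costs at most ε/2.
  have h6 : a * |l - ln| ≤ ε / 2 := by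
    calc a * |l - ln| ≤ A * (ε / (2 * A)) := by gcongr
      _ = ε / 2 := by field_simp
  have h7 : |a - 1 / κ| * |l| ≤ ε / 2 := by
    calc |a - 1 / κ| * |l| ≤ ε / (2 * C') * C' := by
          gcongr
          calc |l| ≤ C := e2
            _ ≤ C' := by simp only [C']; linarith [le_abs_self C]
      _ = ε / 2 := by field_simp
  have h8 : a * (l - ln) ≤ a * |l - ln| := by gcongr; exact le_abs_self _
  have h9 : -((a - 1 / κ) * l) ≤ |a - 1 / κ| * |l| := by
    rw [← abs_mul]; exact neg_le_abs _
  nlinarith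

end Weights

/-! ### Bounds for the density -/

section Density

variable {S : Set ℝ} {θ : ℕ} {κ : ℝ} {p : ℕ → ℕ} {wn : ℕ → ℝ → ℝ} {w : ℝ → ℝ}

lemma density_incl {n m : ℕ} {v : ℝ → ℝ} (x : Fin m → S) :
    density S θ n m v (incl S m x) = (∏ i, v (x i) ^ n) *
      ∏ i, ∏ j ∈ Finset.Ioi i, (|(x i : ℝ) - x j| * |(x i : ℝ) ^ θ - (x j : ℝ) ^ θ|) := by
  unfold density
  rw [indicator_of_mem]
  · rfl
  · exact fun i => (x i).2

lemma density_incl_nonneg {n m : ℕ} {v : ℝ → ℝ} (hv : ∀ x ∈ S, 0 ≤ v x) (x : Fin m → S) :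
    0 ≤ density S θ n m v (incl S m x) := by
  rw [density_incl]
  refine mul_nonneg (Finset.prod_nonneg fun i _ => pow_nonneg (hv _ (x i).2) _) ?_
  exact Finset.prod_nonneg fun i _ => Finset.prod_nonneg fun j _ => by positivity

lemma continuous_density_incl {n m : ℕ} {v : ℝ → ℝ} (hv : ContinuousOn v S) :
    Continuous fun x : Fin m → S => density S θ n m v (incl S m x) := by
  simp_rw [density_incl]
  have h0 : Continuous fun x : S => v x := continuousOn_iff_continuous_domRestrict.1 hv
  have h1 : ∀ i, Continuous fun x : Fin m → S => v (x i) := fun i => h0.comp (continuous_apply i)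
  refine (continuous_finsetProd _ fun i _ => (h1 i).pow n).mul
    (continuous_finsetProd _ fun i _ => continuous_finsetProd _ fun j _ => ?_)
  fun_prop

/-- The square of the density is a product over ordered pairs, once the weights are distributed
over the pairs. -/
lemma sq_density_mul {n m : ℕ} {v u k : ℝ → ℝ} (huk : ∀ x ∈ S, u x ^ (m - 1) = v x ^ n * k x)
    (x : Fin m → S) :
    density S θ n m v (incl S m x) ^ 2 * (∏ i, k (x i)) ^ 2 =
      ∏ i, ∏ j ∈ {i}ᶜ, pairWeight θ u (x i) (x j) := by
  rw [density_incl, mul_pow, sq_prod_prod_Ioi]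
  · simp only [pairWeight, Finset.prod_mul_distrib (f := fun j => |_| * |_|)]
    rw [Finset.prod_mul_distrib, prod_offDiag_mul fun i => u (x i)]
    have : ∏ i, u (x i) ^ (2 * (m - 1)) = (∏ i, v (x i) ^ n) ^ 2 * (∏ i, k (x i)) ^ 2 := by
      rw [← Finset.prod_pow, ← Finset.prod_pow, ← Finset.prod_mul_distrib]
      refine Finset.prod_congr rfl fun i _ => ?_
      rw [mul_comm 2, pow_mul, huk _ (x i).2, mul_pow]
    rw [this]; ring
  · intro i j
    rw [abs_sub_comm, abs_sub_comm ((x i : ℝ) ^ θ)]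

/-- Each variable grows with power θ + 1; this is the origin of that exponent in the tail condition.
-/
lemma abs_sub_mul_abs_pow_sub_le (θ : ℕ) (x y : ℝ) :
    |x - y| * |x ^ θ - y ^ θ| ≤ (1 + |x|) ^ (θ + 1) * (1 + |y|) ^ (θ + 1) := by
  have hx := abs_nonneg x
  have hy := abs_nonneg y
  have h1 : |x - y| ≤ (1 + |x|) * (1 + |y|) := by
    have := abs_sub x y; nlinarith
  have h2 : |x ^ θ - y ^ θ| ≤ (1 + |x|) ^ θ * (1 + |y|) ^ θ := by
    rcases eq_or_ne θ 0 with rfl | hθ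
    · simp
    · calc |x ^ θ - y ^ θ| ≤ |x| ^ θ + |y| ^ θ := by
            have := abs_sub (x ^ θ) (y ^ θ); rwa [abs_pow, abs_pow] at this
        _ ≤ (|x| + |y|) ^ θ := pow_add_pow_le hx hy hθ
        _ ≤ ((1 + |x|) * (1 + |y|)) ^ θ := by gcongr; nlinarith
        _ = _ := mul_pow _ _ _
  calc |x - y| * |x ^ θ - y ^ θ| ≤ ((1 + |x|) * (1 + |y|)) * ((1 + |x|) ^ θ * (1 + |y|) ^ θ) := by
        gcongr
    _ = _ := by ring

/-- Bounding the interaction through the normalised weights `v(x) (1 + |x|)^(θ+1)`. -/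
lemma pairWeight_le_mul {v : ℝ → ℝ} {x y a b : ℝ} (hy : 0 ≤ v y)
    (ha : v x * (1 + |x|) ^ (θ + 1) ≤ a) (hb : v y * (1 + |y|) ^ (θ + 1) ≤ b) (ha0 : 0 ≤ a)
    (hx : 0 ≤ v x) : pairWeight θ v x y ≤ a * b := by
  calc pairWeight θ v x y
      ≤ ((1 + |x|) ^ (θ + 1) * (1 + |y|) ^ (θ + 1)) * (v x * v y) := by
        exact mul_le_mul_of_nonneg_right (abs_sub_mul_abs_pow_sub_le θ x y) (mul_nonneg hx hy)
    _ = (v x * (1 + |x|) ^ (θ + 1)) * (v y * (1 + |y|) ^ (θ + 1)) := by ring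
    _ ≤ a * b := by gcongr

/-- After division by (1+|x|)^(θ+1) (1+|y|)^(θ+1) the geometric factor is at most 1. Only the
product of two normalised weights, bounded by C, has to be expanded, so the error is additive and
uniform on S. -/
lemma pairWeight_le_add {v u : ℝ → ℝ} {x y C η : ℝ} (hy : 0 ≤ v y)
    (hux : 0 ≤ u x) (huy : 0 ≤ u y) (hη : 0 ≤ η)
    (hvx : v x * (1 + |x|) ^ (θ + 1) ≤ u x * (1 + |x|) ^ (θ + 1) + η)
    (hvy : v y * (1 + |y|) ^ (θ + 1) ≤ u y * (1 + |y|) ^ (θ + 1) + η)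
    (hCx : u x * (1 + |x|) ^ (θ + 1) ≤ C) (hCy : u y * (1 + |y|) ^ (θ + 1) ≤ C) :
    pairWeight θ v x y ≤ pairWeight θ u x y + (2 * C * η + η ^ 2) := by
  set A := (1 + |x|) ^ (θ + 1) with hA
  set B := (1 + |y|) ^ (θ + 1) with hB
  have hA0 : 0 < A := by positivity
  have hB0 : 0 < B := by positivity
  set P := |x - y| * |x ^ θ - y ^ θ| / (A * B) with hP
  have hP0 : 0 ≤ P := by positivity
  have hP1 : P ≤ 1 := by
    rw [hP, div_le_one (by positivity)]
    exact abs_sub_mul_abs_pow_sub_le θ x y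
  have hrep : ∀ f : ℝ → ℝ, pairWeight θ f x y = P * ((f x * A) * (f y * B)) := by
    intro f
    rw [hP]; unfold pairWeight; field_simp
  rw [hrep v, hrep u]
  have huA : 0 ≤ u x * A := by positivity
  have huB : 0 ≤ u y * B := by positivity
  calc P * ((v x * A) * (v y * B)) ≤ P * ((u x * A + η) * (u y * B + η)) := by gcongr
    _ = P * ((u x * A) * (u y * B)) + P * ((u x * A + u y * B) * η + η ^ 2) := by ring
    _ ≤ P * ((u x * A) * (u y * B)) + 1 * ((C + C) * η + η ^ 2) := by gcongr
    _ = _ := by ring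

lemma pairedWeight_nonneg (hwn_nonneg : ∀ n, ∀ x ∈ S, 0 ≤ wn n x) (n : ℕ) {x : ℝ} (hx : x ∈ S) :
    0 ≤ pairedWeight p wn n x :=
  mul_nonneg (Real.rpow_nonneg (hwn_nonneg n x hx) _) (Real.rpow_nonneg (by positivity) _)

lemma rpow_div_pred_pow {m : ℕ} (hm : 2 ≤ m) {a b : ℝ} (ha : 0 ≤ a) :
    (a ^ (b / ((m : ℝ) - 1))) ^ (m - 1) = a ^ b := by
  have h : ((m - 1 : ℕ) : ℝ) = (m : ℝ) - 1 := by rw [Nat.cast_sub (by omega)]; simp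
  have hm' : (2 : ℝ) ≤ m := by exact_mod_cast hm
  have : (m : ℝ) - 1 ≠ 0 := by linarith
  rw [← Real.rpow_natCast, ← Real.rpow_mul ha, h, div_mul_cancel₀ _ this]

lemma sq_density_eq (hwn_nonneg : ∀ n, ∀ x ∈ S, 0 ≤ wn n x) {n : ℕ} (hn : 2 ≤ p n)
    (x : Fin (p n) → S) :
    density S θ n (p n) (wn n) (incl S (p n) x) ^ 2 =
      (∏ i, (1 + (x i : ℝ) ^ 2)⁻¹) ^ 2 *
        ∏ i, ∏ j ∈ {i}ᶜ, pairWeight θ (pairedWeight p wn n) (x i) (x j) := by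
  rw [← sq_density_mul (v := wn n) (n := n) (k := fun x => 1 + x ^ 2)]
  · rw [Finset.prod_inv_distrib]
    have : ∏ i, (1 + (x i : ℝ) ^ 2) ≠ 0 := Finset.prod_ne_zero_iff.2 fun i _ => by positivity
    field_simp
  · intro y hy
    unfold pairedWeight
    rw [mul_pow, rpow_div_pred_pow hn (hwn_nonneg n y hy),
      rpow_div_pred_pow hn (by positivity), Real.rpow_natCast, Real.rpow_one]

/-- This variant without reference density serves the lower bound, where the sampling measure is
already finite. -/
lemma sq_density_eq' (hwn_nonneg : ∀ n, ∀ x ∈ S, 0 ≤ wn n x) {n : ℕ} (hn : 2 ≤ p n)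
    (x : Fin (p n) → S) :
    density S θ n (p n) (wn n) (incl S (p n) x) ^ 2 =
      ∏ i, ∏ j ∈ {i}ᶜ,
        pairWeight θ (fun y => wn n y ^ ((n : ℝ) / ((p n : ℝ) - 1))) (x i) (x j) := by
  rw [← sq_density_mul (v := wn n) (n := n) (k := fun _ => 1)]
  · simp
  · intro y hy
    rw [rpow_div_pred_pow hn (hwn_nonneg n y hy), Real.rpow_natCast, mul_one]

lemma eventually_sq_density_le_add (hκ : 0 < κ)
    (hpκ : Tendsto (fun n : ℕ => (p n : ℝ) / (n : ℝ)) atTop (𝓝 κ)) (hS : IsClosed S)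
    (hwn_nonneg : ∀ n, ∀ x ∈ S, 0 ≤ wn n x) (ha1 : WeightsConverge S wn w)
    {C δ : ℝ} (hC : 1 ≤ C) (hδ : 0 < δ)
    (hle : ∀ᶠ n in atTop, ∀ x ∈ S, pairedWeight p wn n x * (1 + |x|) ^ (θ + 1) ≤
        C * (1 + |x|) ^ (-δ))
    (hlim : ∀ x ∈ S, w x ^ (1 / κ) * (1 + |x|) ^ (θ + 1) ≤ C * (1 + |x|) ^ (-δ))
    {η : ℝ} (hη : 0 < η) :
    ∀ᶠ n in atTop, ∀ x : Fin (p n) → S,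
      density S θ n (p n) (wn n) (incl S (p n) x) ^ 2 ≤ (∏ i, (1 + (x i : ℝ) ^ 2)⁻¹) ^ 2 *
        ∏ i, ∏ j ∈ {i}ᶜ, (limitPair S θ κ w (x i, x j) + η) := by
  have hlimC : ∀ x ∈ S, w x ^ (1 / κ) * (1 + |x|) ^ (θ + 1) ≤ C := fun x hx => by
    refine (hlim x hx).trans (mul_le_of_le_one_right (by linarith) ?_)
    exact Real.rpow_le_one_of_one_le_of_nonpos (by linarith [abs_nonneg x]) (by linarith)
  -- The cap ζ ≤ 1 gives ζ² ≤ ζ, so (2C + 1) ζ ≤ η suffices.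
  obtain ⟨ζ, hζ, hζη⟩ : ∃ ζ : ℝ, 0 < ζ ∧ 2 * C * ζ + ζ ^ 2 ≤ η := by
    refine ⟨min 1 (η / (2 * C + 1)), by positivity, ?_⟩
    have h1 := min_le_left 1 (η / (2 * C + 1))
    have h2 := min_le_right 1 (η / (2 * C + 1))
    have h3 : 0 < min 1 (η / (2 * C + 1)) := by positivity
    rw [le_div_iff₀ (by positivity)] at h2
    nlinarith
  filter_upwards [eventually_pairedWeight_le_add hκ hpκ hS hwn_nonneg ha1 hδ hle hζ,
    (tendsto_atTop_of_ratio hκ hpκ).eventually_ge_atTop 2] with n h1 h2 x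
  rw [sq_density_eq hwn_nonneg h2]
  refine mul_le_mul_of_nonneg_left ?_ (sq_nonneg _)
  have hv := fun i => pairedWeight_nonneg (p := p) hwn_nonneg n (x i).2
  refine Finset.prod_le_prod (fun i _ => Finset.prod_nonneg fun j _ =>
    pairWeight_nonneg (hv i) (hv j)) fun i _ => ?_
  refine Finset.prod_le_prod (fun j _ => pairWeight_nonneg (hv i) (hv j)) fun j _ => ?_
  have hu := fun i => Real.rpow_nonneg (ha1.nonneg _ (x i).2) (1 / κ)
  refine (pairWeight_le_add (u := fun x => w x ^ (1 / κ)) (hv j) (hu i) (hu j) hζ.le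
    (h1 _ (x i).2) (h1 _ (x j).2) (hlimC _ (x i).2) (hlimC _ (x j).2)).trans ?_
  unfold limitPair
  linarith

lemma rpow_neg_mul_rpow_neg {C δ x y : ℝ} :
    (C * (1 + |x|) ^ (-δ)) * (C * (1 + |y|) ^ (-δ)) =
      C ^ 2 * Real.exp (-(δ * Real.log (1 + |x|)) - δ * Real.log (1 + |y|)) := by
  have hx : 0 < 1 + |x| := by positivity
  have hy : 0 < 1 + |y| := by positivity
  rw [Real.rpow_def_of_pos hx, Real.rpow_def_of_pos hy, sub_eq_add_neg, Real.exp_add]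
  ring_nf

lemma limitPair_le_exp (ha1 : WeightsConverge S wn w) {C δ : ℝ} (hC : 0 ≤ C)
    (hlim : ∀ x ∈ S, w x ^ (1 / κ) * (1 + |x|) ^ (θ + 1) ≤ C * (1 + |x|) ^ (-δ)) (x y : S) :
    limitPair S θ κ w (x, y) ≤
      C ^ 2 * Real.exp (-(δ * Real.log (1 + |(x : ℝ)|)) - δ * Real.log (1 + |(y : ℝ)|)) := by
  rw [← rpow_neg_mul_rpow_neg]
  exact pairWeight_le_mul (Real.rpow_nonneg (ha1.nonneg _ y.2) _) (hlim _ x.2) (hlim _ y.2)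
    (by positivity) (Real.rpow_nonneg (ha1.nonneg _ x.2) _)

lemma eventually_sq_density_le_exp (hκ : 0 < κ)
    (hpκ : Tendsto (fun n : ℕ => (p n : ℝ) / (n : ℝ)) atTop (𝓝 κ))
    (hwn_nonneg : ∀ n, ∀ x ∈ S, 0 ≤ wn n x) {C δ B : ℝ} (hC : 0 ≤ C) (hCB : C ^ 2 ≤ B)
    (hle : ∀ᶠ n in atTop, ∀ x ∈ S, pairedWeight p wn n x * (1 + |x|) ^ (θ + 1) ≤
        C * (1 + |x|) ^ (-δ)) :
    ∀ᶠ n in atTop, ∀ x : Fin (p n) → S,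
      density S θ n (p n) (wn n) (incl S (p n) x) ^ 2 ≤ (∏ i, (1 + (x i : ℝ) ^ 2)⁻¹) ^ 2 *
        ∏ i, ∏ j ∈ {i}ᶜ, (B * Real.exp (-(δ * Real.log (1 + |(x i : ℝ)|)) -
          δ * Real.log (1 + |(x j : ℝ)|))) := by
  filter_upwards [hle, (tendsto_atTop_of_ratio hκ hpκ).eventually_ge_atTop 2] with n h1 h2 x
  rw [sq_density_eq hwn_nonneg h2]
  refine mul_le_mul_of_nonneg_left ?_ (sq_nonneg _)
  have hv := fun i => pairedWeight_nonneg (p := p) hwn_nonneg n (x i).2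
  refine Finset.prod_le_prod (fun i _ => Finset.prod_nonneg fun j _ =>
    pairWeight_nonneg (hv i) (hv j)) fun i _ => ?_
  refine Finset.prod_le_prod (fun j _ => pairWeight_nonneg (hv i) (hv j)) fun j _ => ?_
  calc pairWeight θ (pairedWeight p wn n) (x i) (x j)
      ≤ (C * (1 + |(x i : ℝ)|) ^ (-δ)) * (C * (1 + |(x j : ℝ)|) ^ (-δ)) :=
        pairWeight_le_mul (hv j) (h1 _ (x i).2) (h1 _ (x j).2) (by positivity) (hv i)
    _ ≤ _ := by rw [rpow_neg_mul_rpow_neg]; gcongr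

lemma eventually_le_sq_density (hκ : 0 < κ)
    (hpκ : Tendsto (fun n : ℕ => (p n : ℝ) / (n : ℝ)) atTop (𝓝 κ))
    (hwn_nonneg : ∀ n, ∀ x ∈ S, 0 ≤ wn n x) (ha1 : WeightsConverge S wn w) {K : Set ℝ}
    (hKS : K ⊆ S \ zerosIn S w) (hK : IsCompact K) {ε : ℝ} (hε : 0 < ε) :
    ∀ᶠ n in atTop, ∀ x : Fin (p n) → S, (∀ i, (x i : ℝ) ∈ K) →
      ∏ i, ∏ j ∈ {i}ᶜ, (Real.exp (-ε) * limitPair S θ κ w (x i, x j)) ≤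
        density S θ n (p n) (wn n) (incl S (p n) x) ^ 2 := by
  -- Each pair carries two weights, and each may lose a factor exp(-ε/2).
  filter_upwards [eventually_le_weight_rpow hκ hpκ hwn_nonneg ha1 hKS hK (half_pos hε),
    (tendsto_atTop_of_ratio hκ hpκ).eventually_ge_atTop 2] with n h1 h2 x hx
  rw [sq_density_eq' hwn_nonneg h2]
  have hE := fun i j => limitPair_nonneg (θ := θ) (κ := κ) ha1.nonneg (x i, x j)
  refine Finset.prod_le_prod (fun i _ => Finset.prod_nonneg fun j _ =>
    mul_nonneg (Real.exp_pos _).le (hE i j)) fun i _ => ?_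
  refine Finset.prod_le_prod (fun j _ => mul_nonneg (Real.exp_pos _).le (hE i j)) fun j _ => ?_
  have hu := fun i => Real.rpow_nonneg (ha1.nonneg _ (x i).2) (1 / κ)
  have he : Real.exp (-ε) = Real.exp (-(ε / 2)) * Real.exp (-(ε / 2)) := by
    rw [← Real.exp_add]; congr 1; ring
  have hi := h1 _ (hx i)
  have hj := h1 _ (hx j)
  unfold limitPair pairWeight
  calc Real.exp (-ε) * (|(x i : ℝ) - x j| * |(x i : ℝ) ^ θ - (x j : ℝ) ^ θ| *
        (w (x i) ^ (1 / κ) * w (x j) ^ (1 / κ)))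
      = |(x i : ℝ) - x j| * |(x i : ℝ) ^ θ - (x j : ℝ) ^ θ| *
        ((Real.exp (-(ε / 2)) * w (x i) ^ (1 / κ)) *
          (Real.exp (-(ε / 2)) * w (x j) ^ (1 / κ))) := by rw [he]; ring
    _ ≤ _ := by
      refine mul_le_mul_of_nonneg_left ?_ (by positivity)
      exact mul_le_mul hi hj (mul_nonneg (Real.exp_pos _).le (hu j))
        ((mul_nonneg (Real.exp_pos _).le (hu i)).trans hi)

end Density

/-! ### The positive part of the logarithmic kernel -/

open Classical in
/-- The positive part of `-log |t|`, infinite at `0`. -/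
def logKernel (t : ℝ) : ℝ≥0∞ := if t = 0 then ∞ else ENNReal.ofReal (-Real.log |t|)

lemma measurable_logKernel : Measurable logKernel := by
  unfold logKernel
  exact Measurable.ite (measurableSet_singleton 0) measurable_const (by fun_prop)

lemma lintegral_logKernel_ne_top : ∫⁻ t, logKernel t ≠ ∞ := by
  have h1 : ∫⁻ t, logKernel t =
      ∫⁻ t, (Ioc (-1 : ℝ) 1).indicator (fun t => ENNReal.ofReal (-Real.log t)) t := by
    refine lintegral_congr_ae ?_
    have h0 : ∀ᵐ t : ℝ, t ≠ 0 := by simp [ae_iff]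
    have h1 : ∀ᵐ t : ℝ, t ≠ -1 := by simp [ae_iff]
    filter_upwards [h0, h1] with t ht ht1
    by_cases h : t ∈ Ioc (-1 : ℝ) 1
    · rw [indicator_of_mem h, logKernel, if_neg ht, Real.log_abs]
    · rw [indicator_of_notMem h, logKernel, if_neg ht, ENNReal.ofReal_eq_zero]
      have : 1 ≤ |t| := by
        by_contra! hlt
        rw [abs_lt] at hlt
        exact h ⟨hlt.1, hlt.2.le⟩
      linarith [Real.log_nonneg this]
  have h2 : IntervalIntegrable Real.log volume (-1) 1 := intervalIntegral.intervalIntegrable_log'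
  rw [intervalIntegrable_iff_integrableOn_Ioc_of_le (by norm_num)] at h2
  rw [h1, lintegral_indicator measurableSet_Ioc]
  exact (h2.neg.lintegral_lt_top).ne

lemma logKernel_mul_le {s t : ℝ} (hs : 0 < s) :
    logKernel (s * t) ≤ ENNReal.ofReal (-Real.log s) + logKernel t := by
  unfold logKernel
  by_cases ht : t = 0
  · simp [ht]
  · rw [if_neg (mul_ne_zero hs.ne' ht), if_neg ht, abs_mul, abs_of_pos hs,
      Real.log_mul hs.ne' (abs_ne_zero.2 ht), neg_add]
    exact ENNReal.ofReal_add_le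

lemma logKernel_le_of_abs_le {s t : ℝ} {c : ℝ} (hc : 0 < c) (hs : s ≠ 0) (h : |t| ≤ c * |s|) :
    logKernel s ≤ logKernel t + ENNReal.ofReal (Real.log c) := by
  unfold logKernel
  by_cases ht : t = 0
  · simp [ht]
  · rw [if_neg hs, if_neg ht]
    refine le_trans (ENNReal.ofReal_le_ofReal ?_) ENNReal.ofReal_add_le
    have := Real.log_le_log (abs_pos.2 ht) h
    rw [Real.log_mul hc.ne' (abs_ne_zero.2 hs)] at this
    linarith

/-- The uniform distribution on the unit interval. -/
def unitUniform : Measure ℝ := volume.restrict (Icc 0 1)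

instance : IsProbabilityMeasure unitUniform := ⟨by simp [unitUniform]⟩

/-- Scaling out δ costs -log δ, and translation invariance makes the rest independent of s. -/
lemma lintegral_logKernel_affine_le {s δ : ℝ} (hδ : 0 < δ) :
    ∫⁻ u, logKernel (s + δ * u) ∂unitUniform ≤
      ENNReal.ofReal (-Real.log δ) + ∫⁻ t, logKernel t := by
  calc ∫⁻ u, logKernel (s + δ * u) ∂unitUniform
      ≤ ∫⁻ u, (ENNReal.ofReal (-Real.log δ) + logKernel (s / δ + u)) ∂unitUniform := by
        refine lintegral_mono fun u => ?_
        rw [show s + δ * u = δ * (s / δ + u) by field_simp]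
        exact logKernel_mul_le hδ
    _ = ENNReal.ofReal (-Real.log δ) + ∫⁻ u, logKernel (s / δ + u) ∂unitUniform := by
        rw [lintegral_add_left measurable_const]; simp
    _ ≤ ENNReal.ofReal (-Real.log δ) + ∫⁻ u, logKernel (s / δ + u) := by
        gcongr
        exact Measure.restrict_le_self
    _ = _ := by rw [lintegral_add_left_eq_self (fun t => logKernel t)]

/-- The constant does not depend on r, δ or v, which supplies domination as δ → 0. If |r| ≥ 4δ, the
displacement changes |r| by at most a quarter. If |r| < 4δ, then -log δ is itself controlled by the
kernel at r, up to log 4. -/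
lemma lintegral_logKernel_smear_le {r δ v : ℝ} (hδ : 0 < δ) (hv : v ∈ Icc (0 : ℝ) 1) :
    ∫⁻ u, logKernel (r + δ * (u - v)) ∂unitUniform ≤
      logKernel r + (ENNReal.ofReal (Real.log 4) + ∫⁻ t, logKernel t) := by
  rcases le_or_gt (4 * δ) |r| with h | h
  · calc ∫⁻ u, logKernel (r + δ * (u - v)) ∂unitUniform
        ≤ ∫⁻ _, (logKernel r + ENNReal.ofReal (Real.log 4)) ∂unitUniform := by
          refine lintegral_mono_ae ?_
          unfold unitUniform
          filter_upwards [ae_restrict_mem measurableSet_Icc] with u hu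
          have h1 : |u - v| ≤ 1 := by rw [abs_le]; constructor <;> linarith [hu.1, hu.2, hv.1, hv.2]
          have h2 : |r| ≤ |r + δ * (u - v)| + δ := by
            calc |r| = |(r + δ * (u - v)) - δ * (u - v)| := by ring_nf
              _ ≤ |r + δ * (u - v)| + |δ * (u - v)| := abs_sub _ _
              _ ≤ _ := by
                rw [abs_mul, abs_of_pos hδ]
                gcongr
                nlinarith
          refine logKernel_le_of_abs_le (by norm_num) ?_ ?_
          · intro h0; rw [h0, abs_zero] at h2; linarith
          · linarith
      _ = logKernel r + ENNReal.ofReal (Real.log 4) := by simp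
      _ ≤ _ := by gcongr; exact le_self_add
  · have h1 : ENNReal.ofReal (-Real.log δ) ≤ logKernel r + ENNReal.ofReal (Real.log 4) := by
      have := logKernel_le_of_abs_le (s := δ) (t := r) (c := 4) (by norm_num) hδ.ne'
        (by rw [abs_of_pos hδ]; exact h.le)
      rwa [logKernel, if_neg hδ.ne', abs_of_pos hδ] at this
    calc ∫⁻ u, logKernel (r + δ * (u - v)) ∂unitUniform
        = ∫⁻ u, logKernel ((r - δ * v) + δ * u) ∂unitUniform := by
          congr 1; funext u; congr 1; ring
      _ ≤ ENNReal.ofReal (-Real.log δ) + ∫⁻ t, logKernel t := lintegral_logKernel_affine_le hδ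
      _ ≤ _ := by rw [← add_assoc]; gcongr

/-! ### Smearing a measure by a small uniform translation -/

section Smear

variable {S : Set ℝ} {κ B : ℝ} {E : S × S → ℝ}

open Classical in
/-- Translation by `δ u`, as long as this does not leave `S`. -/
def shift (S : Set ℝ) (δ : ℝ) (z : S × ℝ) : S :=
  if h : (z.1 : ℝ) + δ * z.2 ∈ S then ⟨(z.1 : ℝ) + δ * z.2, h⟩ else z.1

open Classical in
lemma measurable_shift (hS : MeasurableSet S) (δ : ℝ) : Measurable (shift S δ) := by
  have h0 : Measurable fun z : S × ℝ => (z.1 : ℝ) + δ * z.2 := by fun_prop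
  rw [← (MeasurableEmbedding.subtype_coe hS).measurable_comp_iff]
  have h1 : Subtype.val ∘ shift S δ =
      {z : S × ℝ | (z.1 : ℝ) + δ * z.2 ∈ S}.piecewise (fun z => (z.1 : ℝ) + δ * z.2)
        fun z => (z.1 : ℝ) := by
    funext z
    by_cases h : (z.1 : ℝ) + δ * z.2 ∈ S <;> simp [shift, piecewise, h]
  rw [h1]
  exact h0.piecewise (h0 hS) (by fun_prop)

lemma coe_shift {δ : ℝ} {x : S} {u : ℝ} (h : (x : ℝ) + δ * u ∈ S) :
    (shift S δ (x, u) : ℝ) = x + δ * u := by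
  unfold shift
  rw [dif_pos h]

/-- The law of `X + δ U` with `X` distributed according to `ν` and `U` uniform. -/
def smear (hS : MeasurableSet S) (δ : ℝ) (ν : ProbabilityMeasure S) : ProbabilityMeasure S :=
  ⟨((ν : Measure S).prod unitUniform).map (shift S δ),
    Measure.isProbabilityMeasure_map (measurable_shift hS δ).aemeasurable⟩

lemma coe_smear (hS : MeasurableSet S) (δ : ℝ) (ν : ProbabilityMeasure S) :
    (smear hS δ ν : Measure S) = ((ν : Measure S).prod unitUniform).map (shift S δ) := rfl

variable {K : Set ℝ} {δ₀ : ℝ}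

lemma add_mul_mem_cthickening {δ x u : ℝ} (hδ : 0 < δ) (hδ₀ : δ ≤ δ₀) (hx : x ∈ K)
    (hu : u ∈ Icc (0 : ℝ) 1) : x + δ * u ∈ Metric.cthickening δ₀ K := by
  refine Metric.mem_cthickening_of_dist_le _ x _ _ hx ?_
  rw [Real.dist_eq, add_sub_cancel_left, abs_of_nonneg (mul_nonneg hδ.le hu.1)]
  nlinarith [hu.2]

lemma ae_prod_unitUniform {ν : ProbabilityMeasure S} (hν : ∀ᵐ x : S ∂(ν : Measure S), (x : ℝ) ∈ K) :
    ∀ᵐ z ∂((ν : Measure S).prod unitUniform), (z.1 : ℝ) ∈ K ∧ z.2 ∈ Icc (0 : ℝ) 1 := by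
  have h2 : ∀ᵐ u ∂unitUniform, u ∈ Icc (0 : ℝ) 1 := ae_restrict_mem measurableSet_Icc
  exact (Measure.quasiMeasurePreserving_fst.ae hν).and (Measure.quasiMeasurePreserving_snd.ae h2)

lemma ae_smear (hS : MeasurableSet S) {ν : ProbabilityMeasure S}
    (hν : ∀ᵐ x : S ∂(ν : Measure S), (x : ℝ) ∈ K)
    (hKS : Metric.cthickening δ₀ K ⊆ S) {δ : ℝ} (hδ : 0 < δ) (hδ₀ : δ ≤ δ₀) :
    ∀ᵐ x : S ∂(smear hS δ ν : Measure S), (x : ℝ) ∈ Metric.cthickening δ₀ K := by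
  rw [coe_smear, ae_map_iff (measurable_shift hS δ).aemeasurable
    (measurable_subtype_coe Metric.isClosed_cthickening.measurableSet)]
  filter_upwards [ae_prod_unitUniform hν] with z hz
  have := add_mul_mem_cthickening hδ hδ₀ hz.1 hz.2
  rwa [coe_shift (hKS this)]

/-- For fixed x near which no translation leaves S, the law of x + δU has density at most 1/δ;
averaging over x preserves this. -/
lemma smear_le (hS : MeasurableSet S) {ν : ProbabilityMeasure S}
    (hν : ∀ᵐ x : S ∂(ν : Measure S), (x : ℝ) ∈ K)
    (hKS : Metric.cthickening δ₀ K ⊆ S) {δ : ℝ} (hδ : 0 < δ) (hδ₀ : δ ≤ δ₀) :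
    (smear hS δ ν : Measure S) ≤
      ENNReal.ofReal δ⁻¹ • (volume : Measure ℝ).comap (Subtype.val : S → ℝ) := by
  refine Measure.le_iff.2 fun A hA => ?_
  have hemb : MeasurableEmbedding (Subtype.val : S → ℝ) := MeasurableEmbedding.subtype_coe hS
  rw [coe_smear, Measure.map_apply (measurable_shift hS δ) hA, Measure.smul_apply,
    hemb.comap_apply, smul_eq_mul, Measure.prod_apply (measurable_shift hS δ hA)]
  calc ∫⁻ x, unitUniform (Prod.mk x ⁻¹' (shift S δ ⁻¹' A)) ∂(ν : Measure S)
      ≤ ∫⁻ _, ENNReal.ofReal δ⁻¹ * volume (Subtype.val '' A) ∂(ν : Measure S) := by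
        refine lintegral_mono_ae ?_
        filter_upwards [hν] with x hx
        have h2 : unitUniform (Prod.mk x ⁻¹' (shift S δ ⁻¹' A)) ≤
            volume ((fun u => δ * u) ⁻¹' ((fun y => (x : ℝ) + y) ⁻¹' (Subtype.val '' A))) := by
          unfold unitUniform
          rw [Measure.restrict_apply' measurableSet_Icc]
          refine measure_mono fun u hu => ?_
          have := hKS (add_mul_mem_cthickening hδ hδ₀ hx hu.2)
          exact ⟨shift S δ (x, u), hu.1, coe_shift this⟩
        refine h2.trans (le_of_eq ?_)
        rw [Real.volume_preimage_mul_left hδ.ne', measure_preimage_add,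
          abs_of_pos (inv_pos.2 hδ)]
    _ = _ := by simp

lemma dist_shift_le (δ : ℝ) (x : S) (u : ℝ) : dist (shift S δ (x, u)) x ≤ |δ * u| := by
  by_cases h : (x : ℝ) + δ * u ∈ S
  · rw [Subtype.dist_eq, coe_shift h, Real.dist_eq, add_sub_cancel_left]
  · unfold shift; rw [dif_neg h, dist_self]; positivity

lemma tendsto_shift {δ : ℕ → ℝ} (hδt : Tendsto δ atTop (𝓝 0)) (x : S) (u : ℝ) :
    Tendsto (fun n => shift S (δ n) (x, u)) atTop (𝓝 x) := by
  rw [tendsto_iff_dist_tendsto_zero]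
  exact squeeze_zero (fun _ => dist_nonneg) (fun n => dist_shift_le _ x u)
    (by simpa using (hδt.mul_const u).abs)

lemma tendsto_smear (hS : MeasurableSet S) (ν : ProbabilityMeasure S) {δ : ℕ → ℝ}
    (hδt : Tendsto δ atTop (𝓝 0)) : Tendsto (fun n => smear hS (δ n) ν) atTop (𝓝 ν) := by
  rw [ProbabilityMeasure.tendsto_iff_forall_integral_tendsto]
  intro f
  have h1 : ∀ n, ∫ y, f y ∂(smear hS (δ n) ν : Measure S) =
      ∫ z, f (shift S (δ n) z) ∂((ν : Measure S).prod unitUniform) := fun n => by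
    rw [coe_smear, integral_map (measurable_shift hS _).aemeasurable
      f.continuous.aestronglyMeasurable]
  have h2 : ∫ y, f y ∂(ν : Measure S) = ∫ z, f z.1 ∂((ν : Measure S).prod unitUniform) := by
    have h3 : (((ν : Measure S).prod unitUniform).map Prod.fst) = (ν : Measure S) := by
      rw [Measure.map_fst_prod]; simp
    rw [← h3, integral_map measurable_fst.aemeasurable f.continuous.aestronglyMeasurable, h3]
  simp_rw [h1]
  rw [h2]
  refine tendsto_integral_of_dominated_convergence (fun _ => ‖f‖) (fun n => ?_)
    (integrable_const _) (fun n => Eventually.of_forall fun z => f.norm_coe_le_norm _)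
    (Eventually.of_forall fun z => ?_)
  · exact (f.continuous.measurable.comp (measurable_shift hS _)).aestronglyMeasurable
  · exact (f.continuous.tendsto _).comp (tendsto_shift hδt z.1 z.2)

/-! ### Energy of smeared measures -/

/-- The interaction cost averaged over independent uniform translations. -/
def smearCost (κ B : ℝ) (E : S × S → ℝ) (δ : ℝ) (z : S × S) : ℝ≥0∞ :=
  ∫⁻ q, cost κ B E (shift S δ (z.1, q.1), shift S δ (z.2, q.2)) ∂(unitUniform.prod unitUniform)

lemma measurable_cost_shift (hS : MeasurableSet S) (hE : Measurable E) (δ : ℝ) :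
    Measurable fun r : (S × S) × ℝ × ℝ =>
      cost κ B E (shift S δ (r.1.1, r.2.1), shift S δ (r.1.2, r.2.2)) := by
  have h := measurable_shift hS δ
  exact (measurable_cost hE).comp ((h.comp (by fun_prop)).prodMk (h.comp (by fun_prop)))

lemma measurable_smearCost (hS : MeasurableSet S) (hE : Measurable E) (δ : ℝ) :
    Measurable (smearCost κ B E δ) :=
  (measurable_cost_shift hS hE δ).lintegral_prod_right'

/-- By Tonelli, two independent copies of X + δU are averaged first over the translations and then
over the base points. -/
lemma costEnergy_smear (hS : MeasurableSet S) (hE : Measurable E) (δ : ℝ)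
    (ν : ProbabilityMeasure S) :
    costEnergy κ B E (smear hS δ ν) =
      ∫⁻ z, smearCost κ B E δ z ∂((ν : Measure S).prod (ν : Measure S)) := by
  have hs := measurable_shift hS δ
  have hc : Measurable (cost κ B E) := measurable_cost hE
  have hm := measurable_cost_shift (κ := κ) (B := B) hS hE δ
  rw [lintegral_prod _ (measurable_smearCost hS hE δ).aemeasurable]
  unfold costEnergy
  rw [lintegral_prod _ hc.aemeasurable, coe_smear,
    lintegral_map (hc.lintegral_prod_right') hs, lintegral_prod _ (by
      exact (hc.lintegral_prod_right'.comp hs).aemeasurable)]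
  refine lintegral_congr fun x => ?_
  have h1 : ∀ u, ∫⁻ b, cost κ B E (shift S δ (x, u), b)
      ∂(((ν : Measure S).prod unitUniform).map (shift S δ)) =
      ∫⁻ y, ∫⁻ v, cost κ B E (shift S δ (x, u), shift S δ (y, v)) ∂unitUniform
        ∂(ν : Measure S) := by
    intro u
    rw [lintegral_map (by fun_prop) hs, lintegral_prod _ (by fun_prop)]
  simp_rw [h1]
  rw [lintegral_lintegral_swap]
  · refine lintegral_congr fun y => ?_
    unfold smearCost
    rw [lintegral_prod _ (by
      exact (hm.comp (measurable_prodMk_left (x := (x, y)))).aemeasurable)]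
  · refine Measurable.aemeasurable ?_
    have : Measurable fun r : (ℝ × S) × ℝ =>
        cost κ B E (shift S δ (x, r.1.1), shift S δ (r.1.2, r.2)) :=
      hm.comp (f := fun r : (ℝ × S) × ℝ => ((x, r.1.2), (r.1.1, r.2))) (by fun_prop)
    exact this.lintegral_prod_right'

variable {c C : ℝ}

/-- Where E is comparable to |x - y|², the cost agrees with κ² times the logarithmic kernel up to
bounded terms. This and the converse `logKernel_le_cost` reduce smearing to that kernel. -/
lemma cost_le_logKernel (hκ : 0 < κ) (hc : 0 < c) {x y : S}
    (hlow : c * |(x : ℝ) - y| ^ 2 ≤ E (x, y)) :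
    cost κ B E (x, y) ≤ ENNReal.ofReal (κ ^ 2 / 2 * (Real.log B - Real.log c)) +
      ENNReal.ofReal (κ ^ 2) * logKernel (x - y) := by
  by_cases hxy : (x : ℝ) - y = 0
  · have : ENNReal.ofReal (κ ^ 2) ≠ 0 := (ENNReal.ofReal_pos.2 (by positivity)).ne'
    simp [logKernel, hxy, ENNReal.mul_top this]
  · have habs : 0 < |(x : ℝ) - y| := abs_pos.2 hxy
    have hpos : 0 < E (x, y) := lt_of_lt_of_le (by positivity) hlow
    rw [logKernel, if_neg hxy, cost, if_neg hpos.ne', ← ENNReal.ofReal_mul (by positivity)]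
    refine le_trans (ENNReal.ofReal_le_ofReal ?_) ENNReal.ofReal_add_le
    have h := Real.log_le_log (by positivity) hlow
    rw [Real.log_mul hc.ne' (by positivity), Real.log_pow] at h
    push_cast at h
    have : κ ^ 2 / 2 * (Real.log B - Real.log (E (x, y))) ≤
        κ ^ 2 / 2 * (Real.log B - (Real.log c + 2 * Real.log |(x : ℝ) - y|)) := by gcongr
    linarith

lemma logKernel_le_cost (hκ : 0 < κ) (hC : 0 < C) (hE0 : ∀ z, 0 ≤ E z) {x y : S}
    (hup : E (x, y) ≤ C * |(x : ℝ) - y| ^ 2) :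
    ENNReal.ofReal (κ ^ 2) * logKernel (x - y) ≤
      cost κ B E (x, y) + ENNReal.ofReal (κ ^ 2 / 2 * (Real.log C - Real.log B)) := by
  by_cases h0 : E (x, y) = 0
  · simp [cost, h0]
  · have hpos : 0 < E (x, y) := lt_of_le_of_ne (hE0 _) (Ne.symm h0)
    have hxy : (x : ℝ) - y ≠ 0 := by
      intro h
      rw [h] at hup
      simp at hup
      linarith
    have habs : 0 < |(x : ℝ) - y| := abs_pos.2 hxy
    rw [logKernel, if_neg hxy, cost, if_neg h0, ← ENNReal.ofReal_mul (by positivity)]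
    refine le_trans (ENNReal.ofReal_le_ofReal ?_) ENNReal.ofReal_add_le
    have h := Real.log_le_log hpos hup
    rw [Real.log_mul hC.ne' (by positivity), Real.log_pow] at h
    push_cast at h
    have : κ ^ 2 / 2 * Real.log (E (x, y)) ≤
        κ ^ 2 / 2 * (Real.log C + 2 * Real.log |(x : ℝ) - y|) := by gcongr
    linarith

lemma smearCost_le (hκ : 0 < κ) (hS : MeasurableSet S) (hE : Measurable E) (hc : 0 < c)
    (hKS : Metric.cthickening δ₀ K ⊆ S)
    (hlow : ∀ x y : S, (x : ℝ) ∈ Metric.cthickening δ₀ K → (y : ℝ) ∈ Metric.cthickening δ₀ K →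
      c * |(x : ℝ) - y| ^ 2 ≤ E (x, y)) {δ : ℝ} (hδ : 0 < δ) (hδ₀ : δ ≤ δ₀)
    {x y : S} (hx : (x : ℝ) ∈ K) (hy : (y : ℝ) ∈ K) :
    smearCost κ B E δ (x, y) ≤ ∫⁻ v, (ENNReal.ofReal (κ ^ 2 / 2 * (Real.log B - Real.log c)) +
      ENNReal.ofReal (κ ^ 2) * ∫⁻ u, logKernel ((x - y : ℝ) + δ * (u - v)) ∂unitUniform)
        ∂unitUniform := by
  unfold smearCost
  rw [lintegral_prod_symm _ (by
    exact ((measurable_cost_shift hS hE δ).comp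
      (measurable_prodMk_left (x := (x, y)))).aemeasurable)]
  refine lintegral_mono_ae ?_
  have hae : ∀ᵐ u ∂unitUniform, u ∈ Icc (0 : ℝ) 1 := ae_restrict_mem measurableSet_Icc
  filter_upwards [hae] with v hv
  have hmeas : Measurable fun u => logKernel ((x - y : ℝ) + δ * (u - v)) :=
    measurable_logKernel.comp (by fun_prop)
  calc ∫⁻ u, cost κ B E (shift S δ (x, u), shift S δ (y, v)) ∂unitUniform
      ≤ ∫⁻ u, (ENNReal.ofReal (κ ^ 2 / 2 * (Real.log B - Real.log c)) +
          ENNReal.ofReal (κ ^ 2) * logKernel ((x - y : ℝ) + δ * (u - v))) ∂unitUniform := by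
        refine lintegral_mono_ae ?_
        filter_upwards [hae] with u hu
        have h1 := add_mul_mem_cthickening hδ hδ₀ hx hu
        have h2 := add_mul_mem_cthickening hδ hδ₀ hy hv
        have e1 := coe_shift (x := x) (hKS h1)
        have e2 := coe_shift (x := y) (hKS h2)
        have h3 := cost_le_logKernel (B := B) hκ hc
          (hlow (shift S δ (x, u)) (shift S δ (y, v)) (by rwa [e1]) (by rwa [e2]))
        rw [e1, e2] at h3
        refine h3.trans (le_of_eq ?_)
        congr 3; ring
    _ = _ := by
        rw [lintegral_add_left measurable_const, lintegral_const_mul _ hmeas]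
        simp

/-- No energy of ν is assumed: smearing regularises even a point mass. -/
lemma costEnergy_smear_ne_top (hκ : 0 < κ) (hS : MeasurableSet S) (hE : Measurable E) (hc : 0 < c)
    (hKS : Metric.cthickening δ₀ K ⊆ S)
    (hlow : ∀ x y : S, (x : ℝ) ∈ Metric.cthickening δ₀ K → (y : ℝ) ∈ Metric.cthickening δ₀ K →
      c * |(x : ℝ) - y| ^ 2 ≤ E (x, y)) {δ : ℝ} (hδ : 0 < δ) (hδ₀ : δ ≤ δ₀)
    {ν : ProbabilityMeasure S} (hν : ∀ᵐ x : S ∂(ν : Measure S), (x : ℝ) ∈ K) :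
    costEnergy κ B E (smear hS δ ν) ≠ ∞ := by
  set a := ENNReal.ofReal (κ ^ 2 / 2 * (Real.log B - Real.log c)) + ENNReal.ofReal (κ ^ 2) *
    (ENNReal.ofReal (-Real.log δ) + ∫⁻ t, logKernel t) with ha
  have hafin : a ≠ ∞ := by
    refine ENNReal.add_ne_top.2 ⟨ENNReal.ofReal_ne_top, ENNReal.mul_ne_top ENNReal.ofReal_ne_top ?_⟩
    exact ENNReal.add_ne_top.2 ⟨ENNReal.ofReal_ne_top, lintegral_logKernel_ne_top⟩
  have hle : ∀ᵐ z ∂((ν : Measure S).prod (ν : Measure S)), smearCost κ B E δ z ≤ a := by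
    filter_upwards [Measure.quasiMeasurePreserving_fst.ae hν,
      Measure.quasiMeasurePreserving_snd.ae hν] with z h1 h2
    refine (smearCost_le hκ hS hE hc hKS hlow hδ hδ₀ h1 h2).trans ?_
    calc _ ≤ ∫⁻ _, a ∂unitUniform := by
          refine lintegral_mono fun v => ?_
          dsimp only
          rw [ha]
          gcongr
          have := lintegral_logKernel_affine_le (s := (z.1 - z.2 : ℝ) - δ * v) hδ
          refine le_trans (le_of_eq ?_) this
          congr 1; funext u; congr 1; ring
      _ = a := by simp
  rw [costEnergy_smear hS hE]
  refine (lt_of_le_of_lt (lintegral_mono_ae hle) ?_).ne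
  simpa using hafin.lt_top

/-- Pass from the cost to the logarithmic kernel, smear there, and pass back. The added constant is
independent of δ, so the right side dominates as δ → 0. -/
lemma smearCost_le_cost_add (hκ : 0 < κ) (hS : MeasurableSet S) (hE : Measurable E)
    (hE0 : ∀ z, 0 ≤ E z) (hc : 0 < c) (hC : 0 < C)
    (hKS : Metric.cthickening δ₀ K ⊆ S)
    (hlow : ∀ x y : S, (x : ℝ) ∈ Metric.cthickening δ₀ K → (y : ℝ) ∈ Metric.cthickening δ₀ K →
      c * |(x : ℝ) - y| ^ 2 ≤ E (x, y)) {δ : ℝ} (hδ : 0 < δ) (hδ₀ : δ ≤ δ₀)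
    {x y : S} (hx : (x : ℝ) ∈ K) (hy : (y : ℝ) ∈ K)
    (hup : E (x, y) ≤ C * |(x : ℝ) - y| ^ 2) :
    smearCost κ B E δ (x, y) ≤ cost κ B E (x, y) +
      (ENNReal.ofReal (κ ^ 2 / 2 * (Real.log C - Real.log B)) +
        ENNReal.ofReal (κ ^ 2 / 2 * (Real.log B - Real.log c)) +
        ENNReal.ofReal (κ ^ 2) * (ENNReal.ofReal (Real.log 4) + ∫⁻ t, logKernel t)) := by
  refine (smearCost_le hκ hS hE hc hKS hlow hδ hδ₀ hx hy).trans ?_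
  have hae : ∀ᵐ u ∂unitUniform, u ∈ Icc (0 : ℝ) 1 := ae_restrict_mem measurableSet_Icc
  set a := ENNReal.ofReal (κ ^ 2 / 2 * (Real.log B - Real.log c))
  set L := ENNReal.ofReal (Real.log 4) + ∫⁻ t, logKernel t
  calc _ ≤ ∫⁻ _, (a + ENNReal.ofReal (κ ^ 2) * (logKernel (x - y) + L)) ∂unitUniform := by
        refine lintegral_mono_ae ?_
        filter_upwards [hae] with v hv
        gcongr
        exact lintegral_logKernel_smear_le hδ hv
    _ = a + (ENNReal.ofReal (κ ^ 2) * logKernel (x - y) + ENNReal.ofReal (κ ^ 2) * L) := by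
        simp [mul_add]
    _ ≤ a + ((cost κ B E (x, y) + ENNReal.ofReal (κ ^ 2 / 2 * (Real.log C - Real.log B))) +
          ENNReal.ofReal (κ ^ 2) * L) := by
        gcongr
        exact logKernel_le_cost hκ hC hE0 hup
    _ = _ := by ring

lemma continuousAt_cost (hE : Continuous E) {z : S × S} (hz : E z ≠ 0) :
    ContinuousAt (cost κ B E) z := by
  have h1 : ContinuousAt (fun z => ENNReal.ofReal (κ ^ 2 / 2 * (Real.log B - Real.log (E z)))) z :=
    ENNReal.continuous_ofReal.continuousAt.comp
      ((continuousAt_const.sub (hE.continuousAt.log hz)).const_mul _)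
  refine h1.congr ?_
  filter_upwards [hE.continuousAt.eventually_ne hz] with z' hz'
  rw [cost, if_neg hz']

lemma tendsto_smearCost (hS : MeasurableSet S) (hE : Continuous E) {δ : ℕ → ℝ}
    (hδt : Tendsto δ atTop (𝓝 0)) {z : S × S} (hz : E z ≠ 0) :
    Tendsto (fun n => smearCost κ B E (δ n) z) atTop (𝓝 (cost κ B E z)) := by
  have hcont := continuousAt_cost (κ := κ) (B := B) hE hz
  have hfin : cost κ B E z ≠ ∞ := by rw [cost, if_neg hz]; exact ENNReal.ofReal_ne_top
  have hconst : cost κ B E z = ∫⁻ _, cost κ B E z ∂(unitUniform.prod unitUniform) := by simp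
  rw [hconst]
  unfold smearCost
  refine tendsto_lintegral_filter_of_dominated_convergence (fun _ => cost κ B E z + 1)
    (Eventually.of_forall fun n => (measurable_cost_shift hS hE.measurable (δ n)).comp
      (measurable_prodMk_left (x := z))) ?_ (by simpa using hfin) (Eventually.of_forall fun q => ?_)
  · have h1 : ∀ᶠ z' in 𝓝 z, cost κ B E z' < cost κ B E z + 1 :=
      hcont.eventually_lt_const (ENNReal.lt_add_right hfin one_ne_zero)
    obtain ⟨r, hr, hball⟩ := Metric.eventually_nhds_iff.1 h1
    have h2 : ∀ᶠ n in atTop, |δ n| < r := by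
      have := hδt.abs
      rw [abs_zero] at this
      exact this.eventually_lt_const hr
    have hae : ∀ᵐ u ∂unitUniform, u ∈ Icc (0 : ℝ) 1 := ae_restrict_mem measurableSet_Icc
    filter_upwards [h2] with n hn
    filter_upwards [Measure.quasiMeasurePreserving_fst.ae hae,
      Measure.quasiMeasurePreserving_snd.ae hae] with q hq1 hq2
    have hd : ∀ (x : S) (u : ℝ), u ∈ Icc (0 : ℝ) 1 → dist (shift S (δ n) (x, u)) x < r := by
      intro x u hu
      refine lt_of_le_of_lt (dist_shift_le _ x u) (lt_of_le_of_lt ?_ hn)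
      rw [abs_mul, abs_of_nonneg hu.1]
      exact mul_le_of_le_one_right (abs_nonneg _) hu.2
    refine (hball ?_).le
    rw [Prod.dist_eq]
    exact max_lt (hd _ _ hq1) (hd _ _ hq2)
  · exact hcont.tendsto.comp ((tendsto_shift hδt z.1 q.1).prodMk_nhds (tendsto_shift hδt z.2 q.2))

/-- Dominated convergence: finite energy forces E ≠ 0 almost everywhere, and at such pairs the cost
is continuous. -/
lemma tendsto_costEnergy_smear (hκ : 0 < κ) (hS : MeasurableSet S) (hE : Continuous E)
    (hE0 : ∀ z, 0 ≤ E z) (hc : 0 < c) (hC : 0 < C)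
    (hKS : Metric.cthickening δ₀ K ⊆ S)
    (hlow : ∀ x y : S, (x : ℝ) ∈ Metric.cthickening δ₀ K → (y : ℝ) ∈ Metric.cthickening δ₀ K →
      c * |(x : ℝ) - y| ^ 2 ≤ E (x, y))
    (hup : ∀ x y : S, (x : ℝ) ∈ K → (y : ℝ) ∈ K → E (x, y) ≤ C * |(x : ℝ) - y| ^ 2)
    {ν : ProbabilityMeasure S} (hν : ∀ᵐ x : S ∂(ν : Measure S), (x : ℝ) ∈ K)
    (hfin : costEnergy κ B E ν ≠ ∞) {δ : ℕ → ℝ} (hδ : ∀ n, 0 < δ n)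
    (hδt : Tendsto δ atTop (𝓝 0)) (hδ₀ : 0 < δ₀) :
    Tendsto (fun n => costEnergy κ B E (smear hS (δ n) ν)) atTop (𝓝 (costEnergy κ B E ν)) := by
  simp_rw [costEnergy_smear hS hE.measurable]
  have hcm : Measurable (cost κ B E) := measurable_cost hE.measurable
  have hfst := (Measure.quasiMeasurePreserving_fst (μ := (ν : Measure S)) (ν := (ν : Measure S))).ae hν
  have hsnd := (Measure.quasiMeasurePreserving_snd (μ := (ν : Measure S)) (ν := (ν : Measure S))).ae hν
  refine tendsto_lintegral_filter_of_dominated_convergence (fun z => cost κ B E z +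
      (ENNReal.ofReal (κ ^ 2 / 2 * (Real.log C - Real.log B)) +
        ENNReal.ofReal (κ ^ 2 / 2 * (Real.log B - Real.log c)) +
        ENNReal.ofReal (κ ^ 2) * (ENNReal.ofReal (Real.log 4) + ∫⁻ t, logKernel t)))
    (Eventually.of_forall fun n => measurable_smearCost hS hE.measurable _) ?_ ?_ ?_
  · filter_upwards [hδt.eventually_le_const hδ₀] with n hn
    filter_upwards [hfst, hsnd] with z h1 h2
    exact smearCost_le_cost_add hκ hS hE.measurable hE0 hc hC hKS hlow (hδ n) hn h1 h2
      (hup _ _ h1 h2)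
  · rw [lintegral_add_left hcm]
    refine ENNReal.add_ne_top.2 ⟨hfin, ?_⟩
    have := lintegral_logKernel_ne_top
    simp [ENNReal.mul_eq_top, this]
  · filter_upwards [ae_lt_top hcm hfin] with z hz
    refine tendsto_smearCost hS hE hδt fun h => ?_
    simp [cost, h] at hz

end Smear

section Approximation

variable {S : Set ℝ} {κ B : ℝ} {E : S × S → ℝ}

/-! ### Measures of finite energy -/

/-- The cost is infinite on {x} × {x}, which has mass μ{x}². -/
lemma measure_singleton_eq_zero_of_costEnergy (hE : Measurable E) (hdiag : ∀ x, E (x, x) = 0)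
    {μ : ProbabilityMeasure S} (hμ : costEnergy κ B E μ ≠ ∞) (x : S) :
    (μ : Measure S) {x} = 0 := by
  have h1 := ae_lt_top (measurable_cost hE) hμ
  have h2 : ((μ : Measure S).prod (μ : Measure S)) ({x} ×ˢ {x}) = 0 := by
    refine measure_mono_null ?_ h1
    rintro ⟨a, b⟩ ⟨ha, hb⟩
    simp only [mem_singleton_iff] at ha hb
    subst ha; subst hb
    simp [cost, hdiag]
  rw [Measure.prod_prod] at h2
  simpa using h2

lemma ae_mem_of_countable_diff (hE : Measurable E) (hdiag : ∀ x, E (x, x) = 0)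
    {μ : ProbabilityMeasure S} (hμ : costEnergy κ B E μ ≠ ∞) {U : Set ℝ}
    (hU : (S \ U).Countable) : ∀ᵐ x : S ∂(μ : Measure S), (x : ℝ) ∈ U := by
  have hc : {x : S | (x : ℝ) ∉ U}.Countable := by
    refine MapsTo.countable_of_injOn (f := Subtype.val) (t := S \ U) ?_
      Subtype.val_injective.injOn hU
    exact fun x hx => ⟨x.2, hx⟩
  change (μ : Measure S) {x : S | (x : ℝ) ∉ U} = 0
  rw [← biUnion_of_singleton {x : S | (x : ℝ) ∉ U}, measure_biUnion_null_iff hc]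
  exact fun x _ => measure_singleton_eq_zero_of_costEnergy hE hdiag hμ x

lemma costEnergy_le_of_le_smul (hE : Measurable E) {μ ν : ProbabilityMeasure S} {c : ℝ≥0∞}
    (h : (ν : Measure S) ≤ c • (μ : Measure S)) :
    costEnergy κ B E ν ≤ c * (c * costEnergy κ B E μ) := by
  have hc : Measurable (cost κ B E) := measurable_cost hE
  unfold costEnergy
  rw [lintegral_prod _ hc.aemeasurable, lintegral_prod _ hc.aemeasurable]
  calc ∫⁻ x, ∫⁻ y, cost κ B E (x, y) ∂(ν : Measure S) ∂(ν : Measure S)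
      ≤ ∫⁻ x, c * ∫⁻ y, cost κ B E (x, y) ∂(μ : Measure S) ∂(ν : Measure S) := by
        refine lintegral_mono fun x => ?_
        refine (lintegral_mono' h le_rfl).trans ?_
        rw [lintegral_smul_measure, smul_eq_mul]
    _ ≤ c * ∫⁻ x, c * ∫⁻ y, cost κ B E (x, y) ∂(μ : Measure S) ∂(μ : Measure S) := by
        refine (lintegral_mono' h le_rfl).trans ?_
        rw [lintegral_smul_measure, smul_eq_mul]
    _ = _ := by rw [lintegral_const_mul _ hc.lintegral_prod_right']

lemma tendsto_cond {μ : ProbabilityMeasure S} {A : ℕ → Set S} (hA : ∀ n, MeasurableSet (A n))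
    (ν : ℕ → ProbabilityMeasure S)
    (hν : ∀ n, (ν n : Measure S) = ((μ : Measure S) (A n))⁻¹ • (μ : Measure S).restrict (A n))
    (hlim : Tendsto (fun n => (μ : Measure S) (A n)) atTop (𝓝 1)) :
    Tendsto ν atTop (𝓝 μ) := by
  rw [ProbabilityMeasure.tendsto_iff_forall_integral_tendsto]
  intro f
  have hf : Integrable (fun x => f x) (μ : Measure S) := f.integrable _
  have hr : Tendsto (fun n => (μ : Measure S).real (A n)) atTop (𝓝 1) := by
    simpa [Measure.real, Function.comp_def] using (ENNReal.tendsto_toReal ENNReal.one_ne_top).comp hlim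
  have h1 : ∀ n, ∫ x, f x ∂(ν n : Measure S) =
      ((μ : Measure S).real (A n))⁻¹ * ∫ x in A n, f x ∂(μ : Measure S) := fun n => by
    rw [hν, integral_smul_measure, smul_eq_mul, ENNReal.toReal_inv, Measure.real]
  have h2 : Tendsto (fun n => ∫ x in A n, f x ∂(μ : Measure S)) atTop
      (𝓝 (∫ x, f x ∂(μ : Measure S))) := by
    rw [tendsto_iff_dist_tendsto_zero]
    have h3 : Tendsto (fun n => ‖f‖ * (1 - (μ : Measure S).real (A n))) atTop (𝓝 0) := by
      simpa using (hr.const_sub 1).const_mul ‖f‖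
    refine squeeze_zero (fun _ => dist_nonneg) (fun n => ?_) h3
    rw [Real.dist_eq, ← integral_add_compl (hA n) hf, sub_add_cancel_left, abs_neg,
      ← Real.norm_eq_abs]
    have h4 := norm_setIntegral_le_of_norm_le_const (μ := (μ : Measure S)) (s := (A n)ᶜ)
      (f := fun x => f x) (C := ‖f‖) (measure_lt_top _ _) fun x _ => f.norm_coe_le_norm x
    rwa [probReal_compl_eq_one_sub (hA n)] at h4
  simp_rw [h1]
  simpa using (hr.inv₀ one_ne_zero).mul h2

/-- A measure of finite energy is approximated, together with its energy, by measures carried by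
compact subsets of an open set of full measure. -/
lemma exists_compact_approx (hE : Measurable E) {μ : ProbabilityMeasure S} {U : Set ℝ}
    (hU : IsOpen U) (hμU : ∀ᵐ x : S ∂(μ : Measure S), (x : ℝ) ∈ U) {G : Set (ProbabilityMeasure S)}
    (hG : G ∈ 𝓝 μ) {a : ℝ≥0∞} (ha : costEnergy κ B E μ < a) :
    ∃ (ν : ProbabilityMeasure S) (K : Set ℝ), ν ∈ G ∧ IsCompact K ∧ K ⊆ U ∧
      (∀ᵐ x : S ∂(ν : Measure S), (x : ℝ) ∈ K) ∧ costEnergy κ B E ν < a := by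
  have hval : Measurable (Subtype.val : S → ℝ) := measurable_subtype_coe
  have hmapU : ((μ : Measure S).map Subtype.val) U = 1 := by
    rw [Measure.map_apply hval hU.measurableSet]
    exact (prob_compl_eq_zero_iff (hval hU.measurableSet)).1 hμU
  have : IsProbabilityMeasure ((μ : Measure S).map (Subtype.val : S → ℝ)) :=
    Measure.isProbabilityMeasure_map hval.aemeasurable
  have hex : ∀ n : ℕ, ∃ K ⊆ U, IsCompact K ∧
      1 - ((n : ℝ≥0∞) + 1)⁻¹ < ((μ : Measure S).map Subtype.val) K := fun n => by
    refine hU.exists_lt_isCompact ?_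
    rw [hmapU]
    exact ENNReal.sub_lt_self (by simp) one_ne_zero (by simp)
  choose K hKU hK hKlt using hex
  set A : ℕ → Set S := fun n => Subtype.val ⁻¹' K n with hAdef
  have hA : ∀ n, MeasurableSet (A n) := fun n => hval (hK n).measurableSet
  have hμA : ∀ n, ((μ : Measure S).map Subtype.val) (K n) = (μ : Measure S) (A n) := fun n =>
    Measure.map_apply hval (hK n).measurableSet
  have hpos : ∀ n, (μ : Measure S) (A n) ≠ 0 := fun n => by
    rw [← hμA]; exact (lt_of_le_of_lt zero_le (hKlt n)).ne'
  have hlim : Tendsto (fun n => (μ : Measure S) (A n)) atTop (𝓝 1) := by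
    have h1 : Tendsto (fun n : ℕ => 1 - ((n : ℝ≥0∞) + 1)⁻¹) atTop (𝓝 1) := by
      have h0 : Tendsto (fun n : ℕ => ((n : ℝ≥0∞) + 1)⁻¹) atTop (𝓝 0) := by
        have := ENNReal.tendsto_inv_nat_nhds_zero.comp (tendsto_add_atTop_nat 1)
        simpa [Function.comp_def] using this
      simpa using ENNReal.Tendsto.sub tendsto_const_nhds h0 (Or.inl ENNReal.one_ne_top)
    refine tendsto_of_tendsto_of_tendsto_of_le_of_le h1 tendsto_const_nhds (fun n => ?_)
      fun n => prob_le_one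
    rw [← hμA]; exact (hKlt n).le
  let ν : ℕ → ProbabilityMeasure S := fun n =>
    ⟨((μ : Measure S) (A n))⁻¹ • (μ : Measure S).restrict (A n), ⟨by
      simp [ENNReal.inv_mul_cancel (hpos n) (measure_ne_top _ _)]⟩⟩
  have hν : ∀ n, (ν n : Measure S) =
      ((μ : Measure S) (A n))⁻¹ • (μ : Measure S).restrict (A n) := fun n => rfl
  -- Conditioning on `A n` multiplies the energy by at most μ(A n)⁻², which tends to 1.
  have hcl : Tendsto (fun n => ((μ : Measure S) (A n))⁻¹ *
      (((μ : Measure S) (A n))⁻¹ * costEnergy κ B E μ)) atTop (𝓝 (costEnergy κ B E μ)) := by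
    have h1 : Tendsto (fun n => ((μ : Measure S) (A n))⁻¹) atTop (𝓝 1) := by
      simpa using tendsto_inv_iff.2 hlim
    have h2 := ENNReal.Tendsto.mul h1 (Or.inl one_ne_zero)
      (ENNReal.Tendsto.mul_const h1 (Or.inl one_ne_zero) (b := costEnergy κ B E μ))
      (Or.inr ENNReal.one_ne_top)
    simpa using h2
  obtain ⟨n, hn1, hn2⟩ := ((tendsto_cond hA ν hν hlim).eventually_mem hG |>.and
    (hcl.eventually_lt_const ha)).exists
  refine ⟨ν n, K n, hn1, hK n, hKU n, ?_, lt_of_le_of_lt (costEnergy_le_of_le_smul hE ?_) hn2⟩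
  · rw [hν]
    exact Measure.ae_smul_measure (ae_restrict_mem (hA n)) _
  · rw [hν]
    intro s
    simp only [Measure.smul_apply, smul_eq_mul]
    gcongr
    exact Measure.restrict_le_self

end Approximation

section Regular

variable {S : Set ℝ} {θ : ℕ} {κ : ℝ} {w : ℝ → ℝ}

/-! ### The interaction away from the zeros of the weight -/

/-- The sum is the quotient (x^θ - y^θ)/(x - y). If it vanished, injectivity of the power on S would
force x = y, where its value is θ x^(θ-1). For θ > 1 this degenerates only at the origin. -/
lemma geom_sum_ne_zero (hθ : 0 < θ) (hSeven : Even θ → S ⊆ Ici 0) {x y : ℝ} (hx : x ∈ S)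
    (hy : y ∈ S) (hx0 : x ≠ 0) : ∑ i ∈ Finset.range θ, x ^ i * y ^ (θ - 1 - i) ≠ 0 := by
  intro h
  have h1 := (Commute.all x y).geom_sum₂_mul θ
  rw [h, zero_mul] at h1
  have h2 : x ^ θ = y ^ θ := by linarith
  have hxy : x = y := by
    rcases Nat.even_or_odd θ with he | ho
    · exact (pow_left_inj₀ (hSeven he hx) (hSeven he hy) hθ.ne').1 h2
    · exact ho.strictMono_pow.injective h2
  subst hxy
  have h3 : ∑ i ∈ Finset.range θ, x ^ i * x ^ (θ - 1 - i) = θ * x ^ (θ - 1) := by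
    rw [Finset.sum_congr rfl (g := fun _ => x ^ (θ - 1))]
    · simp
    · intro i hi
      rw [Finset.mem_range] at hi
      rw [← pow_add]; congr 1; omega
  rw [h3] at h
  have : (θ : ℝ) ≠ 0 := by exact_mod_cast hθ.ne'
  exact mul_ne_zero this (pow_ne_zero _ hx0) h

/-- The interaction equals q(x,y) |x - y|² with q continuous and strictly positive on the compact
set K × K. -/
lemma exists_limitPair_bounds (hκ : 0 < κ) (hθ : 0 < θ) (hSeven : Even θ → S ⊆ Ici 0)
    (hwc : ContinuousOn w S) (hw0 : ∀ x ∈ S, 0 ≤ w x) {K : Set ℝ} (hK : IsCompact K)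
    (hKS : K ⊆ S) (hKw : ∀ x ∈ K, w x ≠ 0) (hK0 : (0 : ℝ) ∉ K) :
    ∃ c C : ℝ, 0 < c ∧ 0 < C ∧ ∀ x y : S, (x : ℝ) ∈ K → (y : ℝ) ∈ K →
      c * |(x : ℝ) - y| ^ 2 ≤ limitPair S θ κ w (x, y) ∧
        limitPair S θ κ w (x, y) ≤ C * |(x : ℝ) - y| ^ 2 := by
  set q : ℝ × ℝ → ℝ := fun z => |∑ i ∈ Finset.range θ, z.1 ^ i * z.2 ^ (θ - 1 - i)| *
    (w z.1 ^ (1 / κ) * w z.2 ^ (1 / κ)) with hq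
  have hwK : ContinuousOn w K := hwc.mono hKS
  have hk : 0 ≤ 1 / κ := by positivity
  have hqc : ContinuousOn q (K ×ˢ K) := by
    have h1 : ContinuousOn (fun x => w x ^ (1 / κ)) K := hwK.rpow_const fun x _ => Or.inr hk
    have h2 : ContinuousOn (fun z : ℝ × ℝ => w z.1 ^ (1 / κ)) (K ×ˢ K) :=
      h1.comp continuousOn_fst fun z hz => hz.1
    have h3 : ContinuousOn (fun z : ℝ × ℝ => w z.2 ^ (1 / κ)) (K ×ˢ K) :=
      h1.comp continuousOn_snd fun z hz => hz.2
    refine ContinuousOn.mul ?_ (h2.mul h3)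
    fun_prop
  have hwpos : ∀ x ∈ K, 0 < w x := fun x hx => lt_of_le_of_ne (hw0 x (hKS hx)) (hKw x hx).symm
  have hqpos : ∀ z ∈ K ×ˢ K, 0 < q z := by
    intro z hz
    have h1 := geom_sum_ne_zero hθ hSeven (hKS hz.1) (hKS hz.2) fun h => hK0 (h ▸ hz.1)
    have h2 := hwpos _ hz.1
    have h3 := hwpos _ hz.2
    rw [hq]
    positivity
  obtain ⟨c, hc, hcle⟩ := (hK.prod hK).exists_forall_le' hqc hqpos
  obtain ⟨C, hC⟩ := (hK.prod hK).exists_bound_of_continuousOn hqc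
  refine ⟨c, |C| + 1, hc, by positivity, fun x y hx hy => ?_⟩
  have hrep : limitPair S θ κ w (x, y) = q (x, y) * |(x : ℝ) - y| ^ 2 := by
    unfold limitPair pairWeight
    simp only [hq]
    rw [← (Commute.all (x : ℝ) (y : ℝ)).geom_sum₂_mul θ, abs_mul]
    ring
  rw [hrep]
  have h1 := hcle (x, y) ⟨hx, hy⟩
  have h2 := hC (x, y) ⟨hx, hy⟩
  rw [Real.norm_eq_abs] at h2
  constructor
  · gcongr
  · gcongr
    linarith [le_abs_self (q (x, y)), le_abs_self C]

/-- Measures of finite energy are approximated, together with their energy, by measures with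
bounded density carried by a compact set away from the zeros of the weight. -/
lemma exists_bounded_density_approx (hκ : 0 < κ) (hθ : 0 < θ) (hSclosed : IsClosed S)
    (hSeven : Even θ → S ⊆ Ici 0) (hSfr : (frontier S).Countable)
    (hwc : ContinuousOn w S) (hw0 : ∀ x ∈ S, 0 ≤ w x) (hfin : (zerosIn S w).Finite) {B : ℝ}
    {μ : ProbabilityMeasure S} {G : Set (ProbabilityMeasure S)} (hG : IsOpen G) (hμ : μ ∈ G)
    {a : ℝ≥0∞} (ha : costEnergy κ B (limitPair S θ κ w) μ < a) :
    ∃ (ν : ProbabilityMeasure S) (K : Set ℝ) (M : ℝ), ν ∈ G ∧ IsCompact K ∧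
      K ⊆ S \ zerosIn S w ∧ (∀ᵐ x : S ∂(ν : Measure S), (x : ℝ) ∈ K) ∧ 0 < M ∧
      (ν : Measure S) ≤ ENNReal.ofReal M • (volume : Measure ℝ).comap (Subtype.val : S → ℝ) ∧
      costEnergy κ B (limitPair S θ κ w) ν < a := by
  have hS := hSclosed.measurableSet
  have hEc : Continuous (limitPair S θ κ w) := continuous_limitPair hκ hwc
  have hE0 : ∀ z, 0 ≤ limitPair S θ κ w z := limitPair_nonneg hw0
  -- The origin is removed along with the zeros of w, since x^θ - y^θ need not be comparable to x -
  -- y there. The loss is countable, hence invisible to measures of finite energy.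
  set U := interior S \ (zerosIn S w ∪ {0}) with hUdef
  have hU : IsOpen U :=
    isOpen_interior.sdiff (hfin.union (finite_singleton 0)).isClosed
  have hUc : (S \ U).Countable := by
    refine (hSfr.union (hfin.union (finite_singleton 0)).countable).mono ?_
    rintro x ⟨hxS, hxU⟩
    by_cases hx : x ∈ interior S
    · exact Or.inr (by_contra fun h => hxU ⟨hx, h⟩)
    · exact Or.inl ⟨subset_closure hxS, hx⟩
  have hdiag : ∀ x, limitPair S θ κ w (x, x) = 0 := fun x => by
    simp [limitPair, pairWeight]
  have hμU := ae_mem_of_countable_diff hEc.measurable hdiag (ha.trans_le le_top).ne hUc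
  obtain ⟨ρ, K, hρG, hK, hKU, hρK, hρa⟩ :=
    exists_compact_approx hEc.measurable hU hμU (hG.mem_nhds hμ) ha
  obtain ⟨δ₀, hδ₀, hsub⟩ := hK.exists_cthickening_subset_open hU hKU
  set K' := Metric.cthickening δ₀ K
  have hK' : IsCompact K' := hK.cthickening
  have hK'S : K' ⊆ S := fun x hx => interior_subset (hsub hx).1
  obtain ⟨c, C, hc, hC, hcC⟩ := exists_limitPair_bounds hκ hθ hSeven hwc hw0 hK' hK'S
    (fun x hx h => (hsub hx).2 (Or.inl ⟨hK'S hx, h⟩)) (fun h => (hsub h).2 (Or.inr rfl))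
  have hKK' : K ⊆ K' := Metric.self_subset_cthickening K
  set δ : ℕ → ℝ := fun n => 1 / ((n : ℝ) + 1)
  have hδ : ∀ n, 0 < δ n := fun n => by positivity
  have hδt : Tendsto δ atTop (𝓝 0) := tendsto_one_div_add_atTop_nhds_zero_nat
  have h1 := tendsto_costEnergy_smear (B := B) hκ hS hEc hE0 hc hC hK'S
    (fun x y hx hy => (hcC x y hx hy).1)
    (fun x y hx hy => (hcC x y (hKK' hx) (hKK' hy)).2) hρK (hρa.trans_le le_top).ne hδ hδt hδ₀
  obtain ⟨n, hn1, hn2, hn3⟩ := ((tendsto_smear hS ρ hδt).eventually_mem (hG.mem_nhds hρG) |>.and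
    ((h1.eventually_lt_const hρa).and (hδt.eventually_le_const hδ₀))).exists
  refine ⟨smear hS (δ n) ρ, K', (δ n)⁻¹, hn1, hK', fun x hx => ⟨hK'S hx, fun h =>
    (hsub hx).2 (Or.inl h)⟩, ae_smear hS hρK hK'S (hδ n) hn3, inv_pos.2 (hδ n),
    smear_le hS hρK hK'S (hδ n) hn3, hn2⟩

/-- Smear a point mass at an interior point of S that is neither a zero of w nor the origin. -/
lemma exists_costEnergy_ne_top (hκ : 0 < κ) (hθ : 0 < θ) (hSclosed : IsClosed S)
    (hSeven : Even θ → S ⊆ Ici 0) (hSint : (interior S).Nonempty)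
    (hwc : ContinuousOn w S) (hw0 : ∀ x ∈ S, 0 ≤ w x) (hfin : (zerosIn S w).Finite) (B : ℝ) :
    ∃ μ : ProbabilityMeasure S, costEnergy κ B (limitPair S θ κ w) μ ≠ ∞ := by
  have hF := hfin.union (finite_singleton (0 : ℝ))
  have hU : IsOpen (interior S \ (zerosIn S w ∪ {0})) := isOpen_interior.sdiff hF.isClosed
  obtain ⟨x, hx⟩ : (interior S \ (zerosIn S w ∪ {0})).Nonempty :=
    ((infinite_of_mem_nhds _ (isOpen_interior.mem_nhds hSint.some_mem)).sdiff hF).nonempty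
  obtain ⟨δ₀, hδ₀, hsub⟩ := isCompact_singleton.exists_cthickening_subset_open hU
    (singleton_subset_iff.2 hx)
  have hK'S : Metric.cthickening δ₀ {x} ⊆ S := fun y hy => interior_subset (hsub hy).1
  obtain ⟨c, C, hc, -, hcC⟩ := exists_limitPair_bounds hκ hθ hSeven hwc hw0
    isCompact_singleton.cthickening hK'S
    (fun y hy h => (hsub hy).2 (Or.inl ⟨hK'S hy, h⟩)) (fun h => (hsub h).2 (Or.inr rfl))
  let ν : ProbabilityMeasure S := ⟨Measure.dirac ⟨x, interior_subset hx.1⟩, inferInstance⟩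
  refine ⟨smear hSclosed.measurableSet δ₀ ν, costEnergy_smear_ne_top hκ _
    (continuous_limitPair hκ hwc).measurable hc hK'S (fun y z hy hz => (hcC y z hy hz).1)
    hδ₀ le_rfl (K := {x}) ?_⟩
  change ∀ᵐ y : S ∂(Measure.dirac (⟨x, interior_subset hx.1⟩ : S)), (y : ℝ) ∈ ({x} : Set ℝ)
  rw [ae_dirac_iff (measurable_subtype_coe (measurableSet_singleton x))]
  rfl

end Regular

section Restriction

variable {S : Set ℝ}

/-! ### Integration over powers of a closed set -/

/-- Lebesgue measure on a subset of the line. -/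
def lebesgueOn (S : Set ℝ) : Measure S := (volume : Measure ℝ).comap Subtype.val

lemma map_lebesgueOn (hS : IsClosed S) :
    (lebesgueOn S).map Subtype.val = (volume : Measure ℝ).restrict S :=
  map_comap_subtype_coe hS.measurableSet _

lemma sigmaFinite_lebesgueOn (hS : IsClosed S) : SigmaFinite (lebesgueOn S) :=
  SigmaFinite.of_map _ measurable_subtype_coe.aemeasurable (by
    rw [map_lebesgueOn hS]; infer_instance)

lemma integrable_inv_one_add_sq_lebesgueOn (hS : IsClosed S) :
    Integrable (fun x : S => (1 + (x : ℝ) ^ 2)⁻¹) (lebesgueOn S) := by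
  refine ((MeasurableEmbedding.subtype_coe hS.measurableSet).integrable_map_iff
    (g := fun x : ℝ => (1 + x ^ 2)⁻¹)).1 ?_
  rw [map_lebesgueOn hS]
  exact integrable_inv_one_add_sq.integrableOn

lemma measurableEmbedding_incl (hS : IsClosed S) (m : ℕ) : MeasurableEmbedding (incl S m) := by
  have : StandardBorelSpace S := hS.measurableSet.standardBorel
  refine Measurable.measurableEmbedding ?_ fun x y h => funext fun i =>
    Subtype.val_injective (congrFun h i)
  exact measurable_pi_lambda _ fun i => measurable_subtype_coe.comp (measurable_pi_apply i)

lemma range_incl (m : ℕ) : range (incl S m) = univ.pi fun _ => S := by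
  ext y
  refine ⟨?_, fun h => ⟨fun i => ⟨y i, h i trivial⟩, rfl⟩⟩
  rintro ⟨x, rfl⟩ i -
  exact (x i).2

lemma map_incl_pi_lebesgueOn (hS : IsClosed S) (m : ℕ) :
    (Measure.pi fun _ : Fin m => lebesgueOn S).map (incl S m) =
      (volume : Measure (Fin m → ℝ)).restrict (univ.pi fun _ => S) := by
  have := sigmaFinite_lebesgueOn hS
  have : SigmaFinite ((lebesgueOn S).map Subtype.val) := by
    rw [map_lebesgueOn hS]; infer_instance
  rw [volume_pi, Measure.restrict_pi_pi]
  simp_rw [← map_lebesgueOn hS]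
  exact Measure.pi_map_pi fun _ => measurable_subtype_coe.aemeasurable

/-- The integral of the unnormalised density over a subset of `S^m`. -/
def partialPartitionFn (S : Set ℝ) (θ n m : ℕ) (w : ℝ → ℝ) (A : Set (Fin m → S)) : ℝ≥0∞ :=
  ∫⁻ x in A, ENNReal.ofReal (density S θ n m w (incl S m x))
    ∂(Measure.pi fun _ : Fin m => lebesgueOn S)

/-- The set A is arbitrary, since restriction along a measurable embedding needs no measurability of
A. Preimages of weakly open or closed sets can thus be inserted directly. -/
lemma lintegral_image_incl (hS : IsClosed S) (θ n m : ℕ) (w : ℝ → ℝ) (A : Set (Fin m → S)) :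
    ∫⁻ x in incl S m '' A, ENNReal.ofReal (density S θ n m w x) =
      partialPartitionFn S θ n m w A := by
  have he := measurableEmbedding_incl hS m
  have hsub : incl S m '' A ⊆ univ.pi fun _ => S := by
    rw [← range_incl]; exact image_subset_range _ _
  rw [← Measure.restrict_restrict_of_subset hsub, ← map_incl_pi_lebesgueOn hS, he.restrict_map,
    he.lintegral_map, he.injective.preimage_image, partialPartitionFn]

lemma partitionFn_eq (hS : IsClosed S) (θ n m : ℕ) (w : ℝ → ℝ) :
    partitionFn S θ n m w = partialPartitionFn S θ n m w univ := by
  rw [← lintegral_image_incl hS, image_univ, range_incl, ← lintegral_indicator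
    (MeasurableSet.univ_pi fun _ => hS.measurableSet), partitionFn]
  refine lintegral_congr fun x => ?_
  by_cases hx : x ∈ univ.pi fun _ => S
  · rw [indicator_of_mem hx]
  · rw [indicator_of_notMem hx, density, indicator_of_notMem, ENNReal.ofReal_zero]
    simpa using hx

lemma ensembleOn_apply (hS : IsClosed S) (θ n m : ℕ) (w : ℝ → ℝ) (A : Set (Fin m → S)) :
    ensembleOn S θ n m w A =
      (partialPartitionFn S θ n m w univ)⁻¹ * partialPartitionFn S θ n m w A := by
  rw [ensembleOn, (measurableEmbedding_incl hS m).comap_apply, ensemble, Measure.smul_apply,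
    withDensity_apply', lintegral_image_incl hS, partitionFn_eq hS, smul_eq_mul]

end Restriction

lemma isCompact_log_one_add_abs_le {S : Set ℝ} (hS : IsClosed S) {δ : ℝ} (hδ : 0 < δ) (r : ℝ) :
    IsCompact {x : S | δ * Real.log (1 + |(x : ℝ)|) ≤ r} := by
  have h1 : IsCompact ((Subtype.val : S → ℝ) ⁻¹' (Icc (-Real.exp (r / δ)) (Real.exp (r / δ)))) :=
    hS.isClosedEmbedding_subtypeVal.isCompact_preimage isCompact_Icc
  have hc : Continuous fun x : S => δ * Real.log (1 + |(x : ℝ)|) :=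
    continuous_const.mul (Continuous.log (by fun_prop) fun x => by positivity)
  refine h1.of_isClosed_subset (isClosed_le hc continuous_const) fun x hx => ?_
  have h2 : Real.log (1 + |(x : ℝ)|) ≤ r / δ := by
    rw [le_div_iff₀ hδ, mul_comm]; exact hx
  have h3 := (Real.log_le_iff_le_exp (by positivity)).1 h2
  exact abs_le.1 (by linarith)

section Shift

variable {X : Type*} {f : X → ℝ≥0∞} {b : ℝ}

/-! ### Shifting a nonnegative functional by a constant -/

lemma coe_le_coe_sub (t : ℝ≥0∞) (b : ℝ) : ((-b : ℝ) : EReal) ≤ (t : EReal) - (b : EReal) := by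
  rw [EReal.coe_neg, ← zero_sub]
  exact EReal.sub_le_sub (EReal.coe_ennreal_nonneg t) le_rfl

/-- The sign condition is essential: for a + b < 0 the right side would be truncated to t ≤ 0. -/
lemma coe_sub_le_coe_iff {t : ℝ≥0∞} {a : ℝ} (hab : 0 ≤ a + b) :
    (t : EReal) - (b : EReal) ≤ (a : EReal) ↔ t ≤ ENNReal.ofReal (a + b) := by
  rw [EReal.sub_le_iff_le_add (Or.inl (EReal.coe_ne_bot b)) (Or.inl (EReal.coe_ne_top b)),
    ← EReal.coe_add, ← EReal.coe_ennreal_le_coe_ennreal_iff, EReal.coe_ennreal_ofReal,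
    max_eq_left hab]

lemma coe_le_coe_sub_iff {t : ℝ≥0∞} {a : ℝ} (hab : 0 ≤ a + b) :
    (a : EReal) ≤ (t : EReal) - (b : EReal) ↔ ENNReal.ofReal (a + b) ≤ t := by
  rw [EReal.le_sub_iff_add_le (Or.inl (EReal.coe_ne_bot b)) (Or.inl (EReal.coe_ne_top b)),
    ← EReal.coe_add, ← EReal.coe_ennreal_le_coe_ennreal_iff, EReal.coe_ennreal_ofReal,
    max_eq_left hab]

lemma setOf_coe_sub_le_eq_empty {a : ℝ} (hab : a + b < 0) :
    {x | (f x : EReal) - (b : EReal) ≤ (a : EReal)} = ∅ := by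
  refine eq_empty_of_forall_notMem fun x hx => ?_
  have h := EReal.coe_le_coe_iff.1 ((coe_le_coe_sub (f x) b).trans hx)
  linarith

variable [TopologicalSpace X]

lemma isCompact_setOf_coe_sub_le (hf : ∀ a : ℝ, IsCompact {x | f x ≤ ENNReal.ofReal a}) (a : ℝ) :
    IsCompact {x | (f x : EReal) - (b : EReal) ≤ (a : EReal)} := by
  rcases lt_or_ge (a + b) 0 with hab | hab
  · rw [setOf_coe_sub_le_eq_empty hab]; exact isCompact_empty
  · simpa only [coe_sub_le_coe_iff hab] using hf (a + b)

lemma lowerSemicontinuous_coe_sub (hf : LowerSemicontinuous f) :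
    LowerSemicontinuous fun x => (f x : EReal) - (b : EReal) := by
  rw [lowerSemicontinuous_iff_isClosed_preimage]
  intro a
  change IsClosed {x | (f x : EReal) - (b : EReal) ≤ a}
  induction a with
  | bot =>
    convert isClosed_empty
    refine eq_empty_of_forall_notMem fun x hx => ?_
    exact (EReal.bot_lt_coe (-b)).not_ge ((coe_le_coe_sub (f x) b).trans hx)
  | top => simp
  | coe a =>
    rcases lt_or_ge (a + b) 0 with hab | hab
    · rw [setOf_coe_sub_le_eq_empty hab]; exact isClosed_empty
    · simp only [coe_sub_le_coe_iff hab]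
      exact (lowerSemicontinuous_iff_isClosed_preimage.1 hf) _

end Shift

end BiorthogonalLDP

end

/-! ### The large deviations principle -/

open BiorthogonalLDP in
theorem theorem2p1
    (θ : ℕ) (hθ : 0 < θ)
    (S : Set ℝ) (hSclosed : IsClosed S) (hSeven : Even θ → S ⊆ Ici 0)
    (hSint : (interior S).Nonempty) (hSfr : (frontier S).Countable)
    (p : ℕ → ℕ) (hp : ∀ n, 0 < p n)
    (κ : ℝ) (hκ : 0 < κ)
    (hpκ : Tendsto (fun n : ℕ => (p n : ℝ) / (n : ℝ)) atTop (𝓝 κ))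
    (wn : ℕ → ℝ → ℝ)
    (hwn_cont : ∀ n, ContinuousOn (wn n) S) (hwn_nonneg : ∀ n, ∀ x ∈ S, 0 ≤ wn n x)
    (w : ℝ → ℝ) (ha1 : WeightsConverge S wn w) (ha2 : TailDecay S θ κ wn) :
    (∀ᶠ n in atTop, partitionFn S θ n (p n) (wn n) ≠ 0 ∧
        partitionFn S θ n (p n) (wn n) ≠ ∞ ∧
        IsProbabilityMeasure (ensembleOn S θ n (p n) (wn n))) ∧
    ∃ c : ℝ,
      Tendsto (fun n : ℕ => ENNReal.log (partitionFn S θ n (p n) (wn n)) /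
          (((n : ℝ) ^ 2 : ℝ) : EReal)) atTop (𝓝 (c : EReal)) ∧
      (c : EReal) = -(⨅ μ : ProbabilityMeasure S, energy S θ κ w μ) ∧
      SatisfiesLDP (fun n => ensembleOn S θ n (p n) (wn n)) (fun n => empirical (hp n))
        (fun n => (n : ℝ) ^ 2) (fun μ => energy S θ κ w μ + (c : EReal)) := by
  obtain ⟨C, δ, hC, hδ, hle, hlim⟩ := exists_pairedWeight_le hκ hpκ hSclosed hwn_nonneg ha1 ha2
  have hC0 : 0 ≤ C := zero_le_one.trans hC
  -- Since E ≤ C², the extra 1 leaves room for the regularisation η ≤ 1 and makes E < B strict.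
  obtain ⟨B, hBC⟩ : ∃ B, B = C ^ 2 + 1 := ⟨_, rfl⟩
  have hB : 0 < B := by rw [hBC]; positivity
  set E := limitPair S θ κ w
  -- This is the decay (1 + |x|)^(-δ) of the normalised weights, written as exp(-g(x)).
  set g : S → ℝ := fun x => δ * Real.log (1 + |(x : ℝ)|)
  obtain ⟨b, hb⟩ : ∃ b, b = κ ^ 2 / 2 * Real.log B := ⟨_, rfl⟩
  have hg0 : ∀ x, 0 ≤ g x := fun x =>
    mul_nonneg hδ.le (Real.log_nonneg (by linarith [abs_nonneg (x : ℝ)]))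
  have hg : Measurable g := by fun_prop
  have hgc : ∀ r, IsCompact {x | g x ≤ r} := isCompact_log_one_add_abs_le hSclosed hδ
  have hEc : Continuous E := continuous_limitPair hκ ha1.continuousOn
  have hE0 : ∀ z, 0 ≤ E z := limitPair_nonneg ha1.nonneg
  have hEg : ∀ x y, E (x, y) ≤ C ^ 2 * Real.exp (-g x - g y) := limitPair_le_exp ha1 hC0 hlim
  have hEC : ∀ z, E z + 1 ≤ B := fun z => by
    have h1 : Real.exp (-g z.1 - g z.2) ≤ 1 :=
      Real.exp_le_one_iff.2 (by linarith [hg0 z.1, hg0 z.2])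
    have h2 := mul_le_mul_of_nonneg_left h1 (sq_nonneg C)
    have h3 := hEg z.1 z.2
    rw [hBC]
    linarith
  have hEB : ∀ z, E z < B := fun z => by linarith [hEC z]
  have hEgB : ∀ x y, E (x, y) ≤ B * Real.exp (-g x - g y) := fun x y =>
    (hEg x y).trans (mul_le_mul_of_nonneg_right (by simp [hBC]) (Real.exp_pos _).le)
  have hen : ∀ μ, energy S θ κ w μ = (costEnergy κ B E μ : EReal) - (b : EReal) :=
    hb ▸ energy_eq hκ ha1.continuousOn ha1.nonneg (by nlinarith) fun z => (hEB z).le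
  have := sigmaFinite_lebesgueOn hSclosed
  obtain ⟨μ₀, hμ₀⟩ := exists_costEnergy_ne_top hκ hθ hSclosed hSeven hSint ha1.continuousOn
    ha1.nonneg ha1.finite_zeros B
  obtain ⟨hZ, c, hc⟩ := satisfiesLDP_of_exponential_bounds
    (fun n => ensembleOn S θ n (p n) (wn n)) (fun n => empirical (hp n))
    (fun n A => partialPartitionFn S θ n (p n) (wn n) (empirical (hp n) ⁻¹' A))
    (fun n A => ensembleOn_apply hSclosed _ _ _ _ _)
    (energy S θ κ w)
    (by simpa only [← hen] using
      lowerSemicontinuous_coe_sub (b := b) (lowerSemicontinuous_costEnergy (B := B) hκ hEc hE0))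
    (by simpa only [← hen] using
      isCompact_setOf_coe_sub_le (b := b) (isCompact_costEnergy_le hκ hB hEc hg hg0 hgc hE0 hEgB))
    (-b) (fun μ => (hen μ).symm ▸ coe_le_coe_sub _ b) μ₀
    (by
      rw [hen]
      lift costEnergy κ B E μ₀ to NNReal using hμ₀ with t
      exact EReal.coe_ne_top ((t : ℝ) - b))
    (fun A hA a c ha hc => by
      refine eventually_lintegral_le hp hκ hpκ hEc hE0 hEC hB hg hg0 hgc
        (h := fun x : S => (1 + (x : ℝ) ^ 2)⁻¹)
        (D := fun n x => density S θ n (p n) (wn n) (incl S (p n) x)) (fun x => by positivity)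
        (by fun_prop)
        (integrable_inv_one_add_sq_lebesgueOn hSclosed)
        (fun η hη _ => eventually_sq_density_le_add hκ hpκ hSclosed hwn_nonneg ha1 hC hδ hle hlim hη)
        (eventually_sq_density_le_exp hκ hpκ hwn_nonneg hC0 (by simp [hBC]) hle) hA (a := a + b)
        (fun μ hμ => ?_) (by linarith)
      -- Levels of the energy are shifted by b to levels of the nonnegative cost; a negative shifted
      -- level only asks for positivity.
      rcases lt_or_ge (a + b) 0 with hab | hab
      · rw [ENNReal.ofReal_of_nonpos hab.le]
        exact costEnergy_pos hκ hEc.measurable hE0 hEB μ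
      · rw [← not_le, ← coe_sub_le_coe_iff hab, ← hen, not_le]
        exact ha μ hμ)
    (fun G hG μ hμ a ha => by
      -- The energy is at least -b everywhere, so an energy below a forces a > -b.
      have hab : 0 ≤ a + b := by
        have h := EReal.coe_lt_coe_iff.1 ((coe_le_coe_sub _ b).trans_lt ((hen μ).symm ▸ ha))
        linarith
      obtain ⟨ν, K, M, hνG, hK, hKS, hνK, hM, hνM, hνa⟩ := exists_bounded_density_approx hκ hθ
        hSclosed hSeven hSfr ha1.continuousOn ha1.nonneg ha1.finite_zeros hG hμ
        (a := ENNReal.ofReal (a + b)) (B := B) (by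
          rw [← not_le, ← coe_le_coe_sub_iff hab, ← hen, not_le]
          exact ha)
      have hνt := (hνa.trans_le le_top).ne
      refine eventually_le_lintegral hp hκ hpκ hEc hE0 (fun z => (hEB z).le)
        (lam := lebesgueOn S) (D := fun n x => density S θ n (p n) (wn n) (incl S (p n) x))
        (fun n x => density_incl_nonneg (hwn_nonneg n) x)
        (fun n => (continuous_density_incl (hwn_cont n)).measurable)
        (K := Subtype.val ⁻¹' K)
        (fun ε hε => eventually_le_sq_density hκ hpκ hwn_nonneg ha1 hKS hK hε)
        hνK hM hνM hνt (hG.mem_nhds hνG) ?_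
      have h := (ENNReal.toReal_lt_of_lt_ofReal hνa)
      linarith)
  simp only [preimage_univ, ← partitionFn_eq hSclosed] at hZ hc
  refine ⟨hZ.mono fun n hn => ⟨hn.1, hn.2, ⟨?_⟩⟩, c, hc⟩
  rw [ensembleOn_apply hSclosed, ← partitionFn_eq hSclosed, ENNReal.inv_mul_cancel hn.1 hn.2]
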